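/- Let $k$ be an algebraically closed field (for instance $k=\mathbb{C}$). A nodal curve over $k$ is a proper reduced $k$-scheme each of whose closed points either is smooth (its local ring is a discrete valuation ring) or is a node (its completed local ring is isomorphic to $k[[x,y]]/(xy)$); it may be reducible or disconnected. Let $C$ be a nodal curve over $k$ and let $L$ be a line bundle on $C$. We write $h^0$ for the $k$-dimension of the space of global sections. For an irreducible component $T$ of $C$, let $C\setminus T$ denote the union of the other components with its reduced structure (the closure of the complement of $T$). A rational leaf of $C$ is an irreducible component $T\cong\mathbb{P}^1_k$ that meets the union of the other irreducible components in a single point $p$; it is attached to the component $U\neq T$ with $p\in U$. The component $U$ may have any genus (in particular, genus $0$ or $1$). (1) Pruning a leaf. Let $T$ be a rational leaf of $C$, attached to $U$ at $p$, and put $C'=C\setminus T$ and $d_T=\deg(L|_T)$. Then $C'$ is again a nodal curve. - If $d_T\ge 0$, then for the line bundle $L'=L|_{C'}$, $$h^0(C,L)=h^0(C',L')+d_T .$$ - If $d_T<0$, then $L'=L|_{C'}\otimes\mathcal{O}_{C'}(-p)$ is a line bundle on $C'$, it satisfies $L'|_U\cong L|_U\otimes\mathcal{O}_U(-p)$ and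 $L'|_{W}\cong L|_{W}$, where $W$ is the union of the components of $C$ other than $T$ and $U$, and $$h^0(C,L)=h^0(C',L').$$ (2) Iteration. If a finite sequence of prunings of rational leaves as in (1) leads from $(C,L)$ to $(C'',L'')$, then $C''$ is a nodal curve, $L''$ is a line bundle on $C''$, and $h^0(C,L)=h^0(C'',L'')+n$, where $n$ is the sum of the degrees of the pruned leaves that had non-negative degree at the moment they were pruned. (3) Removing trees. Let $\mathcal{T}$ be a set of irreducible components of $C$, all isomorphic to $\mathbb{P}^1_k$, that spans a tree in the dual graph of $C$ and is attached to exactly one further component $U$ at exactly one node $p$; that is, the union of the components in $\mathcal{T}$ meets the union of the components not in $\mathcal{T}$ only in the point $p$, and $p\in U\notin\mathcal{T}$. Then there is a finite sequence of prunings as in (1) that leads from $(C,L)$ to a pair whose curve is the union of the components of $C$ that do not lie in $\mathcal{T}$. -/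

import Mathlib

open AlgebraicGeometry CategoryTheory TopologicalSpace

universe u

noncomputable section

namespace NodalPruning

/-! ### Line bundles -/

/-- The structure sheaf of `X`, as a sheaf of modules over itself. -/
abbrev structureSheaf (X : Scheme.{u}) : X.Modules :=
  SheafOfModules.unit X.ringCatSheaf

/-- `g` trivializes `L` over `U`: multiplication by `g` is an isomorphism from the structure sheaf
of `U` to the restriction of `L` to `U`. -/
def IsGenerator {X : Scheme.{u}} (L : X.Modules) {U : X.Opens} (g : Γ(L, U)) : Prop :=
  ∀ (W : X.Opens) (h : W ≤ U),
    Function.Bijective (fun a : Γ(X, W) => (a • L.presheaf.map (homOfLE h).op g : Γ(L, W)))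

/-- A line bundle: a sheaf of modules that is locally free of rank one. -/
def IsLineBundle {X : Scheme.{u}} (L : X.Modules) : Prop :=
  ∀ x : X, ∃ U : X.Opens, x ∈ U ∧ ∃ g : Γ(L, U), IsGenerator L g

/-- The tensor product of two sheaves of modules: the sheafification of the presheaf
`U ↦ Γ(L, U) ⊗ Γ(M, U)`. -/
def tensor {X : Scheme.{u}} (L M : X.Modules) : X.Modules :=
  (PresheafOfModules.sheafification (𝟙 X.ringCatSheaf.obj)).obj
    (PresheafOfModules.Monoidal.tensorObj (R := X.presheaf) L.val M.val)

/-- The restriction of a sheaf of modules along a morphism, `f^* L`. -/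
abbrev restrictTo {X Y : Scheme.{u}} (f : Y ⟶ X) (L : X.Modules) : Y.Modules :=
  (Scheme.Modules.pullback f).obj L

/-- `H⁰(X, L)` is a module over the base ring `k`. -/
abbrev globalSectionsModule {k : Type u} [Field k] {X : Scheme.{u}} (str : X ⟶ Spec (.of k))
    (L : X.Modules) : Module k Γ(L, ⊤) :=
  Module.compHom Γ(L, ⊤) ((Scheme.ΓSpecIso (.of k)).inv ≫ str.appTop).hom

/-- `h⁰(X, L)`, the dimension over `k` of the space of global sections of `L`, as a cardinal. -/
def h0 {k : Type u} [Field k] {X : Scheme.{u}} (str : X ⟶ Spec (.of k)) (L : X.Modules) :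
    Cardinal.{u} :=
  letI := globalSectionsModule str L
  Module.rank k Γ(L, ⊤)

/-! ### Closed subschemes and ideal sheaves -/

/-- The closure of `Z` in `X`, with its reduced induced scheme structure. -/
abbrev reducedSub (X : Scheme.{u}) (Z : Set X) : Scheme.{u} :=
  (Scheme.IdealSheafData.vanishingIdeal (Closeds.closure Z)).subscheme

/-- The closed immersion of `reducedSub X Z` into `X`. -/
abbrev reducedSubι (X : Scheme.{u}) (Z : Set X) : reducedSub X Z ⟶ X :=
  (Scheme.IdealSheafData.vanishingIdeal (Closeds.closure Z)).subschemeι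

/-- The ideal sheaf of `reducedSub X Z`: the kernel of the restriction map from the structure sheaf
of `X` to that of `reducedSub X Z`. For `Z = {p}` with `p` a smooth closed point of a curve, this is
the line bundle `𝒪(-p)`. -/
def idealSheaf (X : Scheme.{u}) (Z : Set X) : X.Modules :=
  Limits.kernel
    (show structureSheaf X ⟶
        (Scheme.Modules.pushforward (reducedSubι X Z)).obj (structureSheaf (reducedSub X Z)) from
      SheafOfModules.unitToPushforwardObjUnit (reducedSubι X Z).toRingCatSheafHom)

/-! ### The degree of a line bundle -/

/-- `D` is the divisor of the rational section `s` of `L`: if `s = a • g` for a local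
generator `g` of `L` at `x`, then `D x` is the order of vanishing of the rational function `a`
at `x`. (It is zero at points that are not of codimension one.) -/
def IsDivisorOf {X : Scheme.{u}} [IsIntegral X] [IsLocallyNoetherian X] (L : X.Modules)
    {V : X.Opens} (s : Γ(L, V)) (D : X →₀ ℤ) : Prop :=
  ∀ (x : X) (U : X.Opens), x ∈ U → ∀ g : Γ(L, U), IsGenerator L g →
    ∀ [Nonempty (U ⊓ V : X.Opens)] (a : Γ(X, U ⊓ V)),
      a • L.presheaf.map (homOfLE (inf_le_left : U ⊓ V ≤ U)).op g =
        L.presheaf.map (homOfLE (inf_le_right : U ⊓ V ≤ V)).op s →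
      D x = Scheme.ord (X.germToFunctionField (U ⊓ V) a) x

/-- `d` is the degree of the divisor of a nonzero rational section of `L`, where `X` is an
integral curve over an algebraically closed field (so that closed points have degree one). -/
def HasDegree {X : Scheme.{u}} (L : X.Modules) (d : ℤ) : Prop :=
  ∃ (_ : IsIntegral X) (_ : IsLocallyNoetherian X) (V : X.Opens) (s : Γ(L, V)) (D : X →₀ ℤ),
    s ≠ 0 ∧ IsDivisorOf L s D ∧ d = D.sum fun _ n => n

open Classical in
/-- The degree of a line bundle on an integral proper curve over an algebraically closed field:
the degree of the divisor of any nonzero rational section. -/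
def degree {X : Scheme.{u}} (L : X.Modules) : ℤ :=
  if h : ∃ d, HasDegree L d then h.choose else 0

/-! ### Nodal curves -/

/-- `x` is a smooth point of a curve: its local ring is a discrete valuation ring. -/
def IsSmoothPoint {X : Scheme.{u}} (x : X) : Prop :=
  ∃ _ : IsDomain (X.presheaf.stalk x), IsDiscreteValuationRing (X.presheaf.stalk x)

/-- `x` is a node: the completed local ring at `x` is isomorphic to `k⟦x, y⟧ / (x * y)`. -/
def IsNode (k : Type u) [Field k] {X : Scheme.{u}} (x : X) : Prop :=
  Nonempty
    (AdicCompletion (IsLocalRing.maximalIdeal (X.presheaf.stalk x)) (X.presheaf.stalk x) ≃+*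
      MvPowerSeries (Fin 2) k ⧸
        Ideal.span {(MvPowerSeries.X 0 * MvPowerSeries.X 1 : MvPowerSeries (Fin 2) k)})

/-- A nodal curve over `k`: a proper reduced `k`-scheme each of whose closed points is either a
smooth point of a curve or a node. It may be reducible or disconnected. -/
structure IsNodalCurve {k : Type u} [Field k] {X : Scheme.{u}} (str : X ⟶ Spec (.of k)) :
    Prop where
  isProper : IsProper str
  isReduced : IsReduced X
  smooth_or_node : ∀ x : X, IsClosed ({x} : Set X) → IsSmoothPoint x ∨ IsNode k x

attribute [local instance] MvPolynomial.gradedAlgebra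

/-- The projective line over `k`. -/
abbrev projectiveLine (k : Type u) [Field k] : Scheme.{u} :=
  Proj (MvPolynomial.homogeneousSubmodule (Fin 2) k)

/-- The structure morphism of the projective line. -/
def projectiveLineStr (k : Type u) [Field k] : projectiveLine k ⟶ Spec (.of k) :=
  Proj.toSpecZero (MvPolynomial.homogeneousSubmodule (Fin 2) k) ≫
    Spec.map (CommRingCat.ofHom
      (algebraMap k (MvPolynomial.homogeneousSubmodule (Fin 2) k 0)))

/-! ### Pairs `(C, L)` and pruning -/

/-- A scheme over `k` together with a sheaf of modules on it. -/
structure Pair (k : Type u) [Field k] where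
  /-- the underlying scheme -/
  C : Scheme.{u}
  /-- its structure morphism -/
  str : C ⟶ Spec (.of k)
  /-- the sheaf -/
  L : C.Modules

namespace Pair

variable {k : Type u} [Field k]

/-- `C` is a nodal curve and `L` a line bundle on it. -/
def IsNodalPair (P : Pair k) : Prop :=
  IsNodalCurve P.str ∧ IsLineBundle P.L

/-- `h⁰(C, L)`. -/
def h0 (P : Pair k) : Cardinal.{u} := NodalPruning.h0 P.str P.L

/-- The reduced curve `T ⊆ C` is isomorphic to the projective line over `k`. -/
def IsRational (P : Pair k) (T : Set P.C) : Prop :=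
  ∃ e : reducedSub P.C T ≅ projectiveLine k,
    e.hom ≫ projectiveLineStr k = reducedSubι P.C T ≫ P.str

/-- `deg (L|_T)`. -/
def degreeOn (P : Pair k) (T : Set P.C) : ℤ :=
  degree (restrictTo (reducedSubι P.C T) P.L)

/-- `T` is a rational leaf of the dual graph of `C`, attached to the vertex `U` at `p`: both are
irreducible components, `T` is a projective line, it meets the union of all other components in
the single point `p`, and `p` lies on `U`. -/
structure IsLeaf (P : Pair k) (T U : Set P.C) (p : P.C) : Prop where
  left_mem : T ∈ irreducibleComponents P.C
  right_mem : U ∈ irreducibleComponents P.C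
  ne : U ≠ T
  isRational : P.IsRational T
  inter_eq : T ∩ ⋃₀ (irreducibleComponents P.C \ {T}) = {p}
  mem : p ∈ U

/-- The curve `C ∖ T`, i.e. the closure of the complement of `T`. -/
abbrev removed (P : Pair k) (T : Set P.C) : Scheme.{u} := reducedSub P.C Tᶜ

/-- The inclusion of `C ∖ T` in `C`. -/
abbrev removedι (P : Pair k) (T : Set P.C) : P.removed T ⟶ P.C := reducedSubι P.C Tᶜ

/-- The pair `(C ∖ T, L|_{C ∖ T})`. -/
def pruneRestrict (P : Pair k) (T : Set P.C) : Pair k where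
  C := P.removed T
  str := P.removedι T ≫ P.str
  L := restrictTo (P.removedι T) P.L

/-- The pair `(C ∖ T, L|_{C ∖ T} ⊗ 𝒪(-p))`. -/
def pruneTwist (P : Pair k) (T : Set P.C) (p : P.C) : Pair k where
  C := P.removed T
  str := P.removedι T ≫ P.str
  L := tensor (restrictTo (P.removedι T) P.L) (idealSheaf (P.removed T) (P.removedι T ⁻¹' {p}))

/-- A sequence of leaf prunings leads from `P` to `Q`, where `j` is the resulting inclusion of the
curve of `Q` in that of `P` and `n` is the total offset. A leaf of degree `d ≥ 0` contributes `d` to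
the offset; a leaf of negative degree contributes nothing and twists the line bundle down. -/
inductive Prunes : (P Q : Pair k) → (Q.C ⟶ P.C) → ℕ → Prop
  | refl (P : Pair k) : Prunes P P (𝟙 P.C) 0
  | restrict {P Q : Pair k} {T U : Set P.C} {p : P.C} (d : ℕ) {n : ℕ}
      {j : Q.C ⟶ (P.pruneRestrict T).C} (leaf : P.IsLeaf T U p)
      (deg : P.degreeOn T = d) (tail : Prunes (P.pruneRestrict T) Q j n) :
      Prunes P Q (j ≫ P.removedι T) (d + n)
  | twist {P Q : Pair k} {T U : Set P.C} {p : P.C} {n : ℕ}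
      {j : Q.C ⟶ (P.pruneTwist T p).C} (leaf : P.IsLeaf T U p)
      (deg : P.degreeOn T < 0) (tail : Prunes (P.pruneTwist T p) Q j n) :
      Prunes P Q (j ≫ P.removedι T) n

/-- The adjacency graph of a set `𝒯` of subsets of `C`: two distinct members are adjacent if they
meet. -/
def meetGraph (P : Pair k) (𝒯 : Set (Set P.C)) : SimpleGraph 𝒯 where
  Adj V W := V ≠ W ∧ ((V : Set P.C) ∩ W).Nonempty
  symm := ⟨fun V W h => ⟨h.1.symm, by rw [Set.inter_comm]; exact h.2⟩⟩
  loopless := ⟨fun _ h => h.1 rfl⟩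

/-- `𝒯` is a tree of rational components of `C` that is attached to exactly one other component
`U` at exactly one node `p`: the subgraph of the dual graph with vertex set `𝒯` is a tree (with no
loops, since the components are projective lines, and no multiple edges, since two of them meet
at most once), and the members of `𝒯` meet the other components only in `p`, which lies on `U`. -/
structure IsRationalTree (P : Pair k) (𝒯 : Set (Set P.C)) (U : Set P.C) (p : P.C) : Prop where
  subset : 𝒯 ⊆ irreducibleComponents P.C
  isRational : ∀ T ∈ 𝒯, P.IsRational T
  isTree : (P.meetGraph 𝒯).IsTree
  simple : ∀ V ∈ 𝒯, ∀ W ∈ 𝒯, V ≠ W → (V ∩ W).Subsingleton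
  right_mem : U ∈ irreducibleComponents P.C \ 𝒯
  inter_eq : ⋃₀ 𝒯 ∩ ⋃₀ (irreducibleComponents P.C \ 𝒯) = {p}
  mem : p ∈ U

end Pair

end NodalPruning

end

/-!
Let `T` be a rational leaf of the nodal curve `C`, attached at `p`, and let `C'` be the closure of its
complement. The attaching point is a node, since at a smooth point one of `T` and `C'` would be all of
`C` near `p`. The algebra of the ring `k⟦x, y⟧ / (x * y)` shows that `C'` is smooth at `p`, because
`T` is, and that the maximal ideal at `p` is the sum of the ideals of `T` and `C'`
(`branch_of_isFormalNode`, `smooth_and_transversal_of_isNode`). So `C'` is nodal, `𝒪(-p)` is a line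
bundle on it (`isLineBundle_idealSheaf`), and sections of `L|_T` and of `L|_{C'}` glue to a section of
`L` as soon as they agree at `p` (`exists_section_of_cover`). In other words,
`0 → L → L|_T ⊕ L|_{C'} → k(p) → 0` is exact.

On the projective line, all divisors are principal up to a multiple of the point at infinity. Hence,
after division by a rational section, the global sections of a line bundle of degree `d` are the
polynomials of degree at most `d` (`LineCharts.exists_parametrization`). If `d ≥ 0`, some section on
`T` is nonzero at `p`, every section on `C'` extends to `C`, and the kernel of the restriction to `C'`
has dimension `d` (`h0_eq_add_h0Vanishing`). If `d < 0`, there are no sections on `T`, and the sections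
on `C` are the sections on `C'` that vanish at `p` (`h0_eq_h0Vanishing`), which are the sections of the
twist by `𝒪(-p)` (`h0_tensor_idealSheaf`).

Line bundles are handled by means of local generators, which are compatible with pullback and tensor
products (`IsGenerator.pullSec`, `IsGenerator.tmul`). The isomorphisms that describe the twisted
bundle come from comparing the images of two multiplication maps (`nonempty_iso_of_generators`).

A tree with several vertices has at least two leaves, so one of them is not the only member through
the attaching point of the tree. It is a rational leaf of the curve, and pruning it leaves a smaller
tree that is attached at the same point (`Pair.IsRationalTree.remove_leaf`).
-/

noncomputable section

/-! ### Sections of sheaves of modules and generators -/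

namespace NodalPruning

variable {X Y : Scheme.{u}}

/-- Restriction of sections of a sheaf of modules to a smaller open set. -/
def resM (M : X.Modules) {W U : X.Opens} (h : W ≤ U) (s : Γ(M, U)) : Γ(M, W) :=
  M.presheaf.map (homOfLE h).op s

/-- Restriction of functions to a smaller open set. -/
def resO {W U : X.Opens} (h : W ≤ U) (a : Γ(X, U)) : Γ(X, W) :=
  X.presheaf.map (homOfLE h).op a

section res
variable (M : X.Modules) {W V U : X.Opens}

@[simp] lemma resM_resM (h : W ≤ V) (h' : V ≤ U) (s : Γ(M, U)) :
    resM M h (resM M h' s) = resM M (h.trans h') s := by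
  simp only [resM, ← ConcreteCategory.comp_apply, ← Functor.map_comp]; rfl

@[simp] lemma resM_self (s : Γ(M, U)) : resM M le_rfl s = s := by
  simp [resM]

@[simp] lemma resM_smul (h : W ≤ U) (a : Γ(X, U)) (s : Γ(M, U)) :
    resM M h (a • s) = resO h a • resM M h s := Scheme.Modules.map_smul M _ _ _

@[simp] lemma resM_add (h : W ≤ U) (s t : Γ(M, U)) :
    resM M h (s + t) = resM M h s + resM M h t := map_add _ _ _

@[simp] lemma resM_sub (h : W ≤ U) (s t : Γ(M, U)) :
    resM M h (s - t) = resM M h s - resM M h t := map_sub _ _ _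

@[simp] lemma resM_zero (h : W ≤ U) : resM M h (0 : Γ(M, U)) = 0 := map_zero _

@[simp] lemma resO_resO (h : W ≤ V) (h' : V ≤ U) (s : Γ(X, U)) :
    resO h (resO h' s) = resO (h.trans h') s := by
  simp only [resO, ← ConcreteCategory.comp_apply, ← Functor.map_comp]; rfl

@[simp] lemma resO_self (s : Γ(X, U)) : resO le_rfl s = s := by
  simp [resO]

@[simp] lemma resO_add (h : W ≤ U) (s t : Γ(X, U)) : resO h (s + t) = resO h s + resO h t :=
  map_add _ _ _
@[simp] lemma resO_sub (h : W ≤ U) (s t : Γ(X, U)) : resO h (s - t) = resO h s - resO h t :=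
  map_sub _ _ _
@[simp] lemma resO_mul (h : W ≤ U) (s t : Γ(X, U)) : resO h (s * t) = resO h s * resO h t :=
  map_mul _ _ _
@[simp] lemma resO_zero (h : W ≤ U) : resO h (0 : Γ(X, U)) = 0 := map_zero _
@[simp] lemma resO_one (h : W ≤ U) : resO h (1 : Γ(X, U)) = 1 := map_one _

lemma app_resM {M N : X.Modules} (φ : M ⟶ N) (h : W ≤ U) (s : Γ(M, U)) :
    φ.app W (resM M h s) = resM N h (φ.app U s) :=
  congr($(φ.mapPresheaf.naturality (homOfLE h).op) s)

lemma app_resO (f : Y ⟶ X) (h : W ≤ U) (a : Γ(X, U)) :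
    f.app W (resO h a) = resO (f.preimage_mono h) (f.app U a) :=
  congr($(f.naturality (homOfLE h).op) a)

lemma germ_resO (h : W ≤ U) (a : Γ(X, U)) (x : X) (hx : x ∈ W) :
    X.presheaf.germ W x hx (resO h a) = X.presheaf.germ U x (h hx) a :=
  X.presheaf.germ_res_apply _ _ _ _

lemma basicOpen_resO (h : W ≤ U) (a : Γ(X, U)) :
    X.basicOpen (resO h a) = W ⊓ X.basicOpen a :=
  X.basicOpen_res _ _

lemma eq_of_locally {s t : Γ(M, U)}
    (H : ∀ x ∈ U, ∃ (W : X.Opens) (h : W ≤ U), x ∈ W ∧ resM M h s = resM M h t) : s = t := by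
  choose! W hW hx e using H
  refine TopCat.Sheaf.eq_of_locally_eq' (⟨M.presheaf, M.isSheaf⟩ : TopCat.Sheaf Ab X)
    (fun x : U => W x) U (fun x => homOfLE (hW x x.2)) ?_ s t (fun x => e x x.2)
  intro x hxU
  exact Opens.mem_iSup.mpr ⟨⟨x, hxU⟩, hx x hxU⟩

lemma eq_of_locallyO {s t : Γ(X, U)}
    (H : ∀ x ∈ U, ∃ (W : X.Opens) (h : W ≤ U), x ∈ W ∧ resO h s = resO h t) : s = t := by
  choose! W hW hx e using H
  refine TopCat.Sheaf.eq_of_locally_eq' X.sheaf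
    (fun x : U => W x) U (fun x => homOfLE (hW x x.2)) ?_ s t (fun x => e x x.2)
  intro x hxU
  exact Opens.mem_iSup.mpr ⟨⟨x, hxU⟩, hx x hxU⟩

/-- Gluing for a property of sections that passes to smaller open sets and determines the
section. -/
lemma exists_glue (P : ∀ W : X.Opens, Γ(M, W) → Prop)
    (hres : ∀ (W W' : X.Opens) (h : W' ≤ W) (s : Γ(M, W)), P W s → P W' (resM M h s))
    (huniq : ∀ (W : X.Opens), W ≤ U → ∀ s t : Γ(M, W), P W s → P W t → s = t)
    (hloc : ∀ x ∈ U, ∃ W : X.Opens, x ∈ W ∧ W ≤ U ∧ ∃ s : Γ(M, W), P W s) :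
    ∃ s : Γ(M, U), ∀ x ∈ U, ∃ (W : X.Opens) (h : W ≤ U), x ∈ W ∧ P W (resM M h s) := by
  choose! W hxW hW s hs using hloc
  obtain ⟨t, ht, -⟩ := TopCat.Sheaf.existsUnique_gluing'
    (⟨M.presheaf, M.isSheaf⟩ : TopCat.Sheaf Ab X) (fun x : U => W x) U
    (fun x => homOfLE (hW x x.2))
    (fun x hxU => Opens.mem_iSup.mpr ⟨⟨x, hxU⟩, hxW x hxU⟩) (fun x => s x)
    (fun x y => huniq _ (inf_le_left.trans (hW x x.2)) _ _
      (hres _ _ _ _ (hs x x.2)) (hres _ _ _ _ (hs y y.2)))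
  refine ⟨t, fun x hx => ⟨W x, hW x hx, hxW x hx, ?_⟩⟩
  have : resM M (hW x hx) t = s x := ht ⟨x, hx⟩
  rw [this]
  exact hs x hx

lemma exists_glueO (P : ∀ W : X.Opens, Γ(X, W) → Prop)
    (hres : ∀ (W W' : X.Opens) (h : W' ≤ W) (s : Γ(X, W)), P W s → P W' (resO h s))
    (huniq : ∀ (W : X.Opens), W ≤ U → ∀ s t : Γ(X, W), P W s → P W t → s = t)
    (hloc : ∀ x ∈ U, ∃ W : X.Opens, x ∈ W ∧ W ≤ U ∧ ∃ s : Γ(X, W), P W s) :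
    ∃ s : Γ(X, U), ∀ x ∈ U, ∃ (W : X.Opens) (h : W ≤ U), x ∈ W ∧ P W (resO h s) := by
  choose! W hxW hW s hs using hloc
  obtain ⟨t, ht, -⟩ := TopCat.Sheaf.existsUnique_gluing'
    X.sheaf (fun x : U => W x) U
    (fun x => homOfLE (hW x x.2))
    (fun x hxU => Opens.mem_iSup.mpr ⟨⟨x, hxU⟩, hxW x hxU⟩) (fun x => s x)
    (fun x y => huniq _ (inf_le_left.trans (hW x x.2)) _ _
      (hres _ _ _ _ (hs x x.2)) (hres _ _ _ _ (hs y y.2)))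
  refine ⟨t, fun x hx => ⟨W x, hW x hx, hxW x hx, ?_⟩⟩
  have : resO (hW x hx) t = s x := ht ⟨x, hx⟩
  rw [this]
  exact hs x hx

end res

section generator
variable {M N : X.Modules} {U V W : X.Opens}

lemma IsGenerator.bij {g : Γ(M, U)} (hg : IsGenerator M g) (h : W ≤ U) :
    Function.Bijective (fun a : Γ(X, W) => (a • resM M h g : Γ(M, W))) := hg W h

lemma IsGenerator.exists_smul {g : Γ(M, U)} (hg : IsGenerator M g) (h : W ≤ U) (s : Γ(M, W)) :
    ∃ a : Γ(X, W), s = a • resM M h g := by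
  obtain ⟨a, ha⟩ := (hg.bij h).2 s
  exact ⟨a, ha.symm⟩

lemma IsGenerator.smul_inj {g : Γ(M, U)} (hg : IsGenerator M g) (h : W ≤ U) {a b : Γ(X, W)}
    (hab : a • resM M h g = b • resM M h g) : a = b := (hg.bij h).1 hab

lemma IsGenerator.smul_eq_zero {g : Γ(M, U)} (hg : IsGenerator M g) (h : W ≤ U) {a : Γ(X, W)}
    (hab : a • resM M h g = 0) : a = 0 := hg.smul_inj h (by simpa using hab)

lemma IsGenerator.res {g : Γ(M, U)} (hg : IsGenerator M g) (h : V ≤ U) :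
    IsGenerator M (resM M h g) := by
  intro W hW
  have := hg.bij (hW.trans h)
  rwa [← resM_resM M hW h] at this

lemma app_bijective (e : M ≅ N) (U : X.Opens) : Function.Bijective (e.hom.app U) := by
  have : IsIso (e.hom.app U) := inferInstance
  exact ConcreteCategory.bijective_of_isIso _

lemma IsGenerator.map_iso {g : Γ(M, U)} (hg : IsGenerator M g) (e : M ≅ N) :
    IsGenerator N (e.hom.app U g) := by
  intro W hW
  have h := (app_bijective e W).comp (hg.bij hW)
  convert h using 2 with a
  change a • resM N hW _ = _
  simp [app_resM]

lemma isGenerator_structureSheaf_one (X : Scheme.{u}) (U : X.Opens) :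
    IsGenerator (structureSheaf X) (U := U) (1 : Γ(X, U)) := by
  intro W hW
  have e : ∀ a : Γ(X, W),
      (a • (structureSheaf X).presheaf.map (homOfLE hW).op (1 : Γ(X, U)) :
        Γ(structureSheaf X, W)) = a := by
    intro a
    have : ((structureSheaf X).presheaf.map (homOfLE hW).op (1 : Γ(X, U)) :
        Γ(structureSheaf X, W)) = (1 : Γ(X, W)) := resO_one hW
    rw [this]
    exact mul_one a
  refine ⟨fun a b h => ?_, fun a => ⟨a, e a⟩⟩
  exact (e a).symm.trans (h.trans (e b))

/-- Being a generator can be checked locally: it suffices that multiplication is injective and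
locally surjective. -/
lemma isGenerator_of_locally_bijective {g : Γ(M, U)}
    (hinj : ∀ (W : X.Opens) (h : W ≤ U) (a : Γ(X, W)), a • resM M h g = 0 → a = 0)
    (hsurj : ∀ (W : X.Opens) (h : W ≤ U) (s : Γ(M, W)), ∀ x ∈ W,
      ∃ (V : X.Opens) (hV : V ≤ W) (a : Γ(X, V)), x ∈ V ∧
        resM M hV s = a • resM M (hV.trans h) g) :
    IsGenerator M g := by
  have huniq : ∀ (W : X.Opens) (h : W ≤ U) (a b : Γ(X, W)),
      a • resM M h g = b • resM M h g → a = b := fun W h a b hab =>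
    sub_eq_zero.mp (hinj W h _ (by rw [sub_smul, hab, sub_self]))
  intro W hW
  refine ⟨fun a b hab => huniq W hW a b hab, fun s => ?_⟩
  obtain ⟨a, ha⟩ := exists_glueO (U := W)
    (fun V a => ∃ h : V ≤ W, a • resM M (h.trans hW) g = resM M h s)
    (fun V V' h a ⟨h1, h2⟩ => ⟨h.trans h1, by
      have := congr(resM M h $h2)
      simpa using this⟩)
    (fun V hV a b ⟨h1, h2⟩ ⟨h3, h4⟩ => huniq V (hV.trans hW) a b (h2.trans h4.symm))
    (fun x hx => by
      obtain ⟨V, hV, a, hxV, ha⟩ := hsurj W hW s x hx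
      exact ⟨V, hxV, hV, a, hV, ha.symm⟩)
  refine ⟨a, eq_of_locally M fun x hx => ?_⟩
  obtain ⟨V, hV, hxV, h1, h2⟩ := ha x hx
  refine ⟨V, hV, hxV, ?_⟩
  change resM M _ (a • resM M _ _) = _
  simpa using h2

/-- A section that is a generator near each point is a generator. -/
lemma isGenerator_of_locally {g : Γ(M, U)}
    (H : ∀ x ∈ U, ∃ (W : X.Opens) (h : W ≤ U), x ∈ W ∧ IsGenerator M (resM M h g)) :
    IsGenerator M g := by
  refine isGenerator_of_locally_bijective (fun W hW a ha => eq_of_locallyO fun x hx => ?_)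
    fun W hW s x hx => ?_
  · obtain ⟨V, hV, hxV, hg⟩ := H x (hW hx)
    refine ⟨W ⊓ V, inf_le_left, ⟨hx, hxV⟩, hg.smul_inj inf_le_right ?_⟩
    have := congr(resM M (inf_le_left : W ⊓ V ≤ W) $ha)
    simpa using this
  · obtain ⟨V, hV, hxV, hg⟩ := H x (hW hx)
    obtain ⟨a, ha⟩ := hg.exists_smul (W := W ⊓ V) inf_le_right (resM M inf_le_left s)
    exact ⟨W ⊓ V, inf_le_left, a, ⟨hx, hxV⟩, by simp [ha]⟩

end generator
end NodalPruning

/-! ### Pullback of sections and of generators -/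

namespace NodalPruning

variable {X Y : Scheme.{u}}

/-- The pullback of a section of `L` to a section of `f^* L`. -/
def pullSec (f : Y ⟶ X) (L : X.Modules) {U : X.Opens} (s : Γ(L, U)) :
    Γ(restrictTo f L, f ⁻¹ᵁ U) :=
  ((Scheme.Modules.pullbackPushforwardAdjunction f).unit.app L).app U s

lemma pullSec_add (f : Y ⟶ X) (L : X.Modules) {U : X.Opens} (s t : Γ(L, U)) :
    pullSec f L (s + t) = pullSec f L s + pullSec f L t :=
  map_add (((Scheme.Modules.pullbackPushforwardAdjunction f).unit.app L).app U).hom _ _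

lemma pullSec_smul (f : Y ⟶ X) (L : X.Modules) {U : X.Opens} (a : Γ(X, U)) (s : Γ(L, U)) :
    pullSec f L (a • s) = f.app U a • pullSec f L s :=
  Scheme.Modules.Hom.app_smul
    ((Scheme.Modules.pullbackPushforwardAdjunction f).unit.app L) a s

lemma pullSec_resM (f : Y ⟶ X) (L : X.Modules) {W U : X.Opens} (h : W ≤ U) (s : Γ(L, U)) :
    pullSec f L (resM L h s) = resM _ (f.preimage_mono h) (pullSec f L s) :=
  app_resM ((Scheme.Modules.pullbackPushforwardAdjunction f).unit.app L) h s

lemma pullSec_naturality (f : Y ⟶ X) {L M : X.Modules} (φ : L ⟶ M) {U : X.Opens} (s : Γ(L, U)) :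
    pullSec f M (φ.app U s) = ((Scheme.Modules.pullback f).map φ).app _ (pullSec f L s) :=
  congr(Scheme.Modules.Hom.app
    $((Scheme.Modules.pullbackPushforwardAdjunction f).unit.naturality φ) U s)

/-- The inverse image functor on open sets is final, as the whole space is terminal. -/
instance opensMap_final (f : Y ⟶ X) : (Opens.map f.base).Final := by
  constructor
  intro V
  have : Nonempty (StructuredArrow V (Opens.map f.base)) :=
    ⟨StructuredArrow.mk (Y := ⊤) (homOfLE le_top)⟩
  refine zigzag_isConnected fun a b => ?_
  let t : StructuredArrow V (Opens.map f.base) := StructuredArrow.mk (Y := ⊤) (homOfLE le_top)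
  have ha : ∀ a : StructuredArrow V (Opens.map f.base), Nonempty (a ⟶ t) := fun a =>
    ⟨StructuredArrow.homMk (homOfLE le_top) (Subsingleton.elim _ _)⟩
  exact (Zigzag.of_hom (ha a).some).trans (Zigzag.of_inv (ha b).some)

/-- A function, viewed as a section of the structure sheaf as a sheaf of modules. -/
def secO {U : X.Opens} (a : Γ(X, U)) : Γ(structureSheaf X, U) := a

lemma secO_bijective (U : X.Opens) : Function.Bijective (secO : Γ(X, U) → _) :=
  Function.bijective_id

lemma resM_secO {W U : X.Opens} (h : W ≤ U) (a : Γ(X, U)) :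
    resM (structureSheaf X) h (secO a) = secO (resO h a) := rfl

lemma smul_secO {U : X.Opens} (a b : Γ(X, U)) : a • secO b = secO (a * b) := rfl

lemma isGenerator_secO_one (X : Scheme.{u}) (U : X.Opens) :
    IsGenerator (structureSheaf X) (secO (1 : Γ(X, U))) := isGenerator_structureSheaf_one X U

section mkHom
variable {M N : X.Modules} (F : ∀ U : X.Opens, Γ(M, U) → Γ(N, U))
    (hadd : ∀ (U : X.Opens) (s t : Γ(M, U)), F U (s + t) = F U s + F U t)
    (hsmul : ∀ (U : X.Opens) (a : Γ(X, U)) (s : Γ(M, U)), F U (a • s) = a • F U s)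
    (hres : ∀ (U W : X.Opens) (h : W ≤ U) (s : Γ(M, U)), F W (resM M h s) = resM N h (F U s))

/-- A morphism of sheaves of modules from its action on sections. -/
def mkHom : M ⟶ N where
  val :=
    { app := fun U => ModuleCat.ofHom (X := M.val.obj U) (Y := N.val.obj U)
        { toFun := F U.unop
          map_add' := hadd U.unop
          map_smul' := hsmul U.unop }
      naturality := by
        intro U W i
        ext s
        exact hres U.unop W.unop (leOfHom i.unop) s }

end mkHom

lemma isIso_of_bijective {M N : X.Modules} (φ : M ⟶ N)
    (h : ∀ U : X.Opens, Function.Bijective (φ.app U)) : IsIso φ := by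
  rw [Scheme.Modules.Hom.isIso_iff_isIso_app]
  intro U
  exact (ConcreteCategory.isIso_iff_bijective _).mpr (h U)

/-- The morphism `𝒪 ⟶ M` given by multiplication with a global section. -/
def homOfSection (M : X.Modules) (s : Γ(M, ⊤)) : structureSheaf X ⟶ M :=
  mkHom (M := structureSheaf X) (fun U (a : Γ(X, U)) => a • resM M le_top s)
    (fun _ _ _ => add_smul _ _ _) (fun _ _ _ => mul_smul _ _ _)
    (fun U W h a => by
      exact ((resM_smul M h (U := U) a (resM M le_top s)).trans
        (congrArg (resO (U := U) h a • ·) (resM_resM M h le_top s))).symm)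

lemma homOfSection_app (M : X.Modules) (s : Γ(M, ⊤)) {U : X.Opens} (a : Γ(X, U)) :
    (homOfSection M s).app U (secO a) = a • resM M le_top s := rfl

lemma isIso_homOfSection {M : X.Modules} {s : Γ(M, ⊤)} (hs : IsGenerator M s) :
    IsIso (homOfSection M s) :=
  isIso_of_bijective _ fun _ => hs.bij le_top

instance pushforward_isRightAdjoint (f : Y ⟶ X) :
    (SheafOfModules.pushforward.{u} f.toRingCatSheafHom).IsRightAdjoint :=
  inferInstanceAs (Scheme.Modules.pushforward f).IsRightAdjoint

/-- The canonical isomorphism `f^* 𝒪 ≅ 𝒪`. -/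
def pullUnitIso (f : Y ⟶ X) : restrictTo f (structureSheaf X) ≅ structureSheaf Y :=
  @asIso _ _ _ _ _ (@SheafOfModules.instIsIsoPullbackObjUnitToUnitOfFinal _ _ _ _ _ _ _ _ _ _
    f.toRingCatSheafHom (pushforward_isRightAdjoint f) (opensMap_final f))

lemma pullUnitIso_pullSec (f : Y ⟶ X) {U : X.Opens} (a : Γ(X, U)) :
    (pullUnitIso f).hom.app (f ⁻¹ᵁ U) (pullSec f (structureSheaf X) (secO a)) =
      secO (f.app U a) := by
  have h := SheafOfModules.pullbackPushforwardAdjunction_homEquiv_pullbackObjUnitToUnit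
    f.toRingCatSheafHom
  rw [Adjunction.homEquiv_unit] at h
  exact congr(Scheme.Modules.Hom.app $h U a)

lemma isGenerator_pullSec_one (f : Y ⟶ X) :
    IsGenerator (restrictTo f (structureSheaf X)) (pullSec f _ (secO (1 : Γ(X, ⊤)))) := by
  have h := (isGenerator_secO_one Y (f ⁻¹ᵁ ⊤)).map_iso (pullUnitIso f).symm
  convert h
  have h2 : (pullUnitIso f).hom.app (f ⁻¹ᵁ ⊤) (pullSec f (structureSheaf X)
      (secO (1 : Γ(X, ⊤)))) = secO (1 : Γ(Y, f ⁻¹ᵁ ⊤)) := by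
    rw [pullUnitIso_pullSec, map_one]
  rw [← h2]
  exact congr(Scheme.Modules.Hom.app $((pullUnitIso f).hom_inv_id) _
    (pullSec f (structureSheaf X) (secO (1 : Γ(X, ⊤))))).symm

/-- Pullback preserves generators over the whole space. -/
lemma isGenerator_pullSec_of_eq_top (f : Y ⟶ X) {L : X.Modules} {V : X.Opens} (hV : V = ⊤)
    {g : Γ(L, V)} (hg : IsGenerator L g) : IsGenerator (restrictTo f L) (pullSec f L g) := by
  subst hV
  have := isIso_homOfSection hg
  have h := (isGenerator_pullSec_one f).map_iso
    ((Scheme.Modules.pullback f).mapIso (asIso (homOfSection L g)))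
  have e := pullSec_naturality f (homOfSection L g) (secO (1 : Γ(X, ⊤)))
  rw [homOfSection_app, one_smul, resM_self] at e
  rw [e]
  exact h

section localize

lemma isGenerator_restrict {U : X.Opens} {L : X.Modules} {g : Γ(L, U)} (hg : IsGenerator L g) :
    IsGenerator (U := U.ι ⁻¹ᵁ U) (L.restrict U.ι) (resM L (U.ι.image_preimage_le U) g) := by
  intro W hW
  have h := (hg.res (U.ι.image_preimage_le U)).bij (U.ι.image_mono hW)
  have h2 : Function.Bijective ((U.ι.appIso W).inv) := ConcreteCategory.bijective_of_isIso _
  exact h.comp h2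

lemma isGenerator_of_restrict {V : X.Opens} {V' : V.toScheme.Opens} (M : X.Modules)
    (g : Γ(M, V.ι ''ᵁ V')) (hg : IsGenerator (U := V') (M.restrict V.ι) g) :
    IsGenerator M g := by
  intro W hW
  obtain ⟨W', hW', rfl⟩ : ∃ W' ≤ V', W = V.ι ''ᵁ W' := by
    refine ⟨V.ι ⁻¹ᵁ W, ?_, ?_⟩
    · exact (V.ι.preimage_mono hW).trans (V.ι.preimage_image_eq V').le
    · rw [V.ι.image_preimage_eq_opensRange_inf]
      refine (inf_eq_right.mpr (hW.trans ?_)).symm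
      rintro _ ⟨x, -, rfl⟩
      exact ⟨x, rfl⟩
  have h2 : Function.Bijective ((V.ι.appIso W').hom) := ConcreteCategory.bijective_of_isIso _
  have key : (fun a : Γ(X, V.ι ''ᵁ W') => a • resM M hW g) =
      (fun b : Γ(V, W') => (b • resM (M.restrict V.ι) hW' g : Γ(M.restrict V.ι, W'))) ∘
        (V.ι.appIso W').hom := by
    funext a
    change a • resM M hW g = ((V.ι.appIso W').inv ((V.ι.appIso W').hom a)) • resM M hW g
    have e : (V.ι.appIso W').inv ((V.ι.appIso W').hom a) = a :=
      congr($((V.ι.appIso W').hom_inv_id) a)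
    rw [e]
  have h3 := (hg.bij hW').comp h2
  rw [← key] at h3
  exact h3

variable (f : Y ⟶ X) (U : X.Opens)

/-- Both ways of restricting a pullback to the preimage of an open set agree, for they are left
adjoint to isomorphic functors. -/
def pullRestrictIso :
    Scheme.Modules.restrictFunctor U.ι ⋙ Scheme.Modules.pullback (f ∣_ U) ≅
      Scheme.Modules.pullback f ⋙ Scheme.Modules.restrictFunctor (f ⁻¹ᵁ U).ι :=
  (conjugateIsoEquiv
    ((Scheme.Modules.pullbackPushforwardAdjunction f).comp
      (Scheme.Modules.restrictAdjunction (f ⁻¹ᵁ U).ι))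
    ((Scheme.Modules.restrictAdjunction U.ι).comp
      (Scheme.Modules.pullbackPushforwardAdjunction (f ∣_ U)))).symm
  (Scheme.Modules.pushforwardComp (f ⁻¹ᵁ U).ι f ≪≫
    Scheme.Modules.pushforwardCongr (morphismRestrict_ι f U).symm ≪≫
    (Scheme.Modules.pushforwardComp (f ∣_ U) U.ι).symm)

lemma image_ι_le : (f ⁻¹ᵁ U).ι ''ᵁ ((f ∣_ U) ⁻¹ᵁ (U.ι ⁻¹ᵁ U)) ≤ f ⁻¹ᵁ U := by
  rintro _ ⟨x, -, rfl⟩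
  exact x.2

lemma pullRestrictIso_pullSec (L : X.Modules) (s : Γ(L, U)) :
    ((pullRestrictIso f U).hom.app L).app ((f ∣_ U) ⁻¹ᵁ (U.ι ⁻¹ᵁ U))
      (pullSec (U := U.ι ⁻¹ᵁ U) (f ∣_ U) (L.restrict U.ι)
        (resM L (U.ι.image_preimage_le U) s)) =
    resM (restrictTo f L) (image_ι_le f U) (pullSec f L s) := by
  have h := unit_conjugateEquiv_symm
    ((Scheme.Modules.pullbackPushforwardAdjunction f).comp
      (Scheme.Modules.restrictAdjunction (f ⁻¹ᵁ U).ι))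
    ((Scheme.Modules.restrictAdjunction U.ι).comp
      (Scheme.Modules.pullbackPushforwardAdjunction (f ∣_ U)))
    (Scheme.Modules.pushforwardComp (f ⁻¹ᵁ U).ι f ≪≫
    Scheme.Modules.pushforwardCongr (morphismRestrict_ι f U).symm ≪≫
    (Scheme.Modules.pushforwardComp (f ∣_ U) U.ι).symm).hom L
  rw [Adjunction.comp_unit_app, Adjunction.comp_unit_app] at h
  refine (congr(Scheme.Modules.Hom.app $h U s)).symm.trans ?_
  have e : (f ∣_ U) ⁻¹ᵁ (U.ι ⁻¹ᵁ U) = (f ⁻¹ᵁ U).ι ⁻¹ᵁ (f ⁻¹ᵁ U) := by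
    simp only [← Scheme.Hom.comp_preimage, morphismRestrict_ι]
  exact resM_resM (restrictTo f L) ((f ⁻¹ᵁ U).ι.image_mono e.le)
    ((f ⁻¹ᵁ U).ι.image_preimage_le _) (pullSec f L s)

/-- Pullback preserves generators. -/
lemma IsGenerator.pullSec {L : X.Modules} {g : Γ(L, U)} (hg : IsGenerator L g) :
    IsGenerator (restrictTo f L) (pullSec f L g) := by
  have hU : U.ι ⁻¹ᵁ U = ⊤ := top_le_iff.mp fun x _ => x.2
  have h := (isGenerator_pullSec_of_eq_top (f ∣_ U) hU (isGenerator_restrict hg)).map_iso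
    ((pullRestrictIso f U).app L)
  have e := pullRestrictIso_pullSec f U L g
  have h2 : IsGenerator (U := (f ∣_ U) ⁻¹ᵁ (U.ι ⁻¹ᵁ U)) ((restrictTo f L).restrict (f ⁻¹ᵁ U).ι)
      (resM (restrictTo f L) (image_ι_le f U) (NodalPruning.pullSec f L g)) :=
    (congrArg (fun t => IsGenerator (U := (f ∣_ U) ⁻¹ᵁ (U.ι ⁻¹ᵁ U))
      ((restrictTo f L).restrict (f ⁻¹ᵁ U).ι) t) e).mp h
  refine isGenerator_of_locally fun x hx => ⟨_, image_ι_le f U, ?_, isGenerator_of_restrict _ _ h2⟩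
  have hx' : f x ∈ U := hx
  refine ⟨⟨x, hx⟩, ?_, rfl⟩
  change (f ∣_ U) ⟨x, hx⟩ ∈ U.ι ⁻¹ᵁ U
  rw [hU]
  trivial

end localize

lemma IsLineBundle.pullback (f : Y ⟶ X) {L : X.Modules} (hL : IsLineBundle L) :
    IsLineBundle (restrictTo f L) := by
  intro y
  obtain ⟨U, hU, g, hg⟩ := hL (f y)
  exact ⟨f ⁻¹ᵁ U, hU, pullSec f L g, hg.pullSec f U⟩

end NodalPruning

/-! ### Tensor products of sheaves of modules -/

namespace NodalPruning
open scoped TensorProduct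

variable {X Y : Scheme.{u}}

/-- The presheaf tensor product, `U ↦ Γ(L, U) ⊗ Γ(M, U)`. -/
abbrev preTensor (L M : X.Modules) : PresheafOfModules X.ringCatSheaf.obj :=
  PresheafOfModules.Monoidal.tensorObj (R := X.presheaf) L.val M.val

/-- The map from the tensor product of the modules of sections to the sections of the
tensor product. -/
def ofTensor (L M : X.Modules) (U : X.Opens) :
    Γ(L, U) ⊗[Γ(X, U)] Γ(M, U) →ₗ[Γ(X, U)] Γ(tensor L M, U) :=
  (((PresheafOfModules.sheafificationAdjunction (𝟙 X.ringCatSheaf.obj)).unit.app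
    (preTensor L M)).app (.op U)).hom

lemma ofTensor_res (L M : X.Modules) {W U : X.Opens} (h : W ≤ U) (s : Γ(L, U)) (t : Γ(M, U)) :
    resM _ h (ofTensor L M U (s ⊗ₜ t)) = ofTensor L M W (resM L h s ⊗ₜ resM M h t) := by
  have := ((PresheafOfModules.sheafificationAdjunction (𝟙 X.ringCatSheaf.obj)).unit.app
    (preTensor L M)).naturality (homOfLE h).op
  exact (congr($(this) (s ⊗ₜ[Γ(X, U)] t))).symm

lemma ofTensor_locally_surjective (L M : X.Modules) {U : X.Opens} (s : Γ(tensor L M, U)) (x : X)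
    (hx : x ∈ U) : ∃ (W : X.Opens) (h : W ≤ U) (_ : x ∈ W) (t : Γ(L, W) ⊗[Γ(X, W)] Γ(M, W)),
      ofTensor L M W t = resM _ h s := by
  have := Presheaf.imageSieve_mem (Opens.grothendieckTopology X)
    (CategoryTheory.toSheafify (Opens.grothendieckTopology X) (preTensor L M).presheaf)
    (U := .op U) s
  obtain ⟨W, i, ⟨t, ht⟩, hxW⟩ := this x hx
  exact ⟨W, leOfHom i, hxW, t, ht⟩

lemma ofTensor_locally_injective (L M : X.Modules) {U : X.Opens}
    (s t : Γ(L, U) ⊗[Γ(X, U)] Γ(M, U)) (h : ofTensor L M U s = ofTensor L M U t) (x : X)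
    (hx : x ∈ U) : ∃ (W : X.Opens) (h : W ≤ U), x ∈ W ∧
      (preTensor L M).presheaf.map (homOfLE h).op s =
        (preTensor L M).presheaf.map (homOfLE h).op t := by
  have := Presheaf.equalizerSieve_mem (Opens.grothendieckTopology X)
    (CategoryTheory.toSheafify (Opens.grothendieckTopology X) (preTensor L M).presheaf)
    (X := .op U) s t h
  obtain ⟨W, i, hi, hxW⟩ := this x hx
  exact ⟨W, leOfHom i, hxW, hi⟩

lemma preTensor_map_tmul (L M : X.Modules) {W U : X.Opens} (h : W ≤ U) (s : Γ(L, U))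
    (t : Γ(M, U)) : (preTensor L M).presheaf.map (homOfLE h).op (s ⊗ₜ[Γ(X, U)] t) =
      (resM L h s ⊗ₜ[Γ(X, W)] resM M h t : Γ(L, W) ⊗[Γ(X, W)] Γ(M, W)) := rfl

lemma tmul_bijective {R A B : Type*} [CommRing R] [AddCommGroup A] [Module R A] [AddCommGroup B]
    [Module R B] {g : A} {h : B} (hg : Function.Bijective fun a : R => a • g)
    (hh : Function.Bijective fun a : R => a • h) :
    Function.Bijective fun a : R => a • (g ⊗ₜ[R] h) := by
  let e : R ≃ₗ[R] A := LinearEquiv.ofBijective (LinearMap.toSpanSingleton R A g) hg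
  let e' : R ≃ₗ[R] B := LinearEquiv.ofBijective (LinearMap.toSpanSingleton R B h) hh
  convert ((TensorProduct.lid R R).symm ≪≫ₗ TensorProduct.congr e e').bijective using 2 with a
  change a • (g ⊗ₜ[R] h) = TensorProduct.congr e e' ((TensorProduct.lid R R).symm a)
  rw [TensorProduct.lid_symm_apply, TensorProduct.congr_tmul]
  change _ = ((1 : R) • g) ⊗ₜ[R] (a • h)
  rw [one_smul, TensorProduct.tmul_smul]

/-- The tensor product of generators is a generator. -/
lemma IsGenerator.tmul {L M : X.Modules} {U : X.Opens} {g : Γ(L, U)} {h : Γ(M, U)}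
    (hg : IsGenerator L g) (hh : IsGenerator M h) :
    IsGenerator (tensor L M) (ofTensor L M U (g ⊗ₜ h)) := by
  have bij : ∀ (W : X.Opens) (hW : W ≤ U),
      Function.Bijective fun a : Γ(X, W) => a • (resM L hW g ⊗ₜ[Γ(X, W)] resM M hW h) :=
    fun W hW => tmul_bijective (hg.bij hW) (hh.bij hW)
  refine isGenerator_of_locally_bijective (fun W hW a ha => eq_of_locallyO fun x hx => ?_)
    fun W hW s x hx => ?_
  · rw [ofTensor_res, ← map_smul] at ha
    obtain ⟨V, hV, hxV, e⟩ := ofTensor_locally_injective L M _ 0 (ha.trans (map_zero _).symm) x hx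
    refine ⟨V, hV, hxV, (bij V (hV.trans hW)).1 ?_⟩
    rw [TensorProduct.smul_tmul'] at e
    have e1 := preTensor_map_tmul L M hV (a • resM L hW g) (resM M hW h)
    have e2 := e1.symm.trans (e.trans (map_zero ((preTensor L M).presheaf.map (homOfLE hV).op).hom))
    simp only [resM_smul, resM_resM] at e2
    simp only [resO_zero, zero_smul, TensorProduct.smul_tmul']
    exact e2
  · obtain ⟨V, hV, hxV, t, ht⟩ := ofTensor_locally_surjective L M s x hx
    obtain ⟨a, rfl⟩ := (bij V (hV.trans hW)).2 t
    refine ⟨V, hV, a, hxV, ?_⟩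
    rw [ofTensor_res, ← ht, ← map_smul]

lemma IsLineBundle.tensor {L M : X.Modules} (hL : IsLineBundle L) (hM : IsLineBundle M) :
    IsLineBundle (NodalPruning.tensor L M) := by
  intro x
  obtain ⟨U, hU, g, hg⟩ := hL x
  obtain ⟨V, hV, h, hh⟩ := hM x
  exact ⟨U ⊓ V, ⟨hU, hV⟩, _, (hg.res inf_le_left).tmul (hh.res inf_le_right)⟩

section desc
variable {L M N : X.Modules}
    (F : ∀ U : X.Opens, Γ(L, U) ⊗[Γ(X, U)] Γ(M, U) →ₗ[Γ(X, U)] Γ(N, U))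
    (hF : ∀ (U W : X.Opens) (h : W ≤ U) (s : Γ(L, U)) (t : Γ(M, U)),
      F W (resM L h s ⊗ₜ resM M h t) = resM N h (F U (s ⊗ₜ t)))

/-- The morphism out of the presheaf tensor product given by a compatible family of linear maps. -/
def preTensorDesc : preTensor L M ⟶ N.val where
  app U := letI φ := ModuleCat.ofHom (R := Γ(X, U.unop)) (F U.unop); φ
  naturality := by
    intro U W i
    refine ModuleCat.MonoidalCategory.tensor_ext (R := Γ(X, U.unop)) fun s t => ?_
    exact hF U.unop W.unop (leOfHom i.unop) s t

/-- The morphism out of the tensor product given by a compatible family of linear maps. -/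
def tensorDesc : tensor L M ⟶ N :=
  ((PresheafOfModules.sheafificationAdjunction (𝟙 X.ringCatSheaf.obj)).homEquiv
    (preTensor L M) N).symm (preTensorDesc F hF)

lemma tensorDesc_ofTensor {U : X.Opens} (t : Γ(L, U) ⊗[Γ(X, U)] Γ(M, U)) :
    (tensorDesc F hF).app U (ofTensor L M U t) = F U t := by
  have h := ((PresheafOfModules.sheafificationAdjunction (𝟙 X.ringCatSheaf.obj)).homEquiv
    (preTensor L M) N).apply_symm_apply (preTensorDesc F hF)
  have h2 := ((PresheafOfModules.sheafificationAdjunction (𝟙 X.ringCatSheaf.obj)).homEquiv_unit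
    (preTensor L M) N (tensorDesc F hF)).symm.trans h
  exact congr(PresheafOfModules.Hom.app $h2 (.op U) t)

end desc
end NodalPruning

/-! ### Reduced closed subschemes and their ideal sheaves -/

namespace NodalPruning

variable {X Y Z : Scheme.{u}}

section closedImmersion
variable (i : Z ⟶ X)

/-- A function restricts to zero on a reduced subscheme iff it vanishes at each of its points. -/
lemma app_eq_zero_iff [IsReduced Z] {U : X.Opens} (a : Γ(X, U)) :
    i.app U a = 0 ↔ ∀ z : Z, i z ∉ X.basicOpen a := by
  rw [← basicOpen_eq_bot_iff, ← Scheme.preimage_basicOpen]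
  constructor
  · intro h z hz
    have : z ∈ i ⁻¹ᵁ X.basicOpen a := hz
    rw [h] at this
    exact this
  · intro h
    ext z
    exact ⟨fun hz => (h z hz).elim, fun hz => hz.elim⟩

lemma app_eq_zero_of_resO [IsReduced Z] {U W : X.Opens} (h : W ≤ U) {a : Γ(X, U)}
    (ha : i.app U a = 0) : i.app W (resO h a) = 0 := by
  rw [app_resO, ha, resO_zero]

lemma exists_affine_nhd {U : X.Opens} {x : X} (hx : x ∈ U) :
    ∃ W : X.Opens, IsAffineOpen W ∧ W ≤ U ∧ x ∈ W := by
  obtain ⟨_, ⟨W, hW, rfl⟩, hx, hWU⟩ := X.isBasis_affineOpens.exists_subset_of_mem_open hx U.2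
  exact ⟨W, hW, hWU, hx⟩

lemma exists_local_lift [IsClosedImmersion i] {U : X.Opens} (b : Γ(Z, i ⁻¹ᵁ U)) {x : X}
    (hx : x ∈ U) : ∃ (W : X.Opens) (h : W ≤ U) (a : Γ(X, W)), x ∈ W ∧ i.app W a =
      resO (i.preimage_mono h) b := by
  obtain ⟨W, hW, hWU, hxW⟩ := exists_affine_nhd hx
  obtain ⟨a, ha⟩ := i.app_surjective W hW (resO (i.preimage_mono hWU) b)
  exact ⟨W, hWU, a, hxW, ha⟩

/-- A closed immersion into a reduced scheme is an isomorphism over the open sets it covers. -/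
lemma isIso_restrict_of_subset_range [IsClosedImmersion i] [IsReduced X] {W : X.Opens}
    (hW : (W : Set X) ⊆ Set.range i) : IsIso (i ∣_ W) := by
  have : Surjective (i ∣_ W) := by
    constructor
    rintro ⟨x, hx⟩
    obtain ⟨z, rfl⟩ := hW hx
    exact ⟨⟨z, hx⟩, Subtype.ext (morphismRestrict_base_coe i W ⟨z, hx⟩)⟩
  exact isIso_of_isClosedImmersion_of_surjective _

lemma isIso_stalkMap_of_subset_range [IsClosedImmersion i] [IsReduced X] {W : X.Opens}
    (hW : (W : Set X) ⊆ Set.range i) (z : Z) (hz : i z ∈ W) : IsIso (i.stalkMap z) := by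
  have := isIso_restrict_of_subset_range i hW
  let z' : (i ⁻¹ᵁ W).toScheme := ⟨z, hz⟩
  have h : IsIso ((i ∣_ W).stalkMap z') := inferInstance
  exact ((MorphismProperty.isomorphisms _).arrow_mk_iso_iff
    (morphismRestrictStalkMap i W z')).mp h

/-- The ideal of a reduced closed subscheme consists of the functions that vanish at its points. -/
lemma ker_eq_vanishingIdeal [IsReduced Z] [QuasiCompact i] {A : Closeds X}
    (hA : closure (Set.range i) = A) : i.ker = Scheme.IdealSheafData.vanishingIdeal A := by
  have h : i.ker.support = A := SetLike.coe_injective (by rw [Scheme.Hom.support_ker, hA])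
  rw [← h, Scheme.IdealSheafData.vanishingIdeal_support]
  ext U : 2
  refine le_antisymm Ideal.le_radical ?_
  change (i.ker.ideal U).radical ≤ _
  rw [Scheme.Hom.ker_apply]
  rintro a ⟨n, hn⟩
  rw [RingHom.mem_ker, map_pow] at hn
  exact (RingHom.mem_ker).mpr (eq_zero_of_pow_eq_zero hn)

/-- Two reduced closed subschemes with the same points are isomorphic. -/
lemma exists_iso_of_range_eq [IsReduced Z] [IsReduced Y] (j : Y ⟶ X) [IsClosedImmersion i]
    [IsClosedImmersion j] (h : Set.range i = Set.range j) : ∃ e : Z ≅ Y, e.hom ≫ j = i := by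
  have hi := ker_eq_vanishingIdeal i (A := ⟨Set.range i, i.isClosedEmbedding.isClosed_range⟩)
    i.isClosedEmbedding.isClosed_range.closure_eq
  have hj := ker_eq_vanishingIdeal j (A := ⟨Set.range i, i.isClosedEmbedding.isClosed_range⟩)
    (by rw [← h]; exact i.isClosedEmbedding.isClosed_range.closure_eq)
  have hk := hj.trans hi.symm
  have := IsClosedImmersion.isIso_lift j i hk
  exact ⟨asIso (IsClosedImmersion.lift j i hk.le), by simp⟩

end closedImmersion

section reducedSub

variable (X) (A : Set X)

lemma range_reducedSubι :
    Set.range (reducedSubι X A) = closure A := by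
  rw [Scheme.IdealSheafData.range_subschemeι]
  simp

instance isReduced_reducedSub : IsReduced (reducedSub X A) := by
  let I := Scheme.IdealSheafData.vanishingIdeal (Closeds.closure A)
  have (U : X.affineOpens) : AlgebraicGeometry.IsReduced (I.subschemeCover.openCover.X U) := by
    have : _root_.IsReduced (Γ(X, U.1) ⧸ I.ideal U) :=
      (Ideal.isRadical_iff_quotient_reduced _).mp (PrimeSpectrum.isRadical_vanishingIdeal _)
    exact inferInstanceAs (AlgebraicGeometry.IsReduced (Spec (.of (Γ(X, U.1) ⧸ I.ideal U))))
  exact @AlgebraicGeometry.IsReduced.of_openCover _ I.subschemeCover.openCover this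

instance : IsClosedImmersion (reducedSubι X A) := inferInstance

end reducedSub

section idealSheaf
open Limits
variable (X) (A : Set X)

/-- The inclusion of an ideal sheaf in the structure sheaf. -/
def idealIncl : idealSheaf X A ⟶ structureSheaf X := kernel.ι _

lemma idealIncl_injective (U : X.Opens) : Function.Injective ((idealIncl X A).app U) := by
  have : Mono (idealIncl X A) := equalizer.ι_mono
  have : Mono ((Scheme.Modules.toPresheaf X).map (idealIncl X A)) := inferInstance
  have := (NatTrans.mono_iff_mono_app _).mp this (.op U)
  exact (AddCommGrpCat.mono_iff_injective _).mp this

/-- The sections of the ideal sheaf are the functions that restrict to zero: taking sections over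
`U` preserves kernels. -/
lemma mem_range_idealIncl (U : X.Opens) (a : Γ(X, U)) :
    (∃ s, (idealIncl X A).app U s = secO a) ↔ (reducedSubι X A).app U a = 0 := by
  let φ : structureSheaf X ⟶
        (Scheme.Modules.pushforward (reducedSubι X A)).obj (structureSheaf (reducedSub X A)) :=
      SheafOfModules.unitToPushforwardObjUnit (reducedSubι X A).toRingCatSheafHom
  have hφ : φ.app U (secO a) = secO ((reducedSubι X A).app U a) := rfl
  let S : ShortComplex X.Modules := ShortComplex.mk (idealIncl X A) φ (kernel.condition φ)
  let F : X.Modules ⥤ Ab := Scheme.Modules.toPresheaf X ⋙ (evaluation _ _).obj (.op U)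
  have : F.PreservesZeroMorphisms := ⟨fun _ _ => rfl⟩
  have hev : PreservesLimitsOfShape WalkingParallelPair
      ((evaluation (Opens X)ᵒᵖ Ab.{u}).obj (.op U)) := inferInstance
  have : PreservesLimit (parallelPair φ 0 ⋙ Scheme.Modules.toPresheaf X)
    ((evaluation (Opens X)ᵒᵖ Ab.{u}).obj (.op U)) := hev.preservesLimit
  have : PreservesLimit (parallelPair φ 0) F := comp_preservesLimit _ _
  have h2 : (S.map F).Exact := ShortComplex.exact_of_f_is_kernel (S.map F)
    (KernelFork.mapIsLimit _ (kernelIsKernel φ) F)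
  rw [ShortComplex.ab_exact_iff] at h2
  constructor
  · rintro ⟨s, hs⟩
    have := congr(Scheme.Modules.Hom.app $(kernel.condition φ) U s)
    exact (congrArg (φ.app U) hs).symm.trans this
  · intro h
    exact h2 (secO a) h

end idealSheaf
end NodalPruning

/-! ### Branches of a formal node -/

namespace NodalPruning

section NodeAlgebra
open IsLocalRing

/-- The powers of the maximal ideal of the completion are the kernels of the projections to the
quotients of `R`. -/
lemma mem_maximalIdeal_pow_completion {R : Type*} [CommRing R] [IsLocalRing R] [IsNoetherianRing R]
    (n : ℕ) (z : AdicCompletion (maximalIdeal R) R) :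
    z ∈ maximalIdeal (AdicCompletion (maximalIdeal R) R) ^ n ↔
      AdicCompletion.eval (maximalIdeal R) R n z = 0 := by
  rw [AdicCompletion.maximalIdeal_eq_map, ← Ideal.map_pow, ← Submodule.restrictScalars_mem R,
    ← Ideal.smul_top_eq_map,
    AdicCompletion.pow_smul_top_eq_ker_eval (maximalIdeal R).fg_of_isNoetherianRing,
    LinearMap.mem_ker]

lemma algebraMap_completion_mem_pow {R : Type*} [CommRing R] [IsLocalRing R] [IsNoetherianRing R]
    (n : ℕ) (r : R) :
    algebraMap R (AdicCompletion (maximalIdeal R) R) r ∈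
      maximalIdeal (AdicCompletion (maximalIdeal R) R) ^ n ↔ r ∈ maximalIdeal R ^ n := by
  rw [mem_maximalIdeal_pow_completion]
  have : algebraMap R (AdicCompletion (maximalIdeal R) R) r =
    AdicCompletion.of (maximalIdeal R) R r := rfl
  rw [this, AdicCompletion.eval_of, Submodule.mkQ_apply, Submodule.Quotient.mk_eq_zero]
  simp

lemma exists_sub_algebraMap_completion_mem_pow {R : Type*} [CommRing R] [IsLocalRing R]
    [IsNoetherianRing R] (n : ℕ) (z : AdicCompletion (maximalIdeal R) R) :
    ∃ r : R, z - algebraMap R _ r ∈ maximalIdeal (AdicCompletion (maximalIdeal R) R) ^ n := by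
  obtain ⟨r, hr⟩ := Submodule.mkQ_surjective _ (AdicCompletion.eval (maximalIdeal R) R n z)
  refine ⟨r, ?_⟩
  rw [mem_maximalIdeal_pow_completion, map_sub, ← hr, sub_eq_zero]
  rfl

/-- The coordinate ring `N` of a formal node: a local ring with elements `x`, `y` that generate its
maximal ideal, are prime, do not divide each other, and whose common multiples vanish. -/
structure IsFormalNode (N : Type*) [CommRing N] [IsLocalRing N] (x y : N) : Prop where
  prime_left : Prime x
  prime_right : Prime y
  eq_zero : ∀ f, x ∣ f → y ∣ f → f = 0
  span_eq : maximalIdeal N = Ideal.span {x, y}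
  not_dvd : ¬ x ∣ y
  not_dvd' : ¬ y ∣ x

namespace IsFormalNode
variable {N : Type*} [CommRing N] [IsLocalRing N] {x y : N}

lemma symm (h : IsFormalNode N x y) : IsFormalNode N y x :=
  ⟨h.2, h.1, fun f hy hx => h.3 f hx hy, by rw [h.4, Set.pair_comm], h.6, h.5⟩

lemma mul_eq_zero (h : IsFormalNode N x y) : x * y = 0 := h.3 _ ⟨_, rfl⟩ ⟨x, mul_comm _ _⟩

lemma mem_left (h : IsFormalNode N x y) : x ∈ maximalIdeal N := by
  rw [h.span_eq]; exact Ideal.subset_span (by simp)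

lemma mem_right (h : IsFormalNode N x y) : y ∈ maximalIdeal N := h.symm.mem_left

/-- The maximal ideal of a formal node is not principal. -/
lemma not_principal (h : IsFormalNode N x y) (w : N) : maximalIdeal N ≠ Ideal.span {w} := by
  intro hw
  have hx := h.mem_left
  have hy := h.mem_right
  rw [hw, Ideal.mem_span_singleton] at hx hy
  have hxw : ¬ x ∣ w := fun hd => h.not_dvd (hd.trans hy)
  obtain ⟨α, hα⟩ := hx
  have hxα : x ∣ α := (h.prime_left.dvd_or_dvd ⟨1, by rw [mul_one, ← hα]⟩).resolve_left hxw
  obtain ⟨β, rfl⟩ := hxα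
  have hwm : w ∈ maximalIdeal N := hw ▸ Ideal.mem_span_singleton_self w
  have hu : IsUnit (1 - w * β) := by
    by_contra hu
    have := (maximalIdeal N).add_mem ((mem_maximalIdeal _).2 hu)
      ((maximalIdeal N).mul_mem_right β hwm)
    rw [sub_add_cancel] at this
    exact (Ideal.ne_top_iff_one _).1 (maximalIdeal.isMaximal N).ne_top this
  have h0 : x * (1 - w * β) = 0 := by linear_combination hα
  exact h.prime_left.ne_zero ((hu.mul_left_eq_zero).1 h0)

lemma right_mul_mem_sq (h : IsFormalNode N x y) {e : N} (he : e ∈ maximalIdeal N ^ 2) :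
    y ^ 3 ∣ y * e := by
  have hxy := h.mul_eq_zero
  rw [h.span_eq, pow_two] at he
  refine Submodule.mul_induction_on he ?_ ?_
  · intro a ha b hb
    obtain ⟨a1, a2, rfl⟩ := Ideal.mem_span_pair.1 ha
    obtain ⟨b1, b2, rfl⟩ := Ideal.mem_span_pair.1 hb
    refine ⟨a2 * b2, ?_⟩
    linear_combination (a1 * b1 * x + a1 * b2 * y + a2 * b1 * y) * hxy
  · intro a b ha hb
    rw [mul_add]; exact dvd_add ha hb

end IsFormalNode

/-- A form of Nakayama's lemma: generators of the cotangent space generate the maximal ideal. -/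
lemma maximalIdeal_eq_of_le_sup_sq {R : Type*} [CommRing R] [IsLocalRing R]
    (hfg : (maximalIdeal R).FG) {I : Ideal R}
    (hI : I ≤ maximalIdeal R) (h : maximalIdeal R ≤ I ⊔ maximalIdeal R ^ 2) :
    maximalIdeal R = I := by
  refine le_antisymm ?_ hI
  refine Submodule.le_of_le_smul_of_le_jacobson_bot (I := maximalIdeal R) hfg
    (maximalIdeal_le_jacobson _) ?_
  rwa [smul_eq_mul, ← pow_two]

variable {R A B N : Type*} [CommRing R] [IsLocalRing R] [IsNoetherianRing R]
  [CommRing A] [IsDomain A] [IsDiscreteValuationRing A] [CommRing B] [IsReduced B]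
  [CommRing N] [IsLocalRing N]

/-- The algebra of a node with two branches. Here `c` exhibits the formal node `N` as the
completion of `R`, and `A` and `B` are branches whose union is everything. The element `b` vanishes
on `B` but is not divisible by `y`, so that `A` must be the branch `y = 0`. If `A` is smooth, then
the maximal ideal of `R` is generated by an element `a` of the ideal of `A` and an element `j` of
the prime ideal of `B`. -/
theorem branch_aux {x y : N} (hN : IsFormalNode N x y) (c : R →+* N)
    (hc : ∀ n r, c r ∈ maximalIdeal N ^ n ↔ r ∈ maximalIdeal R ^ n)
    (hd : ∀ n z, ∃ r, z - c r ∈ maximalIdeal N ^ n)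
    (φ : R →+* A) (hφ : Function.Surjective φ) (ψ : R →+* B)
    (hinf : ∀ r, φ r = 0 → ψ r = 0 → r = 0)
    {b : R} (hb : ψ b = 0) (hby : ¬ y ∣ c b) :
    (RingHom.ker ψ).IsPrime ∧ ∃ a j, φ a = 0 ∧ ψ j = 0 ∧ ψ a ≠ 0 ∧
      maximalIdeal R = Ideal.span {j, a} := by
  have hinj : ∀ r, c r = 0 → r = 0 := by
    intro r hr
    have : r ∈ (⨅ n, maximalIdeal R ^ n : Ideal R) := by
      rw [Ideal.mem_iInf]; intro n; rw [← hc, hr]; exact zero_mem _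
    rwa [Ideal.iInf_pow_eq_bot_of_isLocalRing _ (maximalIdeal.isMaximal R).ne_top,
      Ideal.mem_bot] at this
  have hc1 : ∀ r, c r ∈ maximalIdeal N ↔ r ∈ maximalIdeal R := by
    intro r; simpa using hc 1 r
  have hxy := hN.mul_eq_zero
  have hfg : (maximalIdeal R).FG := (maximalIdeal R).fg_of_isNoetherianRing
  have hNfg : (maximalIdeal N).FG := by
    rw [hN.span_eq]; exact Submodule.fg_span (by simp)
  have hφm : ∀ r, φ r ∈ maximalIdeal A ↔ r ∈ maximalIdeal R := by
    have := IsLocalRing.of_surjective' φ hφ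
    have := IsLocalHom.of_surjective φ hφ
    intro r; rw [mem_maximalIdeal, mem_maximalIdeal, mem_nonunits_iff, mem_nonunits_iff,
      isUnit_map_iff]
  -- the branch `A` lies in `y = 0`
  have hIy : ∀ a, φ a = 0 → y ∣ c a := by
    intro a ha
    have h0 : a * b = 0 := hinf _ (by rw [map_mul, ha, zero_mul]) (by rw [map_mul, hb, mul_zero])
    have : y ∣ c a * c b := by rw [← map_mul, h0, map_zero]; exact dvd_zero _
    exact (hN.prime_right.dvd_or_dvd this).resolve_right hby
  -- the embedding dimension of `R` is two, that of `A` is one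
  obtain ⟨a, ha, ha2⟩ : ∃ a, φ a = 0 ∧ a ∉ maximalIdeal R ^ 2 := by
    by_contra! hcon
    obtain ⟨ϖ, hϖ⟩ := IsDiscreteValuationRing.exists_irreducible A
    obtain ⟨z, rfl⟩ := hφ ϖ
    have hzm : z ∈ maximalIdeal R := (hφm z).1 ((mem_maximalIdeal _).2 hϖ.not_isUnit)
    have hRz : maximalIdeal R = Ideal.span {z} := by
      refine maximalIdeal_eq_of_le_sup_sq hfg
        ((Ideal.span_singleton_le_iff_mem _).2 hzm) fun r hr => ?_
      have := (hφm r).2 hr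
      rw [hϖ.maximalIdeal_eq, Ideal.mem_span_singleton] at this
      obtain ⟨q, hq⟩ := this
      obtain ⟨s, rfl⟩ := hφ q
      have h2 := hcon (r - z * s) (by rw [map_sub, map_mul, hq, sub_self])
      have : r = z * s + (r - z * s) := by ring
      rw [this]
      exact Submodule.add_mem_sup (Ideal.mem_span_singleton.2 ⟨s, rfl⟩) h2
    refine hN.not_principal (c z) (maximalIdeal_eq_of_le_sup_sq hNfg
      ((Ideal.span_singleton_le_iff_mem _).2 ((hc1 z).2 hzm)) fun w hw => ?_)
    obtain ⟨r, hr⟩ := hd 2 w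
    have hrm : r ∈ maximalIdeal R := by
      rw [← hc1]
      have := (maximalIdeal N).sub_mem hw (Ideal.pow_le_self two_ne_zero hr)
      simpa using this
    rw [hRz, Ideal.mem_span_singleton] at hrm
    obtain ⟨s, rfl⟩ := hrm
    have : w = c z * c s + (w - c (z * s)) := by rw [map_mul]; ring
    rw [this]
    exact Submodule.add_mem_sup (Ideal.mem_span_singleton.2 ⟨c s, rfl⟩) hr
  -- so `a` is an equation of the branch `A`: its image in `N` is `y` times a unit `u`
  obtain ⟨u, hu⟩ := hIy a ha
  have huu : IsUnit u := by
    by_contra hnu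
    refine ha2 ((hc 2 a).1 ?_)
    rw [hu, pow_two]
    exact Ideal.mul_mem_mul hN.mem_right ((mem_maximalIdeal _).2 hnu)
  obtain ⟨v, hv⟩ := huu.exists_right_inv
  -- `t` approximates the other coordinate `x`, and `t` and `a` generate the maximal ideal of `R`
  obtain ⟨t, ht⟩ := hd 2 x
  have htm : t ∈ maximalIdeal R := by
    rw [← hc1]
    simpa using (maximalIdeal N).sub_mem hN.mem_left (Ideal.pow_le_self two_ne_zero ht)
  have ham : a ∈ maximalIdeal R := by
    rw [← hc1, hu]; exact Ideal.mul_mem_right _ _ hN.mem_right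
  have hgen : maximalIdeal R = Ideal.span {t, a} := by
    refine maximalIdeal_eq_of_le_sup_sq hfg ?_ fun r hr => ?_
    · rw [Ideal.span_le]; rintro _ (rfl | rfl) <;> assumption
    have hr' := (hc1 r).2 hr
    rw [hN.span_eq, Ideal.mem_span_pair] at hr'
    obtain ⟨α, β, hαβ⟩ := hr'
    obtain ⟨p, hp⟩ := hd 1 α
    obtain ⟨q, hq⟩ := hd 1 (β * v)
    rw [pow_one] at hp hq
    have h2 : r - (p * t + q * a) ∈ maximalIdeal R ^ 2 := by
      rw [← hc]
      have e : c (r - (p * t + q * a)) =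
          (α - c p) * x + c p * (x - c t) + (β * v - c q) * c a := by
        rw [map_sub, map_add, map_mul, map_mul, ← hαβ, hu]
        linear_combination -β * y * hv
      rw [e]
      refine add_mem (add_mem ?_ (Ideal.mul_mem_left _ _ ht)) ?_
      · rw [pow_two]; exact Ideal.mul_mem_mul hp hN.mem_left
      · rw [pow_two]; exact Ideal.mul_mem_mul hq ((hc1 a).2 ham)
    have : r = (p * t + q * a) + (r - (p * t + q * a)) := by ring
    rw [this]
    exact Submodule.add_mem_sup (Ideal.mem_span_pair.2 ⟨p, q, rfl⟩) h2
  -- `a * t` is divisible by `a ^ 3`, first in `N`, then in `R` by Krull's intersection theorem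
  have hat : a ^ 3 ∣ a * t := by
    obtain ⟨w, hw⟩ := hN.right_mul_mem_sq ht
    have hcat : c (a * t) = c a ^ 3 * (-(v ^ 2 * w)) := by
      rw [map_mul, hu]
      have h1 : y * (x - c t) = y ^ 3 * w := hw
      linear_combination (-u) * h1 + u * hxy + y ^ 3 * w * u * (1 + u * v) * hv
    rw [← Ideal.mem_span_singleton]
    have hkr : (⨅ n, (maximalIdeal (R)) ^ n • (⊤ : Submodule R (R ⧸ Ideal.span {a ^ 3}))) = ⊥ :=
      Ideal.iInf_pow_smul_eq_bot_of_isLocalRing _ (maximalIdeal.isMaximal R).ne_top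
    rw [← Ideal.Quotient.eq_zero_iff_mem, ← Submodule.mem_bot R, ← hkr, Submodule.mem_iInf]
    intro n
    obtain ⟨s, hs⟩ := hd n (-(v ^ 2 * w))
    have h3 : a * t - a ^ 3 * s ∈ maximalIdeal R ^ n := by
      rw [← hc, map_sub, hcat, map_mul, map_pow, ← mul_sub]
      exact Ideal.mul_mem_left _ _ hs
    have h4 : Ideal.Quotient.mk (Ideal.span {a ^ 3}) (a * t) =
        (a * t - a ^ 3 * s) • (1 : R ⧸ Ideal.span {a ^ 3}) := by
      rw [Algebra.smul_def, mul_one, Ideal.Quotient.algebraMap_eq, map_sub, map_mul _ (a ^ 3),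
        Ideal.Quotient.eq_zero_iff_mem.2 (Ideal.mem_span_singleton_self _)]
      ring
    rw [h4]
    exact Submodule.smul_mem_smul h3 trivial
  obtain ⟨r, hr⟩ := hat
  have hnyx : ∀ f, f * (y * u) = 0 → x ∣ f := by
    intro f hf
    have h0 : f * y = 0 := by linear_combination v * hf - f * y * hv
    exact (hN.prime_left.dvd_or_dvd (h0 ▸ dvd_zero x)).resolve_right hN.not_dvd
  -- corrected by a multiple of `a ^ 2`, the approximation `t` of `x` is killed by `a`
  set j := t - a ^ 2 * r with hj
  have hja : j * a = 0 := by rw [hj]; linear_combination hr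
  have hcj : x ∣ c j := hnyx _ (by rw [← hu, ← map_mul, hja, map_zero])
  have hφb : φ b ≠ 0 := fun h0 => hby (by rw [hinf b h0 hb, map_zero]; exact dvd_zero _)
  -- the branch `B` is `x = 0`; some power of `q` is a multiple of `b` on `A`, and `B` is reduced
  have hJ : ∀ q, ψ q = 0 ↔ x ∣ c q := by
    intro q
    constructor
    · intro hq
      refine hnyx _ ?_
      rw [← hu, ← map_mul, hinf (q * a) (by rw [map_mul, ha, mul_zero])
        (by rw [map_mul, hq, zero_mul]), map_zero]
    · intro hq
      have hqI : ∀ i, φ i = 0 → q * i = 0 := fun i hi => hinj _ (by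
        rw [map_mul]
        exact hN.eq_zero _ (hq.mul_right _) ((hIy i hi).mul_left _))
      have hqm : q ∈ maximalIdeal R := by
        rw [← hc1]
        obtain ⟨q', hq'⟩ := hq
        rw [hq']; exact Ideal.mul_mem_right _ _ hN.mem_left
      obtain ⟨ϖ, hϖ⟩ := IsDiscreteValuationRing.exists_irreducible A
      obtain ⟨n, hn⟩ := IsDiscreteValuationRing.associated_pow_irreducible hφb hϖ
      have hqn : φ b ∣ φ q ^ n := by
        refine hn.dvd.trans (pow_dvd_pow_of_dvd ?_ n)
        have := (hφm q).2 hqm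
        rwa [hϖ.maximalIdeal_eq, Ideal.mem_span_singleton] at this
      obtain ⟨s', hs⟩ := hqn
      obtain ⟨s, rfl⟩ := hφ s'
      have h1 := hqI (q ^ n - b * s) (by rw [map_sub, map_pow, map_mul, hs, sub_self])
      have h2 : ψ (q ^ (n + 1)) = 0 := by
        have : q ^ (n + 1) = q * b * s := by linear_combination h1
        rw [this, map_mul, map_mul, hb]; ring
      rw [map_pow] at h2
      exact (pow_eq_zero_iff (Nat.succ_ne_zero n)).1 h2
  refine ⟨?_, a, j, ha, (hJ j).2 hcj, ?_, ?_⟩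
  · constructor
    · rw [Ne, Ideal.eq_top_iff_one, RingHom.mem_ker, hJ, map_one]
      exact fun h => hN.prime_left.not_isUnit (isUnit_of_dvd_one h)
    · intro f g hfg
      rw [RingHom.mem_ker, hJ, map_mul] at hfg
      rw [RingHom.mem_ker, RingHom.mem_ker, hJ, hJ]
      exact hN.prime_left.dvd_or_dvd hfg
  · intro h0
    exact ha2 (by rw [hinf a ha h0]; exact zero_mem _)
  · rw [hgen]
    refine le_antisymm ?_ ?_ <;> rw [Ideal.span_le] <;> rintro _ (rfl | rfl)
    · exact Ideal.mem_span_pair.2 ⟨1, a * r, by rw [hj]; ring⟩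
    · exact Ideal.subset_span (by simp)
    · exact Ideal.mem_span_pair.2 ⟨1, -(a * r), by rw [hj]; ring⟩
    · exact Ideal.subset_span (by simp)

/-- A Noetherian local ring whose completion is a formal node, written as a union of two branches
`A` and `B`: if `A` is smooth, `B` is reduced and `B` is not everything, then `B` is smooth too, and
the branches meet transversally. -/
theorem branch_of_isFormalNode {A B N : Type*} [CommRing A] [IsDomain A]
    [IsDiscreteValuationRing A] [CommRing B] [IsReduced B] [CommRing N] [IsLocalRing N]
    {x y : N} (hN : IsFormalNode N x y)
    (e : AdicCompletion (maximalIdeal R) R ≃+* N)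
    (φ : R →+* A) (hφ : Function.Surjective φ) (ψ : R →+* B) (hψ : Function.Surjective ψ)
    (hinf : ∀ r, φ r = 0 → ψ r = 0 → r = 0) (hne : ∃ b, b ≠ 0 ∧ ψ b = 0) :
    (∃ _ : IsDomain B, IsDiscreteValuationRing B) ∧
      maximalIdeal R ≤ RingHom.ker φ ⊔ RingHom.ker ψ := by
  let e' : AdicCompletion (maximalIdeal R) R →+* N := e
  let c : R →+* N := e'.comp (algebraMap R _)
  have he : ∀ n z, e z ∈ maximalIdeal N ^ n ↔
      z ∈ maximalIdeal (AdicCompletion (maximalIdeal R) R) ^ n := by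
    intro n z
    have h1 : (maximalIdeal (AdicCompletion (maximalIdeal R) R)).map e' =
        maximalIdeal N := by
      refine IsLocalRing.eq_maximalIdeal ?_
      exact Ideal.map_isMaximal_of_equiv e
    rw [← h1, ← Ideal.map_pow]
    constructor
    · intro h
      replace h := (Ideal.mem_map_of_equiv e _).1 h
      obtain ⟨w, hw, h⟩ := h
      rwa [← e.injective h]
    · exact fun h => Ideal.mem_map_of_mem e' h
  have hc : ∀ n r, c r ∈ maximalIdeal N ^ n ↔ r ∈ maximalIdeal R ^ n := fun n r =>
    (he n _).trans (algebraMap_completion_mem_pow n r)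
  have hd : ∀ n z, ∃ r, z - c r ∈ maximalIdeal N ^ n := by
    intro n z
    obtain ⟨r, hr⟩ := exists_sub_algebraMap_completion_mem_pow n (e.symm z)
    refine ⟨r, ?_⟩
    have := (he n _).2 hr
    simpa [c, e'] using this
  obtain ⟨b, hb0, hb⟩ := hne
  -- the nonzero element `b` of the ideal of `B` is nonzero on one of the two coordinate axes
  have hcb : ¬ (x ∣ c b ∧ y ∣ c b) := by
    rintro ⟨h1, h2⟩
    have h0 := hN.eq_zero _ h1 h2
    have : algebraMap R (AdicCompletion (maximalIdeal R) R) b = 0 := by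
      simpa [c, e'] using h0
    have hb' : b ∈ (⨅ n, maximalIdeal R ^ n : Ideal R) := by
      rw [Ideal.mem_iInf]; intro n; rw [← hc, h0]; exact zero_mem _
    rw [Ideal.iInf_pow_eq_bot_of_isLocalRing _ (maximalIdeal.isMaximal R).ne_top,
      Ideal.mem_bot] at hb'
    exact hb0 hb'
  obtain ⟨hprime, a, j, ha, hj, hψa, hm⟩ : (RingHom.ker ψ).IsPrime ∧ ∃ a j, φ a = 0 ∧ ψ j = 0 ∧
      ψ a ≠ 0 ∧ maximalIdeal R = Ideal.span {j, a} := by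
    by_cases h : y ∣ c b
    · exact branch_aux hN.symm c hc hd φ hφ ψ hinf hb fun h' => hcb ⟨h', h⟩
    · exact branch_aux hN c hc hd φ hφ ψ hinf hb h
  refine ⟨?_, ?_⟩
  · have hdom : IsDomain B :=
      (RingHom.quotientKerEquivOfSurjective hψ).symm.toMulEquiv.isDomain _
    have := IsLocalRing.of_surjective' ψ hψ
    have := isNoetherianRing_of_surjective _ _ ψ hψ
    have hmB : maximalIdeal B = Ideal.span {ψ a} := by
      have := IsLocalHom.of_surjective ψ hψ
      have hmap : (maximalIdeal R).map ψ = maximalIdeal B := by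
        rw [← maximalIdeal_comap ψ, Ideal.map_comap_of_surjective ψ hψ]
      rw [← hmap, hm, Ideal.map_span, Set.image_pair, hj]
      simp
    have hnf : ¬ IsField B := by
      intro hf
      have := IsLocalRing.isField_iff_maximalIdeal_eq.1 hf
      rw [this] at hmB
      exact hψa (by simpa using hmB.symm)
    have htfae : IsDiscreteValuationRing B ↔ (maximalIdeal B).IsPrincipal :=
      (IsDiscreteValuationRing.TFAE B hnf).out 0 4
    exact ⟨hdom, htfae.2 ⟨ψ a, hmB⟩⟩
  · rw [hm, Ideal.span_le]
    rintro _ (rfl | rfl)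
    · exact Ideal.mem_sup_right hj
    · exact Ideal.mem_sup_left ha

end NodeAlgebra
end NodalPruning

/-! ### The completed local ring of a node -/

namespace NodalPruning

section PowerSeriesNode
open IsLocalRing MvPowerSeries
variable {k : Type*} [Field k]

/-- The restriction of a power series in two variables to the coordinate axis `i`. -/
def axis (i : Fin 2) : MvPowerSeries (Fin 2) k →+* PowerSeries k where
  toFun f := PowerSeries.mk fun n => coeff (Finsupp.single i n) f
  map_one' := by
    classical
    ext n; simp [MvPowerSeries.coeff_one, PowerSeries.coeff_one]
  map_zero' := by ext n; simp
  map_add' f g := by ext n; simp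
  map_mul' f g := by
    classical
    ext n
    simp [MvPowerSeries.coeff_mul, PowerSeries.coeff_mul, Finsupp.antidiagonal_single]

/-- A power series that vanishes on one axis is divisible by the other coordinate. -/
lemma axis_eq_zero {i j : Fin 2} (hij : i ≠ j) (f : MvPowerSeries (Fin 2) k) :
    axis i f = 0 ↔ X j ∣ f := by
  rw [X_dvd_iff]
  constructor
  · intro h m hm
    have e : m = Finsupp.single i (m i) := by
      ext l
      by_cases hl : l = i
      · subst hl; simp
      · have : l = j := by omega
        subst this; simp [hm, hij]
    rw [e]
    simpa [axis] using congr(PowerSeries.coeff (m i) $h)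
  · intro h
    ext n
    simpa [axis] using h (Finsupp.single i n) (by simp [hij])

lemma X_prime {i j : Fin 2} (hij : i ≠ j) : Prime (X j : MvPowerSeries (Fin 2) k) := by
  refine ⟨fun h => ?_, fun h => ?_, fun f g h => ?_⟩
  · simpa [coeff_X] using congr(coeff (Finsupp.single j 1) $h)
  · simpa using (isUnit_iff_constantCoeff.1 h)
  · rw [← axis_eq_zero hij, map_mul, mul_eq_zero] at h
    rwa [← axis_eq_zero hij, ← axis_eq_zero hij]

lemma not_X_dvd_X {i j : Fin 2} (hij : i ≠ j) : ¬ (X j : MvPowerSeries (Fin 2) k) ∣ X i := by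
  intro h
  rw [X_dvd_iff] at h
  have := h (Finsupp.single i 1) (by simp [hij])
  simp [coeff_X] at this

lemma mem_span_X_of_constantCoeff {f : MvPowerSeries (Fin 2) k} (hf : constantCoeff f = 0) :
    f ∈ Ideal.span {(X 0 : MvPowerSeries (Fin 2) k), X 1} := by
  let g : MvPowerSeries (Fin 2) k := fun m => if m 0 = 0 then coeff m f else 0
  have h1 : (X 0 : MvPowerSeries (Fin 2) k) ∣ f - g := by
    rw [X_dvd_iff]
    intro m hm
    have : coeff m g = coeff m f := if_pos hm
    rw [map_sub, this, sub_self]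
  have h2 : (X 1 : MvPowerSeries (Fin 2) k) ∣ g := by
    rw [X_dvd_iff]
    intro m hm
    change (if m 0 = 0 then coeff m f else 0) = 0
    split_ifs with h0
    · have : m = 0 := by ext l; fin_cases l <;> simp [h0, hm]
      rw [this]; exact hf
    · rfl
  obtain ⟨a, ha⟩ := h1
  obtain ⟨b, hb⟩ := h2
  exact Ideal.mem_span_pair.2 ⟨a, b, by linear_combination -ha - hb⟩

variable (k) in
/-- The ring `k⟦x, y⟧ / (x * y)`. -/
abbrev NodeRing := MvPowerSeries (Fin 2) k ⧸
        Ideal.span {(MvPowerSeries.X 0 * MvPowerSeries.X 1 : MvPowerSeries (Fin 2) k)}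

lemma mk_X_dvd {i : Fin 2} {f : MvPowerSeries (Fin 2) k} :
    (Ideal.Quotient.mk _ (X i) : NodeRing k) ∣ Ideal.Quotient.mk _ f ↔ X i ∣ f := by
  constructor
  · rintro ⟨g, hg⟩
    obtain ⟨g, rfl⟩ := Ideal.Quotient.mk_surjective g
    rw [← map_mul, Ideal.Quotient.eq, Ideal.mem_span_singleton] at hg
    have h1 : (X i : MvPowerSeries (Fin 2) k) ∣ X 0 * X 1 := by
      fin_cases i
      · exact ⟨_, rfl⟩
      · exact ⟨X 0, mul_comm _ _⟩
    have := dvd_add (h1.trans hg) ⟨g, rfl⟩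
    rwa [sub_add_cancel] at this
  · exact fun h => map_dvd _ h

instance : IsLocalRing (NodeRing k) :=
  have : Nontrivial (NodeRing k) := by
    rw [Ideal.Quotient.nontrivial_iff, Ne, Ideal.span_singleton_eq_top, isUnit_iff_constantCoeff]
    simp
  IsLocalRing.of_surjective' (Ideal.Quotient.mk _) Ideal.Quotient.mk_surjective

lemma mk_X_prime {i j : Fin 2} (hij : i ≠ j) :
    Prime (Ideal.Quotient.mk _ (X j) : NodeRing k) := by
  refine ⟨fun h => ?_, fun h => ?_, fun f g h => ?_⟩
  · have hd : (Ideal.Quotient.mk _ (X i) : NodeRing k) ∣ Ideal.Quotient.mk _ (X j) :=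
      h ▸ dvd_zero _
    exact not_X_dvd_X hij.symm (mk_X_dvd.1 hd)
  · have hd : (Ideal.Quotient.mk _ (X j) : NodeRing k) ∣ Ideal.Quotient.mk _ 1 := h.dvd
    exact (X_prime hij).not_isUnit (isUnit_of_dvd_one (mk_X_dvd.1 hd))
  · obtain ⟨f, rfl⟩ := Ideal.Quotient.mk_surjective f
    obtain ⟨g, rfl⟩ := Ideal.Quotient.mk_surjective g
    rw [← map_mul, mk_X_dvd] at h
    rw [mk_X_dvd, mk_X_dvd]
    exact (X_prime hij).dvd_or_dvd h

variable (k) in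
/-- The completed local ring of a node is a formal node; divisibility by a coordinate is vanishing
on the other axis. -/
theorem isFormalNode_nodeRing : IsFormalNode (NodeRing k)
    (Ideal.Quotient.mk _ (X 0)) (Ideal.Quotient.mk _ (X 1)) where
  prime_left := mk_X_prime (i := 1) (by decide)
  prime_right := mk_X_prime (i := 0) (by decide)
  eq_zero f h0 h1 := by
    obtain ⟨f, rfl⟩ := Ideal.Quotient.mk_surjective f
    rw [mk_X_dvd] at h0 h1
    obtain ⟨g, rfl⟩ := h0
    have := ((X_prime (k := k) (i := 0) (j := 1) (by decide)).dvd_or_dvd h1).resolve_left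
      (not_X_dvd_X (by decide))
    rw [Ideal.Quotient.eq_zero_iff_mem, Ideal.mem_span_singleton]
    exact mul_dvd_mul_left _ this
  span_eq := by
    refine le_antisymm (fun f hf => ?_) ?_
    · obtain ⟨f, rfl⟩ := Ideal.Quotient.mk_surjective f
      have h0 : constantCoeff f = 0 := by
        by_contra h0
        exact (mem_maximalIdeal _).1 hf
          ((isUnit_iff_constantCoeff.2 (Ne.isUnit h0)).map (Ideal.Quotient.mk _))
      have := Ideal.mem_map_of_mem (Ideal.Quotient.mk
        (Ideal.span {(X 0 * X 1 : MvPowerSeries (Fin 2) k)})) (mem_span_X_of_constantCoeff h0)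
      rwa [Ideal.map_span, Set.image_pair] at this
    · rw [Ideal.span_le]
      rintro _ (rfl | rfl)
      · exact (mem_maximalIdeal _).2 (mk_X_prime (i := 1) (by decide)).not_isUnit
      · exact (mem_maximalIdeal _).2 (mk_X_prime (i := 0) (by decide)).not_isUnit
  not_dvd h := not_X_dvd_X (by decide) (mk_X_dvd.1 h)
  not_dvd' h := not_X_dvd_X (by decide) (mk_X_dvd.1 h)

end PowerSeriesNode

section Transport
open IsLocalRing

lemma maximalIdeal_pow_le_comap {R S : Type*} [CommRing R] [CommRing S] [IsLocalRing R]
    [IsLocalRing S] (e : R ≃+* S) (n : ℕ) :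
    maximalIdeal R ^ n ≤ (maximalIdeal S ^ n).comap (e : R →+* S) := by
  rw [← Ideal.map_le_iff_le_comap, Ideal.map_pow]
  refine Ideal.pow_right_mono ?_ n
  exact (map_ringEquiv_maximalIdeal e).le

lemma factorPow_comp_quotientMap {R S : Type*} [CommRing R] [CommRing S] [IsLocalRing R]
    [IsLocalRing S] (e : R ≃+* S) {m n : ℕ} (hmn : m ≤ n) :
    (Ideal.Quotient.factorPow (maximalIdeal S) hmn).comp
      ((Ideal.quotientMap (maximalIdeal S ^ n) (e : R →+* S) (maximalIdeal_pow_le_comap e n)).comp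
        (AdicCompletion.evalₐ (maximalIdeal R) n :
          AdicCompletion (maximalIdeal R) R →+* R ⧸ maximalIdeal R ^ n)) =
      (Ideal.quotientMap (maximalIdeal S ^ m) (e : R →+* S) (maximalIdeal_pow_le_comap e m)).comp
        (AdicCompletion.evalₐ (maximalIdeal R) m :
          AdicCompletion (maximalIdeal R) R →+* R ⧸ maximalIdeal R ^ m) := by
  refine RingHom.ext fun z => ?_
  obtain ⟨z, rfl⟩ := AdicCompletion.mk_surjective _ _ z
  simp only [RingHom.comp_apply, RingHom.coe_coe, AdicCompletion.evalₐ_mk,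
  Ideal.quotientMap_mk]
  refine Ideal.Quotient.eq.2 ?_
  rw [← map_sub]
  refine maximalIdeal_pow_le_comap e m ?_
  have h := z.2 hmn
  rw [SModEq.comm, SModEq.sub_mem] at h
  simpa using h

/-- The map on completions induced by an isomorphism of local rings. -/
def completionMap {R S : Type*} [CommRing R] [CommRing S] [IsLocalRing R]
    [IsLocalRing S] (e : R ≃+* S) :
    AdicCompletion (maximalIdeal R) R →+* AdicCompletion (maximalIdeal S) S :=
  AdicCompletion.liftRingHom (maximalIdeal S)
    (fun n => (Ideal.quotientMap (maximalIdeal S ^ n) (e : R →+* S)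
      (maximalIdeal_pow_le_comap e n)).comp
        (AdicCompletion.evalₐ (maximalIdeal R) n :
          AdicCompletion (maximalIdeal R) R →+* R ⧸ maximalIdeal R ^ n))
            (factorPow_comp_quotientMap e)

lemma evalₐ_completionMap {R S : Type*} [CommRing R] [CommRing S] [IsLocalRing R]
    [IsLocalRing S] (e : R ≃+* S) (n : ℕ) (z : AdicCompletion (maximalIdeal R) R) :
    AdicCompletion.evalₐ (maximalIdeal S) n (completionMap e z) =
      Ideal.quotientMap (maximalIdeal S ^ n) (e : R →+* S) (maximalIdeal_pow_le_comap e n)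
        (AdicCompletion.evalₐ (maximalIdeal R) n z) :=
  AdicCompletion.evalₐ_liftRingHom _ _ (factorPow_comp_quotientMap e) _ _

lemma completionMap_symm {R S : Type*} [CommRing R] [CommRing S] [IsLocalRing R]
    [IsLocalRing S] (e : R ≃+* S) (z : AdicCompletion (maximalIdeal R) R) :
    completionMap e.symm (completionMap e z) = z := by
  have H : ∀ n, AdicCompletion.evalₐ (maximalIdeal R) n (completionMap e.symm (completionMap e z)) =
      AdicCompletion.evalₐ (maximalIdeal R) n z := fun n => by
    rw [evalₐ_completionMap, evalₐ_completionMap]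
    obtain ⟨r, hr⟩ := Ideal.Quotient.mk_surjective (AdicCompletion.evalₐ (maximalIdeal R) n z)
    rw [← hr]
    simp
  exact AdicCompletion.ext_evalₐ H

/-- Completion at the maximal ideal is functorial in ring isomorphisms. -/
lemma nonempty_completion_ringEquiv {R S : Type*} [CommRing R] [CommRing S] [IsLocalRing R]
    [IsLocalRing S] (e : R ≃+* S) :
    Nonempty (AdicCompletion (maximalIdeal R) R ≃+* AdicCompletion (maximalIdeal S) S) := by
  exact ⟨RingEquiv.ofRingHom (completionMap e) (completionMap e.symm)
    (RingHom.ext fun z => completionMap_symm e.symm z)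
      (RingHom.ext fun z => completionMap_symm e z)⟩
end Transport
end NodalPruning

/-! ### Orders of vanishing on an affine line -/

namespace NodalPruning

section Order
open Order
variable {X : Scheme.{u}}

lemma coheight_eq_one {x : X} (hx : IsSmoothPoint x) : coheight x = 1 := by
  obtain ⟨_, _⟩ := hx
  have h1 := ringKrullDim_stalk_eq_coheight x
  have h2 : ringKrullDim (X.presheaf.stalk x) = 1 :=
    IsPrincipalIdealRing.ringKrullDim_eq_one _ (IsDiscreteValuationRing.not_isField _)
  rw [h2] at h1
  exact_mod_cast h1.symm

variable [IsIntegral X] [IsLocallyNoetherian X]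

lemma ord_algebraMap_of_isUnit {x : X} {u : X.presheaf.stalk x} (hu : IsUnit u) :
    Scheme.ord (algebraMap _ X.functionField u) x = 0 := by
  by_cases! hx : coheight x ≠ 1
  · simp [hx]
  have : Ring.KrullDimLE 1 (X.presheaf.stalk x) := krullDimLE_of_coheight_le hx.le
  rw [Scheme.ord_eq_iff hx ((hu.map (algebraMap _ X.functionField)).ne_zero)]
  exact Ring.ordFrac_of_isUnit hu

lemma ord_algebraMap_of_irreducible {x : X} (hx : IsSmoothPoint x) {u : X.presheaf.stalk x}
    (hu : Irreducible u) : Scheme.ord (algebraMap _ X.functionField u) x = 1 := by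
  have hc := coheight_eq_one hx
  obtain ⟨_, _⟩ := hx
  have : Ring.KrullDimLE 1 (X.presheaf.stalk x) := krullDimLE_of_coheight_le hc.le
  rw [Scheme.ord_eq_iff hc]
  · exact Ring.ordFrac_irreducible hu
  · rw [Ne, map_eq_zero_iff _ (IsFractionRing.injective _ _)]; exact hu.ne_zero

/-- The local ring of a smooth point is the valuation ring of the order of vanishing. -/
lemma ord_nonneg_iff {x : X} (hx : IsSmoothPoint x) {f : X.functionField} (hf : f ≠ 0) :
    0 ≤ Scheme.ord f x ↔ ∃ a : X.presheaf.stalk x, algebraMap _ _ a = f := by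
  have hc := coheight_eq_one hx
  obtain ⟨_, _⟩ := hx
  have : Ring.KrullDimLE 1 (X.presheaf.stalk x) := krullDimLE_of_coheight_le hc.le
  rw [Scheme.le_ord_iff hc hf]
  change 1 ≤ Ring.ordFrac (X.presheaf.stalk x) f ↔ _
  constructor
  · intro h
    rw [Ring.ordFrac_eq_valuation_inv] at h
    refine IsDiscreteValuationRing.exists_lift_of_le_one ?_
    exact (one_le_inv₀ (zero_lt_iff.2 ((Valuation.ne_zero_iff _).2 hf))).1 h
  · rintro ⟨a, rfl⟩
    exact Ring.ordFrac_ge_one_of_ne_zero (by rintro rfl; simp at hf)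

lemma ord_one (x : X) : Scheme.ord (1 : X.functionField) x = 0 := by
  simpa using ord_algebraMap_of_isUnit (x := x) isUnit_one

lemma ord_inv {f : X.functionField} (hf : f ≠ 0) (x : X) :
    Scheme.ord f⁻¹ x = - Scheme.ord f x := by
  have := Scheme.ord_mul (x := x) hf (inv_ne_zero hf)
  rw [mul_inv_cancel₀ hf, ord_one] at this
  linarith

lemma ord_pow {f : X.functionField} (hf : f ≠ 0) (x : X) (n : ℕ) :
    Scheme.ord (f ^ n) x = n * Scheme.ord f x := by
  induction n with
  | zero => simp [ord_one]
  | succ n ih =>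
    rw [pow_succ, Scheme.ord_mul (pow_ne_zero _ hf) hf, ih]; push_cast; ring

lemma ord_zpow {f : X.functionField} (hf : f ≠ 0) (x : X) (n : ℤ) :
    Scheme.ord (f ^ n) x = n * Scheme.ord f x := by
  cases n with
  | ofNat n => simpa using ord_pow hf x n
  | negSucc n =>
    rw [zpow_negSucc, ord_inv (pow_ne_zero _ hf), ord_pow hf, Int.negSucc_eq]; push_cast; ring

lemma ord_prod {ι : Type*} (s : Finset ι) (f : ι → X.functionField) (hf : ∀ i ∈ s, f i ≠ 0)
    (x : X) : Scheme.ord (∏ i ∈ s, f i) x = ∑ i ∈ s, Scheme.ord (f i) x := by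
  classical
  induction s using Finset.induction_on with
  | empty => simp [ord_one]
  | insert i s hi ih =>
    rw [Finset.prod_insert hi, Finset.sum_insert hi, Scheme.ord_mul (hf _ (by simp))
      (Finset.prod_ne_zero_iff.2 fun j hj => hf j (by simp [hj])),
      ih fun j hj => hf j (by simp [hj])]

end Order

section Chart
open Polynomial
variable {T : Scheme.{u}} {k : Type u} [Field k]

section
variable {U : T.Opens} (hU : IsAffineOpen U) (θ : k[X] ≃+* Γ(T, U))

lemma mem_primeIdealOf_iff {x : T} (hx : x ∈ U) (f : Γ(T, U)) :
    f ∈ (hU.primeIdealOf ⟨x, hx⟩).asIdeal ↔ x ∉ T.basicOpen f := by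
  let _ := TopCat.Presheaf.algebra_section_stalk T.presheaf ⟨x, hx⟩
  have := hU.isLocalization_stalk ⟨x, hx⟩
  rw [T.mem_basicOpen f x hx, ← not_iff_not, not_not]
  exact (IsLocalization.AtPrime.isUnit_to_map_iff (T.presheaf.stalk x)
    (hU.primeIdealOf ⟨x, hx⟩).asIdeal f).symm

include hU in
/-- Away from the generic point, the points of an affine line are given by coordinates. -/
lemma exists_coordinate [IsAlgClosed k] [IsIntegral T] {x : T} (hx : x ∈ U)
    (hg : x ≠ genericPoint T) :
    ∃ a : k, x ∉ T.basicOpen (θ (X - C a)) := by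
  have : Nonempty U := ⟨⟨x, hx⟩⟩
  set P := (hU.primeIdealOf ⟨x, hx⟩).asIdeal with hP
  have hbot : P ≠ ⊥ := by
    intro h
    apply hg
    have h1 : hU.primeIdealOf ⟨x, hx⟩ = genericPoint (Spec Γ(T, U)) := by
      rw [genericPoint_eq_bot_of_affine]; exact PrimeSpectrum.ext h
    rw [← hU.primeIdealOf_genericPoint] at h1
    have := congr(hU.fromSpec $h1)
    rwa [hU.fromSpec_primeIdealOf, hU.fromSpec_primeIdealOf] at this
  obtain ⟨f, hf, hf0⟩ := Submodule.exists_mem_ne_zero_of_ne_bot hbot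
  obtain ⟨p, rfl⟩ := θ.surjective f
  have hp0 : p ≠ 0 := by rintro rfl; simp at hf0
  have hsp := (IsAlgClosed.splits p).eq_prod_roots
  rw [hsp, map_mul, map_multiset_prod, Multiset.map_map] at hf
  have hprime : P.IsPrime := (hU.primeIdealOf ⟨x, hx⟩).isPrime
  rcases hprime.mem_or_mem hf with h | h
  · exfalso
    refine hprime.ne_top (Ideal.eq_top_of_isUnit_mem _ h ?_)
    exact ((isUnit_C.2 (Ne.isUnit (leadingCoeff_ne_zero.2 hp0)))).map θ
  · rw [hprime.multiset_prod_mem_iff_exists_mem] at h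
    obtain ⟨_, hm, h⟩ := h
    obtain ⟨a, -, rfl⟩ := Multiset.mem_map.1 hm
    exact ⟨a, (mem_primeIdealOf_iff hU hx _).1 h⟩

include hU in
/-- The prime ideal of the point of an affine line with coordinate `a`. -/
lemma primeIdealOf_eq_of_coordinate {x : T} (hx : x ∈ U) {a : k}
    (ha : x ∉ T.basicOpen (θ (X - C a))) :
    (hU.primeIdealOf ⟨x, hx⟩).asIdeal = Ideal.span {θ (X - C a)} := by
  have hmax : (Ideal.span {(X - C a : k[X])}).IsMaximal :=
    PrincipalIdealRing.isMaximal_of_irreducible (irreducible_X_sub_C a)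
  have hmax' := Ideal.map_isMaximal_of_equiv θ (p := Ideal.span {(X - C a : k[X])})
  rw [Ideal.map_span, Set.image_singleton] at hmax'
  refine (hmax'.eq_of_le (hU.primeIdealOf ⟨x, hx⟩).isPrime.ne_top ?_).symm
  rw [Ideal.span_singleton_le_iff_mem]
  exact (mem_primeIdealOf_iff hU hx _).2 ha

include hU in
lemma eq_of_coordinate {x y : T} (hx : x ∈ U) (hy : y ∈ U) {a : k}
    (ha : x ∉ T.basicOpen (θ (X - C a))) (hb : y ∉ T.basicOpen (θ (X - C a))) : x = y := by
  have h1 : hU.primeIdealOf ⟨x, hx⟩ = hU.primeIdealOf ⟨y, hy⟩ := PrimeSpectrum.ext (by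
    rw [primeIdealOf_eq_of_coordinate hU θ hx ha, primeIdealOf_eq_of_coordinate hU θ hy hb])
  have := congr(hU.fromSpec $h1)
  rwa [hU.fromSpec_primeIdealOf, hU.fromSpec_primeIdealOf] at this

include hU in
lemma mem_basicOpen_iff_eval {x : T} (hx : x ∈ U) {a : k}
    (ha : x ∉ T.basicOpen (θ (X - C a))) (p : k[X]) : x ∈ T.basicOpen (θ p) ↔ p.eval a ≠ 0 := by
  rw [← not_iff_not, ← mem_primeIdealOf_iff hU hx, primeIdealOf_eq_of_coordinate hU θ hx ha,
    Ideal.mem_span_singleton, not_not]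
  rw [map_dvd_iff, dvd_iff_isRoot, IsRoot]

include hU in
lemma isSmoothPoint_of_coordinate [IsIntegral T] {x : T} (hx : x ∈ U) {a : k}
    (ha : x ∉ T.basicOpen (θ (X - C a))) :
    IsSmoothPoint x ∧ Irreducible (T.presheaf.germ U x hx (θ (X - C a))) := by
  have : Nonempty U := ⟨⟨x, hx⟩⟩
  let _ := TopCat.Presheaf.algebra_section_stalk T.presheaf ⟨x, hx⟩
  have hloc := hU.isLocalization_stalk ⟨x, hx⟩
  have hP := primeIdealOf_eq_of_coordinate hU θ hx ha
  have hpir : IsPrincipalIdealRing Γ(T, U) := IsPrincipalIdealRing.of_surjective θ θ.surjective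
  have hne : θ (X - C a) ≠ 0 := by
    rw [Ne, EmbeddingLike.map_eq_zero_iff]; exact X_sub_C_ne_zero a
  have hbot : (hU.primeIdealOf ⟨x, hx⟩).asIdeal ≠ ⊥ := by
    rw [hP, Ne, Ideal.span_singleton_eq_bot]; exact hne
  have hdvr : IsDiscreteValuationRing (T.presheaf.stalk x) :=
    IsLocalization.AtPrime.isDiscreteValuationRing_of_dedekind_domain Γ(T, U) hbot _
  refine ⟨⟨inferInstance, hdvr⟩, ?_⟩
  rw [IsDiscreteValuationRing.irreducible_iff_uniformizer]
  have := IsLocalization.AtPrime.map_eq_maximalIdeal (hU.primeIdealOf ⟨x, hx⟩).asIdeal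
    (T.presheaf.stalk x)
  rw [← this, hP, Ideal.map_span, Set.image_singleton]
  rfl

include hU in
/-- The order of a polynomial at a point of an affine line is its root multiplicity there. -/
lemma ord_eq_rootMultiplicity [IsIntegral T] [IsLocallyNoetherian T] [Nonempty U]
    {x : T} (hx : x ∈ U) {a : k}
    (ha : x ∉ T.basicOpen (θ (X - C a))) {p : k[X]} (hp : p ≠ 0) :
    Scheme.ord (T.germToFunctionField U (θ p)) x = p.rootMultiplicity a := by
  obtain ⟨hsm, hirr⟩ := isSmoothPoint_of_coordinate hU θ hx ha
  obtain ⟨q, hq, hr⟩ := exists_eq_pow_rootMultiplicity_mul_and_not_dvd p hp a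
  have hinj : ∀ r : k[X], r ≠ 0 → T.germToFunctionField U (θ r) ≠ 0 := by
    intro r hr
    rw [Ne, map_eq_zero_iff _ (T.germToFunctionField_injective U), EmbeddingLike.map_eq_zero_iff]
    exact hr
  have hq0 : q ≠ 0 := by rintro rfl; simp at hr
  have h1 : Scheme.ord (T.germToFunctionField U (θ q)) x = 0 := by
    rw [← Scheme.algebraMap_germ_eq_germToFunctionField T hx]
    refine ord_algebraMap_of_isUnit ?_
    rw [← T.mem_basicOpen, mem_basicOpen_iff_eval hU θ hx ha]
    rwa [dvd_iff_isRoot] at hr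
  have h2 : Scheme.ord (T.germToFunctionField U (θ (X - C a))) x = 1 := by
    rw [← Scheme.algebraMap_germ_eq_germToFunctionField T hx]
    exact ord_algebraMap_of_irreducible hsm hirr
  conv_lhs => rw [hq]
  rw [map_mul, map_mul, map_pow, map_pow,
    Scheme.ord_mul (pow_ne_zero _ (hinj _ (X_sub_C_ne_zero a))) (hinj _ hq0), h1, add_zero,
    ord_pow (hinj _ (X_sub_C_ne_zero a)), h2, mul_one]

/-- Every scalar is the coordinate of a point of an affine line. -/
lemma exists_point_of_coordinate (a : k) : ∃ x ∈ U, x ∉ T.basicOpen (θ (X - C a)) := by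
  by_contra! h
  have := T.toRingedSpace.isUnit_of_isUnit_germ U (θ (X - C a))
    fun x hx => (T.mem_basicOpen _ _ hx).1 (h x hx)
  rw [isUnit_map_iff] at this
  exact not_isUnit_X_sub_C a this
end
end Chart
end NodalPruning

/-! ### Rational functions on a projective line -/

namespace NodalPruning

/-- The ring homomorphism from the base field to the global functions of a `k`-scheme. -/
def scalar {k : Type u} [Field k] {X : Scheme.{u}} (str : X ⟶ Spec (.of k)) : k →+* Γ(X, ⊤) :=
  ((Scheme.ΓSpecIso (.of k)).inv ≫ str.appTop).hom

open Polynomial in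
/-- The standard affine charts of a projective line `T` over `k`: two affine lines covering `T` with
coordinates `θ₀ X` and `θ₁ X` that are inverse to each other on the overlap. -/
structure LineCharts {k : Type u} [Field k] {T : Scheme.{u}} (str : T ⟶ Spec (.of k)) where
  U₀ : T.Opens
  U₁ : T.Opens
  affine₀ : IsAffineOpen U₀
  affine₁ : IsAffineOpen U₁
  cover : ∀ x, x ∈ U₀ ∨ x ∈ U₁
  θ₀ : k[X] ≃+* Γ(T, U₀)
  θ₁ : k[X] ≃+* Γ(T, U₁)
  scalar₀ : ∀ c, θ₀ (C c) = resO le_top (scalar str c)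
  scalar₁ : ∀ c, θ₁ (C c) = resO le_top (scalar str c)
  inv : resO (inf_le_left : U₀ ⊓ U₁ ≤ U₀) (θ₀ X) * resO (inf_le_right : U₀ ⊓ U₁ ≤ U₁) (θ₁ X) = 1
  basicOpen_le : T.basicOpen (θ₁ X) ≤ U₀

namespace LineCharts
open Polynomial
variable {k : Type u} [Field k] {T : Scheme.{u}} {str : T ⟶ Spec (.of k)} (𝒞 : LineCharts str)

section

lemma nonempty₀ : Nonempty 𝒞.U₀ := by
  obtain ⟨x, hx, -⟩ := exists_point_of_coordinate 𝒞.θ₀ 0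
  exact ⟨⟨x, hx⟩⟩

lemma nonempty₁ : Nonempty 𝒞.U₁ := by
  obtain ⟨x, hx, -⟩ := exists_point_of_coordinate 𝒞.θ₁ 0
  exact ⟨⟨x, hx⟩⟩

/-- The point at infinity of the projective line. -/
lemma exists_infinity : ∃ x ∈ 𝒞.U₁, x ∉ 𝒞.U₀ ∧ x ∉ T.basicOpen (𝒞.θ₁ (X - C 0)) := by
  obtain ⟨x, hx, h⟩ := exists_point_of_coordinate 𝒞.θ₁ 0
  refine ⟨x, hx, fun h0 => h ?_, h⟩
  rw [C_0, sub_zero]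
  have hu : IsUnit (resO (inf_le_right : 𝒞.U₀ ⊓ 𝒞.U₁ ≤ 𝒞.U₁) (𝒞.θ₁ X)) :=
    .of_mul_eq_one _ ((mul_comm _ _).trans 𝒞.inv)
  have h2 := T.basicOpen_of_isUnit hu
  rw [basicOpen_resO] at h2
  have : x ∈ 𝒞.U₀ ⊓ 𝒞.U₁ := ⟨h0, hx⟩
  rw [← h2] at this
  exact this.2

lemma not_mem₀ {x : T} (hx : x ∉ 𝒞.U₀) : x ∈ 𝒞.U₁ ∧ x ∉ T.basicOpen (𝒞.θ₁ (X - C 0)) := by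
  refine ⟨(𝒞.cover x).resolve_left hx, fun h => hx ?_⟩
  rw [C_0, sub_zero] at h
  exact 𝒞.basicOpen_le h

lemma eq_of_not_mem₀ {x y : T} (hx : x ∉ 𝒞.U₀) (hy : y ∉ 𝒞.U₀) : x = y :=
  eq_of_coordinate 𝒞.affine₁ 𝒞.θ₁ (𝒞.not_mem₀ hx).1 (𝒞.not_mem₀ hy).1 (𝒞.not_mem₀ hx).2
    (𝒞.not_mem₀ hy).2

variable [IsIntegral T]

lemma generic_mem (U : T.Opens) [h : Nonempty U] : genericPoint T ∈ U :=
  ((genericPoint_spec T).mem_open_set_iff U.isOpen).mpr (by simpa using h)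

/-- Polynomials as rational functions on the projective line. -/
def ι : k[X] →+* T.functionField :=
  have := 𝒞.nonempty₀
  (T.germToFunctionField 𝒞.U₀).hom.comp (𝒞.θ₀ : k[X] →+* Γ(T, 𝒞.U₀))

lemma ι_apply [Nonempty 𝒞.U₀] (p : k[X]) : 𝒞.ι p = T.germToFunctionField 𝒞.U₀ (𝒞.θ₀ p) := rfl

lemma ι_injective : Function.Injective 𝒞.ι := by
  have := 𝒞.nonempty₀
  exact (T.germToFunctionField_injective 𝒞.U₀).comp 𝒞.θ₀.injective

lemma ι_ne_zero {p : k[X]} (hp : p ≠ 0) : 𝒞.ι p ≠ 0 := by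
  rwa [Ne, map_eq_zero_iff _ 𝒞.ι_injective]

lemma ι_C [Nonempty (⊤ : T.Opens)] (c : k) :
    𝒞.ι (C c) = T.germToFunctionField ⊤ (scalar str c) := by
  have := 𝒞.nonempty₀
  rw [𝒞.ι_apply, 𝒞.scalar₀]
  exact germ_resO _ _ _ _

/-- Every rational function is a quotient of polynomials. -/
lemma exists_div (f : T.functionField) : ∃ n m : k[X], m ≠ 0 ∧ f = 𝒞.ι n / 𝒞.ι m := by
  have := 𝒞.nonempty₀
  have := functionField_isFractionRing_of_isAffineOpen T 𝒞.U₀ 𝒞.affine₀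
  obtain ⟨a, b, hb, rfl⟩ := IsFractionRing.div_surjective (A := Γ(T, 𝒞.U₀)) f
  obtain ⟨n, rfl⟩ := 𝒞.θ₀.surjective a
  obtain ⟨m, rfl⟩ := 𝒞.θ₀.surjective b
  refine ⟨n, m, ?_, rfl⟩
  rintro rfl
  exact nonZeroDivisors.ne_zero hb (map_zero _)

include 𝒞 in
lemma isSmoothPoint [IsAlgClosed k] {x : T} (hx : x ≠ genericPoint T) : IsSmoothPoint x := by
  rcases 𝒞.cover x with h | h
  · obtain ⟨a, ha⟩ := exists_coordinate 𝒞.affine₀ 𝒞.θ₀ h hx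
    exact (isSmoothPoint_of_coordinate 𝒞.affine₀ 𝒞.θ₀ h ha).1
  · obtain ⟨a, ha⟩ := exists_coordinate 𝒞.affine₁ 𝒞.θ₁ h hx
    exact (isSmoothPoint_of_coordinate 𝒞.affine₁ 𝒞.θ₁ h ha).1

variable [IsLocallyNoetherian T]

lemma ord_ι_finite {x : T} (hx : x ∈ 𝒞.U₀) {a : k} (ha : x ∉ T.basicOpen (𝒞.θ₀ (X - C a)))
    {p : k[X]} (hp : p ≠ 0) : Scheme.ord (𝒞.ι p) x = p.rootMultiplicity a := by
  have := 𝒞.nonempty₀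
  exact ord_eq_rootMultiplicity 𝒞.affine₀ 𝒞.θ₀ hx ha hp

/-- A polynomial of degree `n` has a pole of order `n` at infinity, because it is `X ^ n` times its
reverse as a polynomial in the inverse coordinate. -/
lemma ord_ι_infinity {x : T} (hx : x ∉ 𝒞.U₀) {p : k[X]} (hp : p ≠ 0) :
    Scheme.ord (𝒞.ι p) x = -p.natDegree := by
  have h0 := 𝒞.nonempty₀
  have h1 := 𝒞.nonempty₁
  have ht : Nonempty (⊤ : T.Opens) := ⟨⟨genericPoint T, trivial⟩⟩
  let ι' : k[X] →+* T.functionField :=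
    (T.germToFunctionField 𝒞.U₁).hom.comp (𝒞.θ₁ : k[X] →+* Γ(T, 𝒞.U₁))
  have hη : genericPoint T ∈ 𝒞.U₀ ⊓ 𝒞.U₁ := ⟨generic_mem _, generic_mem _⟩
  have hinv : 𝒞.ι X * ι' X = 1 := by
    have := congr(T.presheaf.germ _ (genericPoint T) hη $𝒞.inv)
    rwa [map_mul, map_one, germ_resO, germ_resO] at this
  have hC : ι'.comp C = 𝒞.ι.comp C := by
    ext c
    change T.germToFunctionField 𝒞.U₁ (𝒞.θ₁ (C c)) = 𝒞.ι (C c)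
    rw [𝒞.ι_C]
    rw [𝒞.scalar₁]
    exact germ_resO _ _ _ _
  have hev : ∀ q, 𝒞.ι q = q.eval₂ (𝒞.ι.comp C) (𝒞.ι X) := fun q => by
    conv_lhs => rw [← q.eval₂_C_X, hom_eval₂]
  have hev' : ∀ q, ι' q = q.eval₂ (𝒞.ι.comp C) (ι' X) := fun q => by
    conv_lhs => rw [← q.eval₂_C_X, hom_eval₂]
    rw [hC]
  have hX0 : 𝒞.ι X ≠ 0 := 𝒞.ι_ne_zero X_ne_zero
  have hrev : 𝒞.ι p = ι' p.reverse * 𝒞.ι X ^ p.natDegree := by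
    let _ : Invertible (𝒞.ι X) := ⟨ι' X, by rw [mul_comm, hinv], hinv⟩
    rw [hev, hev']
    exact (eval₂_reverse_mul_pow _ (𝒞.ι X) p).symm
  have ho : ∀ q : k[X], q ≠ 0 → Scheme.ord (ι' q) x = q.rootMultiplicity 0 := fun q hq =>
    ord_eq_rootMultiplicity 𝒞.affine₁ 𝒞.θ₁ (𝒞.not_mem₀ hx).1 (𝒞.not_mem₀ hx).2 hq
  have hr0 : p.reverse ≠ 0 := by rwa [Ne, reverse_eq_zero]
  have hne : ι' p.reverse ≠ 0 := by
    intro h; rw [h, zero_mul] at hrev; exact 𝒞.ι_ne_zero hp hrev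
  have hX' : ι' X ≠ 0 := right_ne_zero_of_mul_eq_one hinv
  have ordX : Scheme.ord (𝒞.ι X) x = -1 := by
    have h2 := ho X X_ne_zero
    have h3 := Scheme.ord_mul (x := x) hX0 hX'
    rw [hinv, ord_one, h2] at h3
    have h4 : (X : k[X]).rootMultiplicity 0 = 1 := by
      simpa using rootMultiplicity_X_sub_C_self (x := (0 : k))
    rw [h4] at h3
    push_cast at h3; linarith
  rw [hrev, Scheme.ord_mul hne (pow_ne_zero _ hX0), ord_pow hX0, ordX, ho _ hr0,
    rootMultiplicity_eq_zero]
  · simp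
  · rw [IsRoot, ← coeff_zero_eq_eval_zero, coeff_zero_reverse, leadingCoeff_eq_zero]
    exact hp

variable [IsAlgClosed k]

/-- On the projective line every divisor `D` is equivalent to a multiple of the point at infinity:
there is a rational function `q` with the divisor `D - deg D · ∞`. -/
lemma exists_function (D : T →₀ ℤ) (hD : D (genericPoint T) = 0) :
    ∃ q : T.functionField, q ≠ 0 ∧ (∀ x ∈ 𝒞.U₀, x ≠ genericPoint T → Scheme.ord q x = D x) ∧
      ∀ x, x ∉ 𝒞.U₀ → Scheme.ord q x = D x - D.sum fun _ n => n := by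
  classical
  have hco : ∀ x : T, ∃ a : k, x ∈ 𝒞.U₀ → x ≠ genericPoint T →
      x ∉ T.basicOpen (𝒞.θ₀ (X - C a)) := by
    intro x
    by_cases h : x ∈ 𝒞.U₀ ∧ x ≠ genericPoint T
    · obtain ⟨a, ha⟩ := exists_coordinate 𝒞.affine₀ 𝒞.θ₀ h.1 h.2
      exact ⟨a, fun _ _ => ha⟩
    · exact ⟨0, fun h1 h2 => absurd ⟨h1, h2⟩ h⟩
  choose a ha using hco
  let S := D.support.filter (· ∈ 𝒞.U₀)
  have hS : ∀ y ∈ S, y ∈ 𝒞.U₀ ∧ y ≠ genericPoint T := by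
    intro y hy
    obtain ⟨h1, h2⟩ := Finset.mem_filter.1 hy
    refine ⟨h2, ?_⟩
    rintro rfl
    exact (Finsupp.mem_support_iff.1 h1) hD
  let F : T → T.functionField := fun y => 𝒞.ι (X - C (a y))
  have hF : ∀ y, F y ≠ 0 := fun y => 𝒞.ι_ne_zero (X_sub_C_ne_zero _)
  have hq : ∀ x, Scheme.ord (∏ y ∈ S, F y ^ D y) x = ∑ y ∈ S, D y * Scheme.ord (F y) x := by
    intro x
    rw [ord_prod _ _ fun y _ => zpow_ne_zero _ (hF y)]
    exact Finset.sum_congr rfl fun y _ => ord_zpow (hF y) x _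
  -- the product of the functions `X - a y` with multiplicities `D y`
  refine ⟨∏ y ∈ S, F y ^ D y, Finset.prod_ne_zero_iff.2 fun y _ => zpow_ne_zero _ (hF y), ?_, ?_⟩
  · intro x hx hxg
    have h1 : ∀ y ∈ S, D y * Scheme.ord (F y) x = if y = x then D x else 0 := by
      intro y hy
      obtain ⟨hy0, hyg⟩ := hS y hy
      rw [𝒞.ord_ι_finite hx (ha x hx hxg) (X_sub_C_ne_zero _)]
      split_ifs with hxy
      · subst hxy; rw [rootMultiplicity_X_sub_C_self, Nat.cast_one, mul_one]
      · have : a y ≠ a x := by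
          intro h
          have h2 := ha y hy0 hyg
          rw [h] at h2
          exact hxy (eq_of_coordinate 𝒞.affine₀ 𝒞.θ₀ hy0 hx h2 (ha x hx hxg))
        rw [rootMultiplicity_eq_zero]
        · simp
        · simpa [IsRoot, sub_eq_zero] using this.symm
    rw [hq, Finset.sum_congr rfl h1, Finset.sum_ite_eq']
    split_ifs with hxS
    · rfl
    · by_contra h
      exact hxS (Finset.mem_filter.2 ⟨Finsupp.mem_support_iff.2 (Ne.symm h), hx⟩)
  · intro x hx
    rw [hq]
    have h1 : ∀ y ∈ S, D y * Scheme.ord (F y) x = - D y := by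
      intro y _
      rw [𝒞.ord_ι_infinity hx (X_sub_C_ne_zero _)]
      simp
    rw [Finset.sum_congr rfl h1, Finset.sum_neg_distrib, Finsupp.sum,
      ← Finset.sum_filter_add_sum_filter_not D.support (· ∈ 𝒞.U₀)]
    have h2 : ∑ y ∈ D.support.filter (· ∉ 𝒞.U₀), D y = D x := by
      by_cases hxD : x ∈ D.support
      · rw [Finset.sum_eq_single x]
        · intro y hy hyx
          exact absurd (𝒞.eq_of_not_mem₀ (Finset.mem_filter.1 hy).2 hx) hyx
        · exact fun h => absurd (Finset.mem_filter.2 ⟨hxD, hx⟩) h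
      · rw [Finsupp.notMem_support_iff.1 hxD]
        refine Finset.sum_eq_zero fun y hy => ?_
        have := 𝒞.eq_of_not_mem₀ (Finset.mem_filter.1 hy).2 hx
        rw [this, Finsupp.notMem_support_iff.1 hxD]
    rw [h2]
    change -∑ y ∈ S, D y = D x - (∑ y ∈ S, D y + D x)
    ring

/-- A rational function with poles at most at infinity is a polynomial. -/
lemma exists_polynomial {f : T.functionField} (hf : f ≠ 0)
    (h : ∀ x ∈ 𝒞.U₀, x ≠ genericPoint T → 0 ≤ Scheme.ord f x) : ∃ p, f = 𝒞.ι p := by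
  classical
  obtain ⟨n, m, hm, rfl⟩ := 𝒞.exists_div f
  have hn : n ≠ 0 := by rintro rfl; simp at hf
  -- compare root multiplicities of the numerator and of the denominator
  suffices m ∣ n by
    obtain ⟨p, rfl⟩ := this
    exact ⟨p, by rw [map_mul, mul_div_cancel_left₀ _ (𝒞.ι_ne_zero hm)]⟩
  refine (IsAlgClosed.splits m).dvd_of_roots_le_roots hm ?_
  rw [Multiset.le_iff_count]
  intro a
  rw [count_roots, count_roots]
  obtain ⟨x, hx, hxa⟩ := exists_point_of_coordinate 𝒞.θ₀ a
  have hxg : x ≠ genericPoint T := by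
    rintro rfl
    have h1 := (isSmoothPoint_of_coordinate 𝒞.affine₀ 𝒞.θ₀ hx hxa).2
    have h0 := 𝒞.nonempty₀
    refine h1.not_isUnit (Ne.isUnit ?_ : @IsUnit T.functionField _ _)
    exact 𝒞.ι_ne_zero (X_sub_C_ne_zero a)
  have h1 := h x hx hxg
  rw [div_eq_mul_inv, Scheme.ord_mul (𝒞.ι_ne_zero hn) (inv_ne_zero (𝒞.ι_ne_zero hm)),
    ord_inv (𝒞.ι_ne_zero hm), 𝒞.ord_ι_finite hx hxa hn, 𝒞.ord_ι_finite hx hxa hm] at h1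
  lia

end

end LineCharts
end NodalPruning

/-! ### Sections of line bundles as rational functions -/

namespace NodalPruning

section Val
variable {T : Scheme.{u}} [IsIntegral T] {M : T.Modules} {W₀ : T.Opens} {g₀ : Γ(M, W₀)}

lemma generic_mem_inf {U V : T.Opens} (hU : genericPoint T ∈ U) (hV : genericPoint T ∈ V) :
    genericPoint T ∈ U ⊓ V := ⟨hU, hV⟩

lemma generic_mem_top : genericPoint T ∈ (⊤ : T.Opens) := trivial

/-- A section of a line bundle on an integral scheme as a rational function, by means of a
generator `g₀` over a nonempty open set. -/
def val (hg : IsGenerator M g₀) (h₀ : genericPoint T ∈ W₀) {W : T.Opens} (hW : genericPoint T ∈ W)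
    (σ : Γ(M, W)) :
    T.functionField :=
  T.presheaf.germ (W ⊓ W₀) (genericPoint T) ⟨hW, h₀⟩
    (hg.exists_smul inf_le_right (resM M (inf_le_left : W ⊓ W₀ ≤ W) σ)).choose

variable (hg : IsGenerator M g₀) (h₀ : genericPoint T ∈ W₀)

lemma val_eq {W W' : T.Opens} (hW : genericPoint T ∈ W) (hW' : genericPoint T ∈ W') (h : W' ≤ W)
    (h' : W' ≤ W₀)
    {σ : Γ(M, W)} {a : Γ(T, W')} (ha : resM M h σ = a • resM M h' g₀) :
    val hg h₀ hW σ = T.presheaf.germ W' (genericPoint T) hW' a := by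
  have hs := (hg.exists_smul inf_le_right (resM M (inf_le_left : W ⊓ W₀ ≤ W) σ)).choose_spec
  set b := (hg.exists_smul inf_le_right (resM M (inf_le_left : W ⊓ W₀ ≤ W) σ)).choose
  have hle : W' ≤ W ⊓ W₀ := le_inf h h'
  have h1 := congr(resM M hle $hs)
  rw [resM_resM, resM_smul, resM_resM, ha] at h1
  have h2 := hg.smul_inj h' h1
  rw [h2, germ_resO]
  rfl

lemma exists_val_spec {W : T.Opens} (hW : genericPoint T ∈ W) (σ : Γ(M, W)) :
    ∃ a : Γ(T, W ⊓ W₀), resM M inf_le_left σ = a • resM M inf_le_right g₀ ∧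
      val hg h₀ hW σ = T.presheaf.germ (W ⊓ W₀) (genericPoint T) ⟨hW, h₀⟩ a := by
  obtain ⟨a, ha⟩ := hg.exists_smul inf_le_right (resM M (inf_le_left : W ⊓ W₀ ≤ W) σ)
  exact ⟨a, ha, val_eq hg h₀ hW _ _ _ ha⟩

lemma val_resM {W W' : T.Opens} (hW : genericPoint T ∈ W) (hW' : genericPoint T ∈ W') (h : W' ≤ W)
    (σ : Γ(M, W)) :
    val hg h₀ hW' (resM M h σ) = val hg h₀ hW σ := by
  obtain ⟨a, ha, e⟩ := exists_val_spec hg h₀ hW' (resM M h σ)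
  rw [resM_resM] at ha
  rw [e, val_eq hg h₀ hW (generic_mem_inf hW' h₀) _ _ ha]

lemma val_add {W : T.Opens} (hW : genericPoint T ∈ W) (σ τ : Γ(M, W)) :
    val hg h₀ hW (σ + τ) = val hg h₀ hW σ + val hg h₀ hW τ := by
  obtain ⟨a, ha, e⟩ := exists_val_spec hg h₀ hW σ
  obtain ⟨b, hb, e'⟩ := exists_val_spec hg h₀ hW τ
  rw [e, e', ← map_add]
  exact val_eq hg h₀ hW _ inf_le_left inf_le_right (by rw [resM_add, ha, hb, add_smul])

lemma val_smul {W : T.Opens} (hW : genericPoint T ∈ W) (c : Γ(T, W)) (σ : Γ(M, W)) :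
    val hg h₀ hW (c • σ) = T.presheaf.germ W (genericPoint T) hW c * val hg h₀ hW σ := by
  obtain ⟨a, ha, e⟩ := exists_val_spec hg h₀ hW σ
  rw [e, ← germ_resO (inf_le_left : W ⊓ W₀ ≤ W) c (genericPoint T) ⟨hW, h₀⟩, ← map_mul]
  exact val_eq hg h₀ hW _ inf_le_left inf_le_right (by rw [resM_smul, ha, mul_smul])

lemma val_generator : val hg h₀ h₀ g₀ = 1 := by
  rw [val_eq hg h₀ h₀ h₀ le_rfl le_rfl (a := 1) (by rw [one_smul]), map_one]

include hg h₀ in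
lemma val_ne_zero_of_isGenerator {U : T.Opens} (hU : genericPoint T ∈ U) {g : Γ(M, U)}
    (h : IsGenerator M g) : val hg h₀ hU g ≠ 0 := by
  intro h0
  obtain ⟨a, ha⟩ := h.exists_smul (inf_le_left : U ⊓ W₀ ≤ U) (resM M inf_le_right g₀)
  have h1 := val_generator hg h₀
  rw [← val_resM hg h₀ h₀ (generic_mem_inf hU h₀) inf_le_right, ha, val_smul, val_resM hg h₀ hU,
    h0, mul_zero] at h1
  exact zero_ne_one h1

include hg h₀ in
lemma eq_of_val_eq (hM : IsLineBundle M) {W : T.Opens} (hW : genericPoint T ∈ W) {σ τ : Γ(M, W)}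
    (h : val hg h₀ hW σ = val hg h₀ hW τ) : σ = τ := by
  refine eq_of_locally M fun x hx => ?_
  obtain ⟨U, hxU, g, hgU⟩ := hM x
  have hηU : genericPoint T ∈ U :=
    ((genericPoint_spec T).mem_open_set_iff U.isOpen).mpr ⟨x, trivial, hxU⟩
  have hη := generic_mem_inf hηU hW
  refine ⟨U ⊓ W, inf_le_right, ⟨hxU, hx⟩, ?_⟩
  obtain ⟨a, ha⟩ := hgU.exists_smul (inf_le_left : U ⊓ W ≤ U) (resM M inf_le_right σ)
  obtain ⟨b, hb⟩ := hgU.exists_smul (inf_le_left : U ⊓ W ≤ U) (resM M inf_le_right τ)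
  rw [← val_resM hg h₀ hW hη inf_le_right, ← val_resM hg h₀ hW hη inf_le_right, ha, hb, val_smul,
    val_smul] at h
  have h1 := mul_right_cancel₀
    (by rw [val_resM hg h₀ hηU]; exact val_ne_zero_of_isGenerator hg h₀ hηU hgU) h
  have h2 := germ_injective_of_isIntegral T (genericPoint T) hη h1
  rw [ha, hb, h2]

include hg h₀ in
/-- A rational function comes from a section if it does so locally. -/
lemma exists_val_eq (hM : IsLineBundle M) (F : T.functionField)
    (H : ∀ x : T, ∃ (U : T.Opens) (hU : genericPoint T ∈ U) (σ : Γ(M, U)),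
      x ∈ U ∧ val hg h₀ hU σ = F) :
    ∃ σ : Γ(M, ⊤), val hg h₀ generic_mem_top σ = F := by
  obtain ⟨σ, hσ⟩ := exists_glue M (U := ⊤)
    (fun W τ => ∀ hW : genericPoint T ∈ W, val hg h₀ hW τ = F)
    (fun W W' h τ hτ hW' => by rw [val_resM hg h₀ (h hW')]; exact hτ _)
    (fun W _ s t hs ht => by
      by_cases hW : genericPoint T ∈ W
      · exact eq_of_val_eq hg h₀ hM hW ((hs hW).trans (ht hW).symm)
      · refine eq_of_locally M fun x hx => absurd ?_ hW
        exact ((genericPoint_spec T).mem_open_set_iff W.isOpen).mpr ⟨x, trivial, hx⟩)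
    (fun x _ => by
      obtain ⟨U, hU, τ, hx, hτ⟩ := H x
      exact ⟨U, hx, le_top, τ, fun _ => hτ⟩)
  obtain ⟨W, h, hW, hP⟩ := hσ (genericPoint T) trivial
  refine ⟨σ, ?_⟩
  rw [← hP hW, val_resM hg h₀ generic_mem_top]

lemma exists_generic_generator (hM : IsLineBundle M) :
    ∃ (W₀ : T.Opens) (_ : genericPoint T ∈ W₀) (g₀ : Γ(M, W₀)), IsGenerator M g₀ := by
  obtain ⟨U, hU, g, hg⟩ := hM (genericPoint T)
  exact ⟨U, hU, g, hg⟩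

variable [IsLocallyNoetherian T]

include hg h₀ in
/-- The divisor of a rational section in terms of the orders of rational functions. -/
lemma isDivisorOf_iff (hM : IsLineBundle M) {V : T.Opens} (hV : genericPoint T ∈ V) (s : Γ(M, V))
    (hs : s ≠ 0)
    (D : T →₀ ℤ) :
    IsDivisorOf M s D ↔ ∀ (x : T) (U : T.Opens) (hU : genericPoint T ∈ U), x ∈ U → ∀ g : Γ(M, U),
      IsGenerator M g → D x = Scheme.ord (val hg h₀ hV s) x - Scheme.ord (val hg h₀ hU g) x := by
  have hs0 : val hg h₀ hV s ≠ 0 := by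
    intro h
    apply hs
    refine eq_of_val_eq hg h₀ hM hV (h.trans ?_)
    have := val_smul hg h₀ hV 0 s
    rwa [zero_smul, map_zero, zero_mul, eq_comm] at this
  have key : ∀ (U : T.Opens) (hU : genericPoint T ∈ U) (g : Γ(M, U)) (hgU : IsGenerator M g) (x : T)
      (a : Γ(T, U ⊓ V)) (ha : a • resM M inf_le_left g = resM M inf_le_right s),
      Scheme.ord (T.presheaf.germ (U ⊓ V) (genericPoint T) ⟨hU, hV⟩ a) x =
        Scheme.ord (val hg h₀ hV s) x - Scheme.ord (val hg h₀ hU g) x := by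
    intro U hU g hgU x a ha
    have h1 := val_smul hg h₀ (generic_mem_inf hU hV) a (resM M inf_le_left g)
    rw [ha, val_resM hg h₀ hV, val_resM hg h₀ hU] at h1
    have hga := left_ne_zero_of_mul (h1 ▸ hs0)
    rw [h1, Scheme.ord_mul hga (val_ne_zero_of_isGenerator hg h₀ hU hgU)]
    ring
  constructor
  · intro h x U hU hx g hgU
    obtain ⟨a, ha⟩ := hgU.exists_smul (inf_le_left : U ⊓ V ≤ U) (resM M inf_le_right s)
    have hne : Nonempty (U ⊓ V : T.Opens) := ⟨⟨genericPoint T, hU, hV⟩⟩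
    rw [← key U hU g hgU x a ha.symm]
    exact h x U hx g hgU a ha.symm
  · intro h x U hx g hgU hne a ha
    have hU : genericPoint T ∈ U :=
      ((genericPoint_spec T).mem_open_set_iff U.isOpen).mpr ⟨x, trivial, hx⟩
    rw [h x U hU hx g hgU, ← key U hU g hgU x a ha]

end Val

namespace LineCharts
open Polynomial
variable {k : Type u} [Field k] [IsAlgClosed k] {T : Scheme.{u}} {str : T ⟶ Spec (.of k)}
  (𝒞 : LineCharts str) [IsIntegral T] {M : T.Modules}

include 𝒞 in
/-- Nonempty open subsets of the projective line are cofinite. -/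
lemma finite_compl {W : T.Opens} (hW : genericPoint T ∈ W) : (W : Set T)ᶜ.Finite := by
  classical
  have h0 := 𝒞.nonempty₀
  obtain ⟨f, hf, hηf⟩ := 𝒞.affine₀.exists_basicOpen_le ⟨genericPoint T, hW⟩ (generic_mem 𝒞.U₀)
  obtain ⟨p, rfl⟩ := 𝒞.θ₀.surjective f
  have hp : p ≠ 0 := by rintro rfl; simp at hηf
  have hco : ∀ x ∈ (𝒞.U₀ : Set T) \ W, ∃ a : k, x ∉ T.basicOpen (𝒞.θ₀ (X - C a)) := fun x hx =>
    exists_coordinate 𝒞.affine₀ 𝒞.θ₀ hx.1 fun h => hx.2 (h ▸ hW)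
  choose! a ha using hco
  have h1 : ((𝒞.U₀ : Set T) \ W).Finite := by
    refine Set.Finite.of_finite_image (f := a)
      ((p.roots.toFinset.finite_toSet).subset ?_) fun x hx y hy hxy => ?_
    · rintro _ ⟨x, hx, rfl⟩
      have h2 : x ∉ T.basicOpen (𝒞.θ₀ p) := fun h => hx.2 (hf h)
      rw [mem_basicOpen_iff_eval 𝒞.affine₀ 𝒞.θ₀ hx.1 (ha x hx), not_not] at h2
      simpa [hp] using h2
    · have h2 := ha x hx
      rw [hxy] at h2
      exact eq_of_coordinate 𝒞.affine₀ 𝒞.θ₀ hx.1 hy.1 h2 (ha y hy)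
  have h2 : ((𝒞.U₀ : Set T)ᶜ).Finite :=
    Set.Subsingleton.finite fun x hx y hy => 𝒞.eq_of_not_mem₀ hx hy
  refine (h1.union h2).subset fun x hx => ?_
  by_cases h : x ∈ 𝒞.U₀
  · exact Or.inl ⟨h, hx⟩
  · exact Or.inr h

variable [IsLocallyNoetherian T]

include 𝒞 in
/-- Every line bundle on a projective line has a degree: a generator over a nonempty open set is a
rational section, and its divisor is finite, as it is supported outside this open set. -/
lemma exists_hasDegree (hM : IsLineBundle M) : ∃ d, HasDegree M d := by
  classical
  obtain ⟨W₀, h₀, g₀, hg⟩ := exists_generic_generator hM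
  have hMx : ∀ x : T, ∃ (U : T.Opens) (_ : genericPoint T ∈ U) (g : Γ(M, U)),
      x ∈ U ∧ IsGenerator M g ∧ (x ∈ W₀ → Scheme.ord (val hg h₀ ‹_› g) x = 0) := by
    intro x
    by_cases hx : x ∈ W₀
    · exact ⟨W₀, h₀, g₀, hx, hg, fun _ => by rw [val_generator, ord_one]⟩
    · obtain ⟨U, hxU, g, hgU⟩ := hM x
      exact ⟨U, ((genericPoint_spec T).mem_open_set_iff U.isOpen).mpr ⟨x, trivial, hxU⟩, g, hxU,
        hgU, fun h => absurd h hx⟩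
  choose U hηU g hxU hgU hord using hMx
  let D : T →₀ ℤ := Finsupp.ofSupportFinite (fun x => - Scheme.ord (val hg h₀ (hηU x) (g x)) x)
    ((𝒞.finite_compl h₀).subset fun x hx hxW => hx (by simp [hord x hxW]))
  refine ⟨_, inferInstance, inferInstance, W₀, g₀, D, ?_, ?_, rfl⟩
  · rintro rfl
    have := val_ne_zero_of_isGenerator hg h₀ h₀ hg
    refine this ?_
    have := val_smul hg h₀ h₀ 0 (0 : Γ(M, W₀))
    rwa [zero_smul, map_zero, zero_mul] at this
  · rw [isDivisorOf_iff hg h₀ hM h₀]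
    · intro x V hηV hxV g' hg'
      rw [val_generator, ord_one]
      change - _ = _
      rw [zero_sub, neg_inj]
      -- two generators at `x` differ by a unit
      have hη := generic_mem_inf (hηU x) hηV
      obtain ⟨a, ha⟩ := (hgU x).exists_smul (inf_le_left : U x ⊓ V ≤ U x) (resM M inf_le_right g')
      obtain ⟨b, hb⟩ := hg'.exists_smul (inf_le_right : U x ⊓ V ≤ V) (resM M inf_le_left (g x))
      have hba : b * a = 1 := by
        refine (hgU x).smul_inj inf_le_left ?_
        rw [mul_smul, ← ha, ← hb, one_smul]
      have hu : IsUnit a := .of_mul_eq_one b ((mul_comm _ _).trans hba)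
      have h1 := val_smul hg h₀ hη a (resM M inf_le_left (g x))
      rw [← ha, val_resM hg h₀ hηV, val_resM hg h₀ (hηU x)] at h1
      have hga : T.presheaf.germ (U x ⊓ V) (genericPoint T) hη a ≠ 0 :=
        (hu.map (T.presheaf.germ (U x ⊓ V) (genericPoint T) hη).hom).ne_zero
      rw [h1, Scheme.ord_mul hga (val_ne_zero_of_isGenerator hg h₀ _ (hgU x))]
      have hne : Nonempty (U x ⊓ V : T.Opens) := ⟨⟨x, hxU x, hxV⟩⟩
      have := Scheme.ord_of_isUnit hu (x := x) ⟨hxU x, hxV⟩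
      have h2 : Scheme.ord (T.presheaf.germ (U x ⊓ V) (genericPoint T) hη a) x = 0 := this
      rw [h2, zero_add]
    · rintro rfl
      have := val_ne_zero_of_isGenerator hg h₀ h₀ hg
      refine this ?_
      have := val_smul hg h₀ h₀ 0 (0 : Γ(M, W₀))
      rwa [zero_smul, map_zero, zero_mul] at this

end LineCharts
end NodalPruning

/-! ### Riemann–Roch on a projective line -/

namespace NodalPruning

lemma coheight_genericPoint {T : Scheme.{u}} [IsIntegral T] :
    Order.coheight (genericPoint T) ≠ 1 := by
  have h1 := ringKrullDim_stalk_eq_coheight (genericPoint T)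
  have h2 : ringKrullDim T.functionField = 0 := ringKrullDim_eq_zero_of_field _
  intro h
  rw [h] at h1
  have := h2.symm.trans h1
  norm_cast at this

namespace LineCharts
open Polynomial
variable {k : Type u} [Field k] [IsAlgClosed k] {T : Scheme.{u}} {str : T ⟶ Spec (.of k)}
  (𝒞 : LineCharts str) [IsIntegral T] [IsLocallyNoetherian T] {M : T.Modules}

include 𝒞 in
lemma ord_germ_nonneg {x : T} (hx : x ≠ genericPoint T) {U : T.Opens} (hU : genericPoint T ∈ U)
    (hxU : x ∈ U) (a : Γ(T, U)) : 0 ≤ Scheme.ord (T.presheaf.germ U (genericPoint T) hU a) x := by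
  have hne : Nonempty U := ⟨⟨x, hxU⟩⟩
  by_cases h0 : T.presheaf.germ U (genericPoint T) hU a = 0
  · have h0' : T.germToFunctionField U a = 0 := h0
    change 0 ≤ Scheme.ord (T.germToFunctionField U a) x
    rw [h0', Scheme.ord_zero]; rfl
  · rw [ord_nonneg_iff (𝒞.isSmoothPoint hx) h0]
    exact ⟨T.presheaf.germ U x hxU a, Scheme.algebraMap_germ_eq_germToFunctionField T hxU a⟩

omit [IsAlgClosed k] [IsLocallyNoetherian T] in
lemma ι_C' (c : k) :
    𝒞.ι (C c) = T.presheaf.germ ⊤ (genericPoint T) generic_mem_top (scalar str c) := by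
  have : Nonempty (⊤ : T.Opens) := ⟨⟨genericPoint T, trivial⟩⟩
  exact 𝒞.ι_C c

section
variable {W₀ : T.Opens} {g₀ : Γ(M, W₀)} (hg : IsGenerator M g₀) (h₀ : genericPoint T ∈ W₀)

include 𝒞 hg h₀ in
/-- A rational function is a global section if it is regular with respect to local generators. -/
lemma exists_section (hM : IsLineBundle M) {F : T.functionField} (hF : F ≠ 0)
    (H : ∀ x ≠ genericPoint T, ∀ (U : T.Opens) (hU : genericPoint T ∈ U), x ∈ U → ∀ g : Γ(M, U),
      IsGenerator M g → Scheme.ord (val hg h₀ hU g) x ≤ Scheme.ord F x) :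
    ∃ σ : Γ(M, ⊤), val hg h₀ generic_mem_top σ = F := by
  have key : ∀ x ≠ genericPoint T,
      ∃ (U : T.Opens) (hU : genericPoint T ∈ U) (σ : Γ(M, U)), x ∈ U ∧ val hg h₀ hU σ = F := by
    intro x hx
    obtain ⟨U, hxU, g, hgU⟩ := hM x
    have hU : genericPoint T ∈ U :=
      ((genericPoint_spec T).mem_open_set_iff U.isOpen).mpr ⟨x, trivial, hxU⟩
    have hv := val_ne_zero_of_isGenerator hg h₀ hU hgU
    obtain ⟨a, ha⟩ := (ord_nonneg_iff (𝒞.isSmoothPoint hx)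
      (mul_ne_zero hF (inv_ne_zero hv))).1 (by
        rw [Scheme.ord_mul hF (inv_ne_zero hv), ord_inv hv]
        linarith [H x hx U hU hxU g hgU])
    obtain ⟨V, hxV, b, rfl⟩ := T.presheaf.exists_germ_eq a
    have hV : genericPoint T ∈ V :=
      ((genericPoint_spec T).mem_open_set_iff V.isOpen).mpr ⟨x, trivial, hxV⟩
    have hne : Nonempty V := ⟨⟨x, hxV⟩⟩
    rw [Scheme.algebraMap_germ_eq_germToFunctionField T hxV] at ha
    have hUV := generic_mem_inf hU hV
    refine ⟨U ⊓ V, hUV, resO (inf_le_right : U ⊓ V ≤ V) b • resM M (inf_le_left : U ⊓ V ≤ U) g,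
      ⟨hxU, hxV⟩, ?_⟩
    rw [val_smul, val_resM hg h₀ hU, germ_resO]
    have ha' : T.presheaf.germ V (genericPoint T) hV b = F * (val hg h₀ hU g)⁻¹ := ha
    rw [ha', inv_mul_cancel_right₀ hv]
  refine exists_val_eq hg h₀ hM F fun x => ?_
  by_cases hx : x = genericPoint T
  · subst hx
    obtain ⟨y, -, hy, -⟩ := 𝒞.exists_infinity
    have := 𝒞.nonempty₀
    obtain ⟨U, hU, σ, -, h⟩ := key y (by rintro rfl; exact hy (generic_mem _))
    exact ⟨U, hU, σ, hU, h⟩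
  · exact key x hx

end

open Classical in
/-- The Riemann–Roch space of a line bundle on the projective line: after division by a suitable
rational section, the global sections of a line bundle of degree `d` are the polynomials of degree
at most `d`. -/
theorem exists_parametrization (hM : IsLineBundle M) {d : ℤ} (hd : HasDegree M d) :
    ∃ (W₀ : T.Opens) (h₀ : genericPoint T ∈ W₀) (g₀ : Γ(M, W₀)) (hg : IsGenerator M g₀)
      (r : T.functionField), r ≠ 0 ∧
      (∀ p : k[X], p ≠ 0 → (p.natDegree : ℤ) ≤ d →
        ∃ σ : Γ(M, ⊤), val hg h₀ generic_mem_top σ = r * 𝒞.ι p) ∧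
      (∀ σ : Γ(M, ⊤), σ ≠ 0 → ∃ p : k[X], p ≠ 0 ∧ (p.natDegree : ℤ) ≤ d ∧
        val hg h₀ generic_mem_top σ = r * 𝒞.ι p) ∧
      ∀ x ≠ genericPoint T, ∀ (U : T.Opens) (hU : genericPoint T ∈ U), x ∈ U → ∀ g : Γ(M, U),
        IsGenerator M g → Scheme.ord (val hg h₀ hU g) x = Scheme.ord r x +
          if x ∈ 𝒞.U₀ then 0 else -d := by
  obtain ⟨_, _, V, s, D, hs, hsD, rfl⟩ := hd
  obtain ⟨W₀, h₀, g₀, hg⟩ := exists_generic_generator hM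
  have hV : genericPoint T ∈ V := by
    by_contra h
    refine hs (eq_of_locally M fun x hx => absurd ?_ h)
    exact ((genericPoint_spec T).mem_open_set_iff V.isOpen).mpr ⟨x, trivial, hx⟩
  rw [isDivisorOf_iff hg h₀ hM hV s hs] at hsD
  set v := val hg h₀ hV s with hv
  have hv0 : v ≠ 0 := by
    intro h
    apply hs
    refine eq_of_val_eq hg h₀ hM hV (h.trans ?_)
    have := val_smul hg h₀ hV 0 s
    rwa [zero_smul, map_zero, zero_mul, eq_comm] at this
  have hDη : D (genericPoint T) = 0 := by
    rw [hsD _ W₀ h₀ h₀ g₀ hg, Scheme.ord_eq_zero_of_coheight_neq_one coheight_genericPoint,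
      Scheme.ord_eq_zero_of_coheight_neq_one coheight_genericPoint, sub_zero]
  -- dividing the section by `q` moves its divisor to infinity
  obtain ⟨q, hq0, hq, hq'⟩ := 𝒞.exists_function D hDη
  set d := D.sum fun _ n => n with hd
  have hr0 : v * q⁻¹ ≠ 0 := mul_ne_zero hv0 (inv_ne_zero hq0)
  have hord : ∀ x, Scheme.ord (v * q⁻¹) x = Scheme.ord v x - Scheme.ord q x := fun x => by
    rw [Scheme.ord_mul hv0 (inv_ne_zero hq0), ord_inv hq0]; ring
  have hgen : ∀ x ≠ genericPoint T, ∀ (U : T.Opens) (hU : genericPoint T ∈ U), x ∈ U →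
      ∀ g : Γ(M, U), IsGenerator M g → Scheme.ord (val hg h₀ hU g) x = Scheme.ord (v * q⁻¹) x +
          if x ∈ 𝒞.U₀ then 0 else -d := by
    intro x hx U hU hxU g hgU
    have h1 := hsD x U hU hxU g hgU
    rw [hord]
    split_ifs with hx0
    · rw [hq x hx0 hx, h1]; ring
    · rw [hq' x hx0, h1]; ring
  refine ⟨W₀, h₀, g₀, hg, v * q⁻¹, hr0, ?_, ?_, hgen⟩
  · intro p hp hpd
    refine 𝒞.exists_section hg h₀ hM (mul_ne_zero hr0 (𝒞.ι_ne_zero hp)) fun x hx U hU hxU g hgU =>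
      ?_
    rw [hgen x hx U hU hxU g hgU, Scheme.ord_mul hr0 (𝒞.ι_ne_zero hp)]
    refine add_le_add le_rfl ?_
    split_ifs with hx0
    · obtain ⟨a, ha⟩ := exists_coordinate 𝒞.affine₀ 𝒞.θ₀ hx0 hx
      rw [𝒞.ord_ι_finite hx0 ha hp]; positivity
    · rw [𝒞.ord_ι_infinity hx0 hp]; linarith
  · intro σ hσ
    set F := val hg h₀ generic_mem_top σ with hF
    have hF0 : F ≠ 0 := by
      intro h
      apply hσ
      refine eq_of_val_eq hg h₀ hM generic_mem_top (h.trans ?_)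
      have := val_smul hg h₀ generic_mem_top 0 σ
      rwa [zero_smul, map_zero, zero_mul, eq_comm] at this
    have hFr : F * (v * q⁻¹)⁻¹ ≠ 0 := mul_ne_zero hF0 (inv_ne_zero hr0)
    have hle : ∀ x ≠ genericPoint T, (if x ∈ 𝒞.U₀ then 0 else -d) ≤
        Scheme.ord (F * (v * q⁻¹)⁻¹) x := by
      intro x hx
      obtain ⟨U, hxU, g, hgU⟩ := hM x
      have hU : genericPoint T ∈ U :=
        ((genericPoint_spec T).mem_open_set_iff U.isOpen).mpr ⟨x, trivial, hxU⟩
      obtain ⟨a, ha⟩ := hgU.exists_smul le_rfl (resM M le_top σ)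
      rw [resM_self] at ha
      have h1 := val_smul hg h₀ hU a g
      rw [← ha, val_resM hg h₀ generic_mem_top] at h1
      have h2 := 𝒞.ord_germ_nonneg hx hU hxU a
      have ha0 : T.presheaf.germ U (genericPoint T) hU a ≠ 0 :=
        left_ne_zero_of_mul (fun h => hF0 (h1.trans h))
      have h3 := Scheme.ord_mul (x := x) ha0 (val_ne_zero_of_isGenerator hg h₀ hU hgU)
      rw [← h1, hgen x hx U hU hxU g hgU] at h3
      rw [Scheme.ord_mul hF0 (inv_ne_zero hr0), ord_inv hr0]
      change _ ≤ Scheme.ord (val hg h₀ generic_mem_top σ) x + _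
      rw [h3]; linarith
    obtain ⟨p, hp⟩ := 𝒞.exists_polynomial hFr fun x hx0 hx => by
      have := hle x hx
      rwa [if_pos hx0] at this
    have hp0 : p ≠ 0 := by rintro rfl; rw [map_zero] at hp; exact hFr hp
    refine ⟨p, hp0, ?_, ?_⟩
    · obtain ⟨y, -, hy, -⟩ := 𝒞.exists_infinity
      have := 𝒞.nonempty₀
      have h1 := hle y (by rintro rfl; exact hy (generic_mem _))
      rw [if_neg hy, hp, 𝒞.ord_ι_infinity hy hp0] at h1
      linarith
    · rw [← hp]; field_simp

include 𝒞 in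
/-- The space of sections of a line bundle of degree `d` on the projective line has dimension
`max (d + 1) 0`. -/
theorem rank_sections (hM : IsLineBundle M) {d : ℤ} (hd : HasDegree M d) :
    h0 str M = ((d + 1).toNat : Cardinal) := by
  obtain ⟨W₀, h₀, g₀, hg, r, hr0, h1, h2, -⟩ := 𝒞.exists_parametrization hM hd
  let _ := globalSectionsModule str M
  have hz : val hg h₀ generic_mem_top (0 : Γ(M, ⊤)) = 0 := by
    have := val_smul hg h₀ generic_mem_top 0 (0 : Γ(M, ⊤))
    rwa [zero_smul, map_zero, zero_mul] at this
  have hex : ∀ p : degreeLT k (d + 1).toNat,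
      ∃ σ : Γ(M, ⊤), val hg h₀ generic_mem_top σ = r * 𝒞.ι p := by
    rintro ⟨p, hp⟩
    by_cases hp0 : p = 0
    · exact ⟨0, by subst hp0; rw [map_zero, mul_zero, hz]⟩
    · refine h1 p hp0 ?_
      rw [mem_degreeLT, degree_eq_natDegree hp0] at hp
      have : p.natDegree < (d + 1).toNat := by exact_mod_cast hp
      lia
  choose Φ hΦ using hex
  have hinj : ∀ σ τ : Γ(M, ⊤), val hg h₀ generic_mem_top σ = val hg h₀ generic_mem_top τ → σ = τ :=
    fun σ τ => eq_of_val_eq hg h₀ hM generic_mem_top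
  let Ψ : degreeLT k (d + 1).toNat →ₗ[k] Γ(M, ⊤) :=
    { toFun := Φ
      map_add' := fun p q => hinj _ _ (by
        rw [val_add, hΦ, hΦ, hΦ, Submodule.coe_add, map_add, mul_add])
      map_smul' := fun c p => hinj _ _ (by
        have h3 := val_smul hg h₀ generic_mem_top (scalar str c) (Φ p)
        refine (hΦ _).trans (Eq.trans ?_ h3.symm)
        rw [hΦ, ← 𝒞.ι_C', SetLike.val_smul, smul_eq_C_mul, map_mul]
        ring) }
  have hbij : Function.Bijective Ψ := by
    constructor
    · intro p q hpq
      have := congr(val hg h₀ generic_mem_top $hpq)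
      change val hg h₀ generic_mem_top (Φ p) = val hg h₀ generic_mem_top (Φ q) at this
      rw [hΦ, hΦ] at this
      exact Subtype.ext (𝒞.ι_injective (mul_left_cancel₀ hr0 this))
    · intro σ
      by_cases hσ : σ = 0
      · exact ⟨0, by rw [map_zero, hσ]⟩
      · obtain ⟨p, hp0, hpd, hp⟩ := h2 σ hσ
        refine ⟨⟨p, ?_⟩, hinj _ _ ((hΦ _).trans hp.symm)⟩
        rw [mem_degreeLT, degree_eq_natDegree hp0]
        have : p.natDegree < (d + 1).toNat := by lia
        exact_mod_cast this
  have hrank := (LinearEquiv.ofBijective Ψ hbij).rank_eq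
  change Module.rank k Γ(M, ⊤) = _
  rw [← hrank, (degreeLTEquiv k (d + 1).toNat).rank_eq, rank_fin_fun]

include 𝒞 in
open Classical in
/-- A line bundle of non-negative degree on the projective line is globally generated. -/
theorem exists_section_ne_zero (hM : IsLineBundle M) {d : ℤ} (hd : HasDegree M d) (hd0 : 0 ≤ d)
    {x : T} (hx : x ≠ genericPoint T) :
    ∃ σ : Γ(M, ⊤), ∀ (U : T.Opens) (g : Γ(M, U)) (_ : IsGenerator M g) (a : Γ(T, U)), x ∈ U →
      resM M le_top σ = a • g → x ∈ T.basicOpen a := by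
  obtain ⟨W₀, h₀, g₀, hg, r, hr0, h1, -, h2⟩ := 𝒞.exists_parametrization hM hd
  -- the constant `1` does not vanish at a finite point, and `X ^ d` does not vanish at infinity
  obtain ⟨p, hp0, hpd, hpx⟩ : ∃ p : k[X], p ≠ 0 ∧ (p.natDegree : ℤ) ≤ d ∧
      Scheme.ord (𝒞.ι p) x = if x ∈ 𝒞.U₀ then 0 else -d := by
    split_ifs with hx0
    · exact ⟨1, one_ne_zero, by simpa using hd0, by rw [map_one, ord_one]⟩
    · refine ⟨X ^ d.toNat, pow_ne_zero _ X_ne_zero, by simp [hd0], ?_⟩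
      rw [𝒞.ord_ι_infinity hx0 (pow_ne_zero _ X_ne_zero)]
      simp [hd0]
  obtain ⟨σ, hσ⟩ := h1 p hp0 hpd
  refine ⟨σ, fun U g hgU a hxU ha => ?_⟩
  have hU : genericPoint T ∈ U :=
    ((genericPoint_spec T).mem_open_set_iff U.isOpen).mpr ⟨x, trivial, hxU⟩
  have h3 := val_smul hg h₀ hU a g
  rw [← ha, val_resM hg h₀ generic_mem_top, hσ] at h3
  have ha0 : T.presheaf.germ U (genericPoint T) hU a ≠ 0 :=
    left_ne_zero_of_mul fun h =>
      mul_ne_zero hr0 (𝒞.ι_ne_zero hp0) (h3.trans h)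
  have h4 := Scheme.ord_mul (x := x) ha0 (val_ne_zero_of_isGenerator hg h₀ hU hgU)
  rw [← h3, h2 x hx U hU hxU g hgU, Scheme.ord_mul hr0 (𝒞.ι_ne_zero hp0), hpx] at h4
  have h5 : Scheme.ord (T.presheaf.germ U (genericPoint T) hU a) x = 0 := by linarith
  have hne : Nonempty U := ⟨⟨x, hxU⟩⟩
  obtain ⟨b, hb⟩ := (ord_nonneg_iff (𝒞.isSmoothPoint hx) (inv_ne_zero ha0)).1
    (by rw [ord_inv ha0, h5, neg_zero])
  rw [T.mem_basicOpen a x hxU]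
  refine .of_mul_eq_one b (IsFractionRing.injective (T.presheaf.stalk x) T.functionField ?_)
  rw [map_mul, map_one, Scheme.algebraMap_germ_eq_germToFunctionField T hxU, hb]
  exact mul_inv_cancel₀ ha0

end LineCharts
end NodalPruning

/-! ### The standard charts of the projective line -/

namespace NodalPruning

section ProjectiveLine
open HomogeneousLocalization
attribute [local instance] MvPolynomial.gradedAlgebra

variable (k : Type u) [Field k]

lemma X_mem (i : Fin 2) : (MvPolynomial.X i : MvPolynomial (Fin 2) k) ∈
    MvPolynomial.homogeneousSubmodule (Fin 2) k 1 := MvPolynomial.isHomogeneous_X k i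

/-- The scalars in the coordinate ring of a standard affine chart of the projective line. -/
def awayScalar (f : MvPolynomial (Fin 2) k) :
    k →+* Away (MvPolynomial.homogeneousSubmodule (Fin 2) k) f :=
  (fromZeroRingHom (MvPolynomial.homogeneousSubmodule (Fin 2) k) _).comp
    (algebraMap k (MvPolynomial.homogeneousSubmodule (Fin 2) k 0))

/-- The coordinate `X j / X i` on the standard affine chart `X i ≠ 0` of the projective line. -/
abbrev awayCoord (i j : Fin 2) :
    Away (MvPolynomial.homogeneousSubmodule (Fin 2) k) (MvPolynomial.X i) :=
  Away.isLocalizationElem (X_mem k i) (X_mem k j)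

/-- Polynomials in the coordinate `X j / X i`. -/
def awayHom (i j : Fin 2) : Polynomial k →+*
    Away (MvPolynomial.homogeneousSubmodule (Fin 2) k) (MvPolynomial.X i) :=
  Polynomial.eval₂RingHom (awayScalar k _) (awayCoord k i j)

variable {k} in
/-- The localization map of the polynomial ring away from `f`. -/
abbrev loc (f : MvPolynomial (Fin 2) k) : MvPolynomial (Fin 2) k →+* Localization.Away f :=
  algebraMap _ _

lemma val_awayScalar (f : MvPolynomial (Fin 2) k) (c : k) :
    (awayScalar k f c).val = loc f (MvPolynomial.C c) := by
  rw [loc, ← Localization.mk_one_eq_algebraMap]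
  rfl

lemma mul_val_awayCoord (i j : Fin 2) :
    loc (MvPolynomial.X i) (MvPolynomial.X i) * (awayCoord k i j).val =
      loc (MvPolynomial.X i) (MvPolynomial.X j) := by
  rw [Away.val_mk, loc, ← Localization.mk_one_eq_algebraMap, ← Localization.mk_one_eq_algebraMap,
    Localization.mk_mul, Localization.mk_eq_mk_iff, Localization.r_iff_exists]
  exact ⟨1, by simp⟩

/-- Dehomogenization: set `X i = 1` and let `X j` be the coordinate. -/
def dehom (i : Fin 2) : MvPolynomial (Fin 2) k →+* Polynomial k :=
  MvPolynomial.eval₂Hom Polynomial.C fun l => if l = i then 1 else Polynomial.X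

lemma awayHom_injective {i j : Fin 2} (hij : i ≠ j) : Function.Injective (awayHom k i j) := by
  have hu : IsUnit (dehom k i (MvPolynomial.X i)) := by simp [dehom]
  let L := Localization.awayLift (dehom k i) (MvPolynomial.X i) hu
  have hL : ∀ a, L (loc _ a) = dehom k i a := fun a => IsLocalization.lift_eq _ a
  let V : Away (MvPolynomial.homogeneousSubmodule (Fin 2) k) (MvPolynomial.X i) →+*
    Localization.Away (MvPolynomial.X i : MvPolynomial (Fin 2) k) := algebraMap _ _
  have hV : ∀ z, V z = z.val := fun z => rfl
  have h : (L.comp V).comp (awayHom k i j) = RingHom.id _ := by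
    refine Polynomial.ringHom_ext (fun c => ?_) ?_
    · simp only [RingHom.comp_apply, awayHom, Polynomial.coe_eval₂RingHom, Polynomial.eval₂_C, hV,
        val_awayScalar, hL]
      simp [dehom]
    · simp only [RingHom.comp_apply, awayHom, Polynomial.coe_eval₂RingHom, Polynomial.eval₂_X, hV]
      have := congr(L $(mul_val_awayCoord k i j))
      rw [map_mul, hL, hL] at this
      simpa [dehom, hij.symm] using this
  exact Function.LeftInverse.injective (g := L.comp V) fun p => congr($h p)

lemma univ_eq_pair {i j : Fin 2} (hij : i ≠ j) : (Finset.univ : Finset (Fin 2)) = {i, j} := by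
  revert i j; decide

lemma awayHom_surjective {i j : Fin 2} (hij : i ≠ j) : Function.Surjective (awayHom k i j) := by
  intro z
  obtain ⟨n, a, ha, rfl⟩ := Away.mk_surjective _ (X_mem k i) z
  refine ⟨dehom k i a, val_injective _ ?_⟩
  let V : Away (MvPolynomial.homogeneousSubmodule (Fin 2) k) (MvPolynomial.X i) →+*
    Localization.Away (MvPolynomial.X i : MvPolynomial (Fin 2) k) := algebraMap _ _
  have hV : ∀ z, V z = z.val := fun z => rfl
  have hn : a.IsHomogeneous n := by simpa using ha
  have key : loc (MvPolynomial.X i) (MvPolynomial.X i) ^ n *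
      V (awayHom k i j (dehom k i a)) = loc (MvPolynomial.X i) a := by
    conv_lhs => rw [a.as_sum]
    conv_rhs => rw [a.as_sum]
    simp only [map_sum, Finset.mul_sum]
    refine Finset.sum_congr rfl fun m hm => ?_
    have huniv := univ_eq_pair hij
    have hdeg : m i + m j = n := by
      by_contra h
      refine MvPolynomial.mem_support_iff.1 hm (hn.coeff_eq_zero ?_)
      rwa [Finsupp.degree_eq_sum, huniv, Finset.sum_pair hij]
    rw [MvPolynomial.monomial_eq, Finsupp.prod_fintype _ _ (by simp), huniv, Finset.prod_pair hij]
    simp only [map_mul, map_pow]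
    have h1 : dehom k i (MvPolynomial.X i) = 1 := by simp [dehom]
    have h2 : dehom k i (MvPolynomial.X j) = Polynomial.X := by simp [dehom, hij.symm]
    have h3 : dehom k i (MvPolynomial.C (MvPolynomial.coeff m a)) =
      Polynomial.C (MvPolynomial.coeff m a) := by simp [dehom]
    rw [h1, h2, h3]
    simp only [awayHom, Polynomial.coe_eval₂RingHom, Polynomial.eval₂_C, Polynomial.eval₂_X, hV,
      val_awayScalar, ← mul_val_awayCoord k i j, ← hdeg, map_one, val_one, one_pow]
    ring
  have hu : IsUnit (loc (MvPolynomial.X i : MvPolynomial (Fin 2) k) (MvPolynomial.X i) ^ n) :=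
    (IsLocalization.Away.algebraMap_isUnit _).pow n
  refine hu.mul_left_cancel (key.trans ?_)
  rw [Away.val_mk, ← map_pow, loc, ← Localization.mk_one_eq_algebraMap,
    ← Localization.mk_one_eq_algebraMap, Localization.mk_mul, Localization.mk_eq_mk_iff,
    Localization.r_iff_exists]
  exact ⟨1, by simp [mul_comm]⟩

/-- The two coordinates of the projective line are inverse to each other. -/
lemma awayMap_awayCoord_mul (i j : Fin 2) :
    awayMap (MvPolynomial.homogeneousSubmodule (Fin 2) k) (X_mem k j)
        (rfl : (MvPolynomial.X i * MvPolynomial.X j : MvPolynomial (Fin 2) k) = _)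
        (awayCoord k i j) *
      awayMap (MvPolynomial.homogeneousSubmodule (Fin 2) k) (X_mem k i)
        (mul_comm _ _) (awayCoord k j i) = 1 := by
  refine val_injective _ ?_
  rw [val_mul, awayCoord, awayCoord, Away.isLocalizationElem, Away.isLocalizationElem, awayMap_mk,
    awayMap_mk, Away.val_mk, Away.val_mk, Localization.mk_mul, val_one, ← Localization.mk_one,
    Localization.mk_eq_mk_iff, Localization.r_iff_exists]
  exact ⟨1, by simp; ring⟩

/-- The standard affine charts of the projective line. -/
abbrev chart (i : Fin 2) : (projectiveLine k).Opens :=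
  Proj.basicOpen (MvPolynomial.homogeneousSubmodule (Fin 2) k) (MvPolynomial.X i)

/-- The coordinate ring of a standard affine chart of the projective line. -/
def chartEquiv {i j : Fin 2} (hij : i ≠ j) : Polynomial k ≃+* Γ(projectiveLine k, chart k i) :=
  (RingEquiv.ofBijective (awayHom k i j) ⟨awayHom_injective k hij, awayHom_surjective k hij⟩).trans
    (Proj.basicOpenIsoAway (MvPolynomial.homogeneousSubmodule (Fin 2) k) (MvPolynomial.X i)
      (X_mem k i) one_pos).commRingCatIsoToRingEquiv

lemma chartEquiv_apply {i j : Fin 2} (hij : i ≠ j) (p : Polynomial k) :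
    chartEquiv k hij p = Proj.awayToSection (MvPolynomial.homogeneousSubmodule (Fin 2) k)
      (MvPolynomial.X i) (awayHom k i j p) := rfl

lemma chartEquiv_X {i j : Fin 2} (hij : i ≠ j) :
    chartEquiv k hij Polynomial.X = Proj.awayToSection
      (MvPolynomial.homogeneousSubmodule (Fin 2) k) (MvPolynomial.X i) (awayCoord k i j) := by
  rw [chartEquiv_apply, awayHom, Polynomial.coe_eval₂RingHom, Polynomial.eval₂_X]

lemma chartEquiv_C {i j : Fin 2} (hij : i ≠ j) (c : k) :
    chartEquiv k hij (Polynomial.C c) = Proj.awayToSection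
      (MvPolynomial.homogeneousSubmodule (Fin 2) k) (MvPolynomial.X i) (awayScalar k _ c) := by
  rw [chartEquiv_apply, awayHom, Polynomial.coe_eval₂RingHom, Polynomial.eval₂_C]

lemma chart_cover (x : projectiveLine k) : x ∈ chart k 0 ∨ x ∈ chart k 1 := by
  have h := Proj.iSup_basicOpen_eq_top' (MvPolynomial.homogeneousSubmodule (Fin 2) k)
    (fun i : Fin 2 => MvPolynomial.X i) (fun i => ⟨1, X_mem k i⟩) (by
      rw [← top_le_iff]
      intro f _
      have hf : f ∈ Algebra.adjoin k (Set.range (MvPolynomial.X : Fin 2 → _)) := by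
        rw [MvPolynomial.adjoin_range_X]; trivial
      induction hf using Algebra.adjoin_induction with
      | mem x hx => exact Algebra.subset_adjoin hx
      | algebraMap r =>
        exact Subalgebra.algebraMap_mem _ (algebraMap k
          (MvPolynomial.homogeneousSubmodule (Fin 2) k 0) r)
      | add x y _ _ hx hy => exact add_mem (hx trivial) (hy trivial)
      | mul x y _ _ hx hy => exact mul_mem (hx trivial) (hy trivial))
  have hx : x ∈ (⨆ i : Fin 2, chart k i) := by rw [h]; trivial
  obtain ⟨i, hi⟩ := Opens.mem_iSup.1 hx
  fin_cases i
  · exact Or.inl hi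
  · exact Or.inr hi

lemma chart_basicOpen_le {i j : Fin 2} (hij : i ≠ j) :
    (projectiveLine k).basicOpen (chartEquiv k hij Polynomial.X) ≤ chart k j := by
  intro x hx
  have hxi : x ∈ chart k i := (projectiveLine k).basicOpen_le _ hx
  rw [chartEquiv_X] at hx
  let y := Proj.basicOpenToSpec (MvPolynomial.homogeneousSubmodule (Fin 2) k)
    (MvPolynomial.X i) ⟨x, hxi⟩
  have hy : y ∈ PrimeSpectrum.basicOpen (awayCoord k i j) := by
    have h1 : (⟨x, hxi⟩ : chart k i) ∈ (chart k i).ι ⁻¹ᵁ (projectiveLine k).basicOpen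
        (Proj.awayToSection (MvPolynomial.homogeneousSubmodule (Fin 2) k) (MvPolynomial.X i)
          (awayCoord k i j)) := hx
    rw [← Scheme.Opens.toSpecΓ_preimage_basicOpen] at h1
    exact h1
  rw [← Proj.awayι_preimage_basicOpen _ (X_mem k i) one_pos (X_mem k j) one_pos] at hy
  have hxy : Proj.awayι (MvPolynomial.homogeneousSubmodule (Fin 2) k) (MvPolynomial.X i)
      (X_mem k i) one_pos y = x := by
    have h2 : Proj.basicOpenToSpec (MvPolynomial.homogeneousSubmodule (Fin 2) k)
        (MvPolynomial.X i) ≫ Proj.awayι (MvPolynomial.homogeneousSubmodule (Fin 2) k)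
        (MvPolynomial.X i) (X_mem k i) one_pos = (chart k i).ι := by
      rw [← Proj.basicOpenIsoSpec_hom _ _ (X_mem k i) one_pos, Proj.awayι, Iso.hom_inv_id_assoc]
    exact congr($h2 ⟨x, hxi⟩)
  rw [← hxy]
  exact hy

lemma chart_inv {i j : Fin 2} (hij : i ≠ j) :
    resO (inf_le_left : chart k i ⊓ chart k j ≤ chart k i) (chartEquiv k hij Polynomial.X) *
      resO (inf_le_right : chart k i ⊓ chart k j ≤ chart k j)
        (chartEquiv k hij.symm Polynomial.X) = 1 := by
  have hV := Proj.basicOpen_mul (MvPolynomial.homogeneousSubmodule (Fin 2) k)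
    (MvPolynomial.X i) (MvPolynomial.X j)
  have h1 := congr($(Proj.awayMap_awayToSection (MvPolynomial.homogeneousSubmodule (Fin 2) k)
    (X_mem k j) (rfl : (MvPolynomial.X i * MvPolynomial.X j : MvPolynomial (Fin 2) k) = _))
    (awayCoord k i j))
  have h2 := congr($(Proj.awayMap_awayToSection (MvPolynomial.homogeneousSubmodule (Fin 2) k)
    (X_mem k i) (mul_comm (MvPolynomial.X i) (MvPolynomial.X j : MvPolynomial (Fin 2) k)))
    (awayCoord k j i))
  have h3 := congr(Proj.awayToSection (MvPolynomial.homogeneousSubmodule (Fin 2) k)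
    (MvPolynomial.X i * MvPolynomial.X j) $(awayMap_awayCoord_mul k i j))
  rw [map_mul, map_one] at h3
  have h4 := congr(resO hV.ge $((congr_arg₂ (· * ·) h1.symm h2.symm).trans h3))
  rw [resO_one] at h4
  rw [chartEquiv_X, chartEquiv_X, ← h4]
  refine Eq.trans ?_ (resO_mul _ _ _).symm
  exact congr_arg₂ (· * ·) (resO_resO hV.ge (hV.le.trans inf_le_left) _).symm
    (resO_resO hV.ge (hV.le.trans inf_le_right) _).symm

lemma toSpecΓ_comp_scalar {X : Scheme.{u}} (str : X ⟶ Spec (.of k)) :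
    X.toSpecΓ ≫ Spec.map (CommRingCat.ofHom (scalar str)) = str := by
  have : CommRingCat.ofHom (scalar str) = (Scheme.ΓSpecIso (.of k)).inv ≫ str.appTop := rfl
  rw [this, Spec.map_comp, ← Category.assoc, ← Scheme.toSpecΓ_naturality, Category.assoc]
  simp

lemma eq_resO_scalar {X : Scheme.{u}} (str : X ⟶ Spec (.of k)) {U : X.Opens} (hU : IsAffineOpen U)
    (φ : CommRingCat.of k ⟶ Γ(X, U)) (h : U.ι ≫ str = U.toSpecΓ ≫ Spec.map φ) (c : k) :
    φ c = resO le_top (scalar str c) := by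
  have h1 : U.toSpecΓ ≫ Spec.map (CommRingCat.ofHom (scalar str) ≫
      X.presheaf.map (homOfLE le_top).op) = U.toSpecΓ ≫ Spec.map φ := by
    rw [Spec.map_comp, Scheme.Opens.toSpecΓ_SpecMap_presheaf_map_top_assoc, toSpecΓ_comp_scalar, h]
  rw [← hU.isoSpec_hom, cancel_epi] at h1
  exact congr($(Spec.map_injective h1).hom c).symm

lemma chart_scalar {i j : Fin 2} (hij : i ≠ j) (c : k) :
    chartEquiv k hij (Polynomial.C c) = resO le_top (scalar (projectiveLineStr k) c) := by
  rw [chartEquiv_C]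
  refine eq_resO_scalar k (projectiveLineStr k)
    (Proj.isAffineOpen_basicOpen _ _ (X_mem k i) one_pos)
    (CommRingCat.ofHom (awayScalar k (MvPolynomial.X i)) ≫ Proj.awayToSection
      (MvPolynomial.homogeneousSubmodule (Fin 2) k) (MvPolynomial.X i)) ?_ c
  have h2 : Proj.basicOpenToSpec (MvPolynomial.homogeneousSubmodule (Fin 2) k)
      (MvPolynomial.X i) ≫ Proj.awayι (MvPolynomial.homogeneousSubmodule (Fin 2) k)
      (MvPolynomial.X i) (X_mem k i) one_pos = (chart k i).ι := by
    rw [← Proj.basicOpenIsoSpec_hom _ _ (X_mem k i) one_pos, Proj.awayι, Iso.hom_inv_id_assoc]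
  rw [← h2, projectiveLineStr, Category.assoc, Proj.awayι_toSpecZero_assoc, ← Spec.map_comp,
    Proj.basicOpenToSpec, Category.assoc, ← Spec.map_comp]
  rfl

/-- The standard charts of the projective line. -/
def projectiveLineCharts : LineCharts (projectiveLineStr k) where
  U₀ := chart k 0
  U₁ := chart k 1
  affine₀ := Proj.isAffineOpen_basicOpen _ _ (X_mem k 0) one_pos
  affine₁ := Proj.isAffineOpen_basicOpen _ _ (X_mem k 1) one_pos
  cover := chart_cover k
  θ₀ := chartEquiv k (i := 0) (j := 1) (by decide)
  θ₁ := chartEquiv k (i := 1) (j := 0) (by decide)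
  scalar₀ := chart_scalar k _
  scalar₁ := chart_scalar k _
  inv := chart_inv k (i := 0) (j := 1) (by decide)
  basicOpen_le := chart_basicOpen_le k _

end ProjectiveLine

lemma scalar_comp {k : Type u} [Field k] {X Y : Scheme.{u}} (f : Y ⟶ X) (str : X ⟶ Spec (.of k))
    (c : k) : scalar (f ≫ str) c = f.app ⊤ (scalar str c) := by
  have h : (f ≫ str).appTop = str.appTop ≫ f.appTop := Scheme.Hom.comp_appTop _ _
  exact congr(($h).hom ((Scheme.ΓSpecIso (.of k)).inv c))

/-- The action of an isomorphism of schemes on functions. -/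
def appEquiv {X Y : Scheme.{u}} (e : X ≅ Y) (U : Y.Opens) : Γ(Y, U) ≃+* Γ(X, e.hom ⁻¹ᵁ U) :=
  RingEquiv.ofBijective (e.hom.app U).hom (ConcreteCategory.bijective_of_isIso (e.hom.app U))

lemma appEquiv_apply {X Y : Scheme.{u}} (e : X ≅ Y) (U : Y.Opens) (a : Γ(Y, U)) :
    appEquiv e U a = e.hom.app U a := rfl

/-- Charts of a projective line carry over along isomorphisms. -/
def LineCharts.ofIso {k : Type u} [Field k] {T T' : Scheme.{u}} {str : T ⟶ Spec (.of k)}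
    {str' : T' ⟶ Spec (.of k)} (𝒞 : LineCharts str') (e : T ≅ T') (he : e.hom ≫ str' = str) :
    LineCharts str where
  U₀ := e.hom ⁻¹ᵁ 𝒞.U₀
  U₁ := e.hom ⁻¹ᵁ 𝒞.U₁
  affine₀ := 𝒞.affine₀.preimage e.hom
  affine₁ := 𝒞.affine₁.preimage e.hom
  cover x := 𝒞.cover (e.hom x)
  θ₀ := 𝒞.θ₀.trans (appEquiv e _)
  θ₁ := 𝒞.θ₁.trans (appEquiv e _)
  scalar₀ c := by
    rw [RingEquiv.trans_apply, 𝒞.scalar₀, appEquiv_apply, app_resO, ← he, scalar_comp]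
    rfl
  scalar₁ c := by
    rw [RingEquiv.trans_apply, 𝒞.scalar₁, appEquiv_apply, app_resO, ← he, scalar_comp]
    rfl
  inv := by
    have h := congr(e.hom.app (𝒞.U₀ ⊓ 𝒞.U₁) $𝒞.inv)
    rw [map_mul, map_one, app_resO, app_resO] at h
    exact h
  basicOpen_le := by
    rw [RingEquiv.trans_apply, appEquiv_apply, ← Scheme.preimage_basicOpen]
    exact e.hom.preimage_mono 𝒞.basicOpen_le
end NodalPruning

/-! ### Irreducible components and local rings of closed subschemes -/

namespace NodalPruning

section Components
open Set
variable {α : Type*} [TopologicalSpace α]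

lemma isClosed_sUnion_of_subset_components [NoetherianSpace α] {𝒮 : Set (Set α)}
    (h𝒮 : 𝒮 ⊆ irreducibleComponents α) : IsClosed (⋃₀ 𝒮) := by
  rw [sUnion_eq_biUnion]
  exact (NoetherianSpace.finite_irreducibleComponents.subset h𝒮).isClosed_biUnion
    fun W hW => isClosed_of_mem_irreducibleComponents W (h𝒮 hW)

lemma not_subset_sUnion [NoetherianSpace α] {𝒮 : Set (Set α)}
    (h𝒮 : 𝒮 ⊆ irreducibleComponents α) {T : Set α} (hT : T ∈ irreducibleComponents α)
    (hT' : T ∉ 𝒮) : ¬ T ⊆ ⋃₀ 𝒮 := fun h =>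
  hT' (mem_of_subset_sUnion_irreducibleComponents T hT 𝒮
    (NoetherianSpace.finite_irreducibleComponents.subset h𝒮) h𝒮 h)

/-- An irreducible set that meets an open subset of a closed set lies in the closed set. -/
lemma subset_of_mem_nhds {T A : Set α} (hT : IsPreirreducible T) (hA : IsClosed A) {p : α}
    (hp : p ∈ T) (h : A ∈ nhds p) : T ⊆ A := by
  obtain ⟨N, hNA, hN, hpN⟩ := mem_nhds_iff.1 h
  refine (subset_closure_inter_of_isPreirreducible_of_isOpen hT hN ⟨p, hp, hpN⟩).trans ?_
  exact hA.closure_subset_iff.2 fun x hx => hNA hx.2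

lemma eq_of_subset_component {T U : Set α} (hT : T ∈ irreducibleComponents α)
    (hU : U ∈ irreducibleComponents α) (h : T ⊆ U) : T = U :=
  h.antisymm (hT.2 hU.1 h)

lemma sUnion_union_eq_univ {𝒮 : Set (Set α)} :
    ⋃₀ 𝒮 ∪ ⋃₀ (irreducibleComponents α \ 𝒮) = univ := by
  refine eq_univ_of_forall fun x => ?_
  by_cases h : irreducibleComponent x ∈ 𝒮
  · exact Or.inl ⟨_, h, mem_irreducibleComponent⟩
  · exact Or.inr ⟨_, ⟨irreducibleComponent_mem_irreducibleComponents x, h⟩,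
      mem_irreducibleComponent⟩

/-- The closure of the complement of a union of irreducible components is the union of the other
components. -/
lemma closure_compl_sUnion [NoetherianSpace α] {𝒮 : Set (Set α)}
    (h𝒮 : 𝒮 ⊆ irreducibleComponents α) :
    closure (⋃₀ 𝒮)ᶜ = ⋃₀ (irreducibleComponents α \ 𝒮) := by
  refine Subset.antisymm ?_ ?_
  · refine closure_minimal ?_ (isClosed_sUnion_of_subset_components sdiff_subset)
    exact compl_subset_iff_union.2 sUnion_union_eq_univ
  · refine sUnion_subset fun V hV => ?_
    obtain ⟨v, hv, hv'⟩ := not_subset.1 (not_subset_sUnion h𝒮 hV.1 hV.2)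
    exact (subset_closure_inter_of_isPreirreducible_of_isOpen hV.1.1.2
      (isClosed_sUnion_of_subset_components h𝒮).isOpen_compl ⟨v, hv, hv'⟩).trans
      (closure_mono inter_subset_right)

lemma closure_compl_component [NoetherianSpace α] {T : Set α} (hT : T ∈ irreducibleComponents α) :
    closure Tᶜ = ⋃₀ (irreducibleComponents α \ {T}) := by
  rw [← closure_compl_sUnion (singleton_subset_iff.2 hT), sUnion_singleton]

end Components

section Stalks
variable {X Z : Scheme.{u}} (i : Z ⟶ X)

/-- The map on stalks induced by `i`, for a point `z` over `p`. -/
def stalkTo {z : Z} {p : X} (h : i z = p) : X.presheaf.stalk p →+* Z.presheaf.stalk z :=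
  (X.presheaf.stalkSpecializes (specializes_of_eq h) ≫ i.stalkMap z).hom

lemma stalkTo_germ {z : Z} {p : X} (h : i z = p) {U : X.Opens} (hp : p ∈ U) (a : Γ(X, U)) :
    stalkTo i h (X.presheaf.germ U p hp a) =
      Z.presheaf.germ (i ⁻¹ᵁ U) z (show i z ∈ U from h ▸ hp) (i.app U a) := by
  subst h
  change i.stalkMap z (X.presheaf.stalkSpecializes _ _) = _
  rw [X.presheaf.germ_stalkSpecializes_apply, Scheme.Hom.germ_stalkMap_apply]

lemma stalkTo_surjective [IsClosedImmersion i] {z : Z} {p : X} (h : i z = p) :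
    Function.Surjective (stalkTo i h) := by
  subst h
  have h1 : X.presheaf.stalkSpecializes (specializes_of_eq (rfl : i z = i z)) = 𝟙 _ :=
    X.presheaf.stalkSpecializes_refl _
  rw [stalkTo, h1, Category.id_comp]
  exact i.stalkMap_surjective z

/-- A closed subscheme that contains a neighbourhood of `p` has the same local ring at `p`. -/
lemma stalkTo_bijective_of_mem_nhds [IsClosedImmersion i] [IsReduced X] {z : Z} {p : X}
    (h : i z = p) (hW : Set.range i ∈ nhds p) : Function.Bijective (stalkTo i h) := by
  subst h
  have h1 : X.presheaf.stalkSpecializes (specializes_of_eq (rfl : i z = i z)) = 𝟙 _ :=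
    X.presheaf.stalkSpecializes_refl _
  rw [stalkTo, h1, Category.id_comp]
  obtain ⟨N, hN, hNo, hzN⟩ := mem_nhds_iff.1 hW
  have := isIso_stalkMap_of_subset_range i (W := ⟨N, hNo⟩) hN z hzN
  exact ConcreteCategory.bijective_of_isIso (i.stalkMap z)

lemma mem_basicOpen_iff_germ {U : X.Opens} {p : X} (hp : p ∈ U) (a : Γ(X, U)) :
    p ∈ X.basicOpen a ↔ IsUnit (X.presheaf.germ U p hp a) := X.mem_basicOpen a p hp

lemma germ_eq_zero {U : X.Opens} {p : X} (hp : p ∈ U) {a : Γ(X, U)}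
    (h : X.presheaf.germ U p hp a = 0) :
    ∃ (W : X.Opens) (hW : W ≤ U), p ∈ W ∧ resO hW a = 0 := by
  obtain ⟨W, hpW, i1, i2, e⟩ := X.presheaf.germ_eq p hp hp a 0 (h.trans (map_zero _).symm)
  exact ⟨W, leOfHom i1, hpW, e.trans (map_zero (X.presheaf.map i2.op).hom)⟩

/-- A function with vanishing germ on a closed subscheme vanishes there near the point. -/
lemma app_eq_zero_of_stalkTo [IsClosedImmersion i] {z : Z} {p : X} (h : i z = p) {U : X.Opens}
    (hp : p ∈ U) {a : Γ(X, U)} (ha : stalkTo i h (X.presheaf.germ U p hp a) = 0) :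
    ∃ (W : X.Opens) (hW : W ≤ U), p ∈ W ∧ i.app W (resO hW a) = 0 := by
  rw [stalkTo_germ] at ha
  obtain ⟨V, hV, hzV, e⟩ := germ_eq_zero _ ha
  obtain ⟨N, hN, hNV⟩ := i.isClosedEmbedding.isOpen_iff.1 V.isOpen
  refine ⟨U ⊓ ⟨N, hN⟩, inf_le_left, ⟨hp, ?_⟩, ?_⟩
  · have : z ∈ i ⁻¹' N := by rw [hNV]; exact hzV
    rw [← h]; exact this
  · rw [app_resO]
    have hle : i ⁻¹ᵁ (U ⊓ ⟨N, hN⟩) ≤ V := by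
      intro y hy
      change y ∈ (V : Set Z)
      rw [← hNV]
      exact hy.2
    have := congr(resO hle $e)
    rwa [resO_resO, resO_zero] at this

lemma eq_zero_of_basicOpen [IsReduced X] {U : X.Opens} {a : Γ(X, U)}
    (h : ∀ x, x ∉ X.basicOpen a) : a = 0 := by
  rw [← basicOpen_eq_bot_iff]
  exact le_bot_iff.1 fun x hx => h x hx

/-- On an affine open set, the vanishing of finitely many functions defines a closed subscheme. -/
lemma exists_finite_equations [IsLocallyNoetherian X] [IsClosedImmersion i] {U : X.Opens}
    (hU : IsAffineOpen U) :
    ∃ S : Set Γ(X, U), S.Finite ∧ (∀ a ∈ S, i.app U a = 0) ∧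
      ∀ y ∈ U, y ∉ Set.range i → ∃ a ∈ S, y ∈ X.basicOpen a := by
  have : IsNoetherianRing Γ(X, U) := IsLocallyNoetherian.component_noetherian ⟨U, hU⟩
  obtain ⟨S, hS⟩ := IsNoetherian.noetherian (i.ker.ideal ⟨U, hU⟩)
  refine ⟨S, S.finite_toSet, fun a ha => ?_, fun y hy hyi => ?_⟩
  · have : a ∈ i.ker.ideal ⟨U, hU⟩ := hS ▸ Submodule.subset_span ha
    rwa [Scheme.Hom.ker_apply] at this
  · by_contra! H
    have h1 := i.ker.coe_support_inter ⟨U, hU⟩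
    have h2 : y ∈ X.zeroLocus (U := U) (i.ker.ideal ⟨U, hU⟩ : Set Γ(X, U)) ∩ U := by
      refine ⟨?_, hy⟩
      rw [Scheme.mem_zeroLocus_iff]
      intro f hf hyf
      have hspan : f ∈ Ideal.span (S : Set Γ(X, U)) := by rw [Ideal.span, hS]; exact hf
      rw [← Scheme.evaluation_ne_zero_iff_mem_basicOpen X y hy] at hyf
      have hle : Ideal.span (S : Set Γ(X, U)) ≤ RingHom.ker (X.evaluation U y hy).hom := by
        rw [Ideal.span_le]
        intro a ha
        exact (Scheme.evaluation_eq_zero_iff_notMem_basicOpen X y hy a).2 (H a ha)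
      exact hyf (hle hspan)
    rw [← h1, Scheme.Hom.support_ker, i.isClosedEmbedding.isClosed_range.closure_eq] at h2
    exact hyi h2.1

/-- If the map on stalks at `p` is injective, a closed subscheme contains a neighbourhood of `p`. -/
lemma range_mem_nhds [IsLocallyNoetherian X] [IsClosedImmersion i] {z : Z} {p : X} (h : i z = p)
    (hinj : ∀ r, stalkTo i h r = 0 → r = 0) : Set.range i ∈ nhds p := by
  obtain ⟨U, hU, -, hpU⟩ := exists_affine_nhd (X := X) (U := ⊤) (x := p) trivial
  obtain ⟨S, hS, h0, hS'⟩ := exists_finite_equations i hU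
  have h1 : ∀ a ∈ S, ∀ᶠ y in nhds p, y ∉ X.basicOpen a := by
    intro a ha
    have hg : X.presheaf.germ U p hpU a = 0 := by
      refine hinj _ ?_
      rw [stalkTo_germ, h0 a ha, map_zero]
    obtain ⟨W, hW, hpW, e⟩ := germ_eq_zero hpU hg
    filter_upwards [W.isOpen.mem_nhds hpW] with y hy hya
    have h2 : y ∈ X.basicOpen (resO hW a) := by rw [basicOpen_resO]; exact ⟨hy, hya⟩
    rw [e, Scheme.basicOpen_zero] at h2
    exact h2
  filter_upwards [(Filter.eventually_all_finite hS).2 h1, U.isOpen.mem_nhds hpU] with y hy hyU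
  by_contra hyi
  obtain ⟨a, ha, hya⟩ := hS' y hyU hyi
  exact hy a ha hya

end Stalks

section Cover
variable {X Z₁ Z₂ : Scheme.{u}} (i : Z₁ ⟶ X) (j : Z₂ ⟶ X) [IsClosedImmersion i]
  [IsClosedImmersion j] [IsReduced X] [IsReduced Z₁] [IsReduced Z₂]

omit [IsClosedImmersion i] [IsClosedImmersion j] in
/-- A function on a reduced scheme that vanishes on two closed subschemes covering it is zero. -/
lemma eq_zero_of_cover (hij : Set.range i ∪ Set.range j = Set.univ) {U : X.Opens} {a : Γ(X, U)}
    (hi : i.app U a = 0) (hj : j.app U a = 0) : a = 0 := by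
  refine eq_zero_of_basicOpen fun x hx => ?_
  rcases (hij ▸ Set.mem_univ x : x ∈ Set.range i ∪ Set.range j) with ⟨z, rfl⟩ | ⟨z, rfl⟩
  · exact (app_eq_zero_iff i a).1 hi z hx
  · exact (app_eq_zero_iff j a).1 hj z hx

/-- The local ring at a point of the intersection of two closed subschemes that cover `X` embeds in
the product of their local rings. -/
lemma stalkTo_cover_inj (hij : Set.range i ∪ Set.range j = Set.univ) {z₁ : Z₁} {z₂ : Z₂} {p : X}
    (h₁ : i z₁ = p) (h₂ : j z₂ = p) (r : X.presheaf.stalk p) (hi : stalkTo i h₁ r = 0)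
    (hj : stalkTo j h₂ r = 0) : r = 0 := by
  obtain ⟨U, hp, a, rfl⟩ := X.presheaf.exists_germ_eq r
  obtain ⟨W, hW, hpW, e⟩ := app_eq_zero_of_stalkTo i h₁ hp hi
  obtain ⟨W', hW', hpW', e'⟩ := app_eq_zero_of_stalkTo j h₂ hp hj
  have h := eq_zero_of_cover i j hij (U := W ⊓ W') (a := resO (inf_le_left.trans hW) a)
    (by rw [← resO_resO inf_le_left hW]; exact app_eq_zero_of_resO i _ e)
    (by rw [← resO_resO inf_le_right hW']; exact app_eq_zero_of_resO j _ e')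
  rw [← germ_resO (inf_le_left.trans hW) a p ⟨hpW, hpW'⟩, h, map_zero]

/-- If the local ring at `p` is a domain, then one of two closed subschemes that cover `X` and
contain `p` contains a neighbourhood of `p`. -/
lemma mem_nhds_or_mem_nhds [IsLocallyNoetherian X]
    (hij : Set.range i ∪ Set.range j = Set.univ) {z₁ : Z₁} {z₂ : Z₂} {p : X}
    (h₁ : i z₁ = p) (h₂ : j z₂ = p) [IsDomain (X.presheaf.stalk p)] :
    Set.range i ∈ nhds p ∨ Set.range j ∈ nhds p := by
  by_contra! H
  obtain ⟨a, ha, ha0⟩ : ∃ a, stalkTo i h₁ a = 0 ∧ a ≠ 0 := by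
    by_contra! h
    exact H.1 (range_mem_nhds i h₁ h)
  obtain ⟨b, hb, hb0⟩ : ∃ b, stalkTo j h₂ b = 0 ∧ b ≠ 0 := by
    by_contra! h
    exact H.2 (range_mem_nhds j h₂ h)
  refine mul_ne_zero ha0 hb0 (stalkTo_cover_inj i j hij h₁ h₂ _ ?_ ?_)
  · rw [map_mul, ha, zero_mul]
  · rw [map_mul, hb, mul_zero]

end Cover

section Transfer
variable {X Z : Scheme.{u}}

lemma isSmoothPoint_of_ringEquiv {x : X} {z : Z} (e : X.presheaf.stalk x ≃+* Z.presheaf.stalk z)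
    (h : IsSmoothPoint x) : IsSmoothPoint z := by
  obtain ⟨_, _⟩ := h
  have := (e.toMulEquiv.symm).isDomain (X.presheaf.stalk x)
  exact ⟨this, IsDiscreteValuationRing.RingEquivClass.isDiscreteValuationRing e⟩

lemma isNode_of_ringEquiv {k : Type u} [Field k] {x : X} {z : Z}
    (e : X.presheaf.stalk x ≃+* Z.presheaf.stalk z) (h : IsNode k x) : IsNode k z := by
  obtain ⟨f⟩ := h
  obtain ⟨g⟩ := nonempty_completion_ringEquiv e
  exact ⟨g.symm.trans f⟩

end Transfer
end NodalPruning

/-! ### The ideal sheaf of a smooth point -/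

namespace NodalPruning

section Ideal
variable {X : Scheme.{u}} {A : Set X}

lemma app_reducedSubι_eq_zero_iff {U : X.Opens} (a : Γ(X, U)) :
    (reducedSubι X A).app U a = 0 ↔ ∀ x ∈ closure A, x ∉ X.basicOpen a := by
  rw [app_eq_zero_iff, ← range_reducedSubι]
  exact (Set.forall_mem_range (p := fun x => x ∉ X.basicOpen a)).symm

/-- A function that generates the ideal of `closure A` locally and is not a zero divisor defines a
generator of the ideal sheaf. -/
lemma exists_ideal_generator {W : X.Opens} (f : Γ(X, W))
    (hf : ∀ x ∈ closure A, x ∉ X.basicOpen f)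
    (hinj : ∀ (V : X.Opens) (h : V ≤ W) (a : Γ(X, V)), a * resO h f = 0 → a = 0)
    (hgen : ∀ (V : X.Opens) (h : V ≤ W) (s : Γ(X, V)), (∀ x ∈ closure A, x ∉ X.basicOpen s) →
      ∀ x ∈ V, ∃ (V' : X.Opens) (h' : V' ≤ V) (a : Γ(X, V')), x ∈ V' ∧
        resO h' s = a * resO (h'.trans h) f) :
    ∃ u : Γ(idealSheaf X A, W), IsGenerator (idealSheaf X A) u ∧
      (idealIncl X A).app W u = secO f := by
  obtain ⟨u, hu⟩ := (mem_range_idealIncl X A W f).2 ((app_reducedSubι_eq_zero_iff f).2 hf)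
  have hsmul : ∀ (V : X.Opens) (h : V ≤ W) (a : Γ(X, V)),
      (idealIncl X A).app V (a • resM _ h u) = secO (a * resO h f) := by
    intro V h a
    rw [Scheme.Modules.Hom.app_smul, app_resM, hu, resM_secO, smul_secO]
  refine ⟨u, isGenerator_of_locally_bijective (fun V h a ha => hinj V h a ?_)
    fun V h s x hx => ?_, hu⟩
  · have h1 := hsmul V h a
    rw [ha] at h1
    exact (h1.symm.trans (map_zero ((idealIncl X A).app V).hom))
  · obtain ⟨b, hb⟩ := (secO_bijective V).2 ((idealIncl X A).app V s)
    have hvan := (app_reducedSubι_eq_zero_iff b).1 ((mem_range_idealIncl X A V b).1 ⟨s, hb.symm⟩)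
    obtain ⟨V', h', a, hx', e⟩ := hgen V h b hvan x hx
    refine ⟨V', h', a, hx', idealIncl_injective X A V' ?_⟩
    rw [hsmul, app_resM, ← hb, resM_secO, e]

/-- Away from `closure A`, the ideal sheaf is the structure sheaf. -/
lemma exists_ideal_generator_of_disjoint {W : X.Opens} (hW : ∀ x ∈ closure A, x ∉ W) :
    ∃ u : Γ(idealSheaf X A, W), IsGenerator (idealSheaf X A) u ∧
      (idealIncl X A).app W u = secO 1 := by
  refine exists_ideal_generator 1 (fun x hx h => hW x hx (X.basicOpen_le _ h))
    (fun V h a ha => ?_) fun V h s _ x hx => ⟨V, le_rfl, s, hx, ?_⟩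
  · rwa [resO_one, mul_one] at ha
  · rw [resO_one, resO_self, mul_one]

/-- A uniformizer at a smooth closed point generates the ideal sheaf of the point near it. -/
lemma exists_ideal_generator_of_irreducible [IsLocallyNoetherian X] {q : X}
    (hq : IsClosed ({q} : Set X)) [IsDomain (X.presheaf.stalk q)]
    [IsDiscreteValuationRing (X.presheaf.stalk q)] {U : X.Opens} (hqU : q ∈ U) (f : Γ(X, U))
    (hf : Irreducible (X.presheaf.germ U q hqU f)) :
    ∃ (W : X.Opens) (h : W ≤ U) (u : Γ(idealSheaf X {q}, W)), q ∈ W ∧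
      IsGenerator (idealSheaf X {q}) u ∧ (idealIncl X {q}).app W u = secO (resO h f) := by
  obtain ⟨U', hU', hle, hqU'⟩ := exists_affine_nhd hqU
  obtain ⟨S, hS, h0, hS'⟩ := exists_finite_equations (reducedSubι X {q}) hU'
  have hdvd : ∀ (V : X.Opens) (hqV : q ∈ V) (hVU : V ≤ U) (a : Γ(X, V)), q ∉ X.basicOpen a →
      ∃ (V' : X.Opens) (h : V' ≤ V) (r : Γ(X, V')), q ∈ V' ∧
        resO h a = r * resO (h.trans hVU) f := by
    intro V hqV hVU a ha
    rw [mem_basicOpen_iff_germ hqV, ← mem_nonunits_iff, ← IsLocalRing.mem_maximalIdeal,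
      (IsDiscreteValuationRing.irreducible_iff_uniformizer _).1 hf,
      Ideal.mem_span_singleton] at ha
    obtain ⟨r, hr⟩ := ha
    obtain ⟨V₁, hq1, r, rfl⟩ := X.presheaf.exists_germ_eq r
    have hmem : q ∈ V₁ ⊓ V := ⟨hq1, hqV⟩
    have hz : X.presheaf.germ (V₁ ⊓ V) q hmem
        (resO inf_le_right a - resO (inf_le_right.trans hVU) f * resO inf_le_left r) = 0 := by
      rw [map_sub, map_mul, germ_resO, germ_resO, germ_resO, hr, sub_self]
    obtain ⟨V', hV', hqV', e⟩ := germ_eq_zero _ hz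
    refine ⟨V', hV'.trans inf_le_right, resO (hV'.trans inf_le_left) r, hqV', ?_⟩
    rw [resO_sub, resO_mul, resO_resO, resO_resO, resO_resO, sub_eq_zero] at e
    rw [e, mul_comm]
  have hclos : closure ({q} : Set X) = {q} := hq.closure_eq
  -- near `q`, the uniformizer is invertible away from `q`
  have h1 : ∀ a ∈ S, ∀ᶠ y in nhds q, y ∈ X.basicOpen a → y ∈ X.basicOpen f := by
    intro a ha
    have hqa : q ∉ X.basicOpen a :=
      (app_reducedSubι_eq_zero_iff a).1 (h0 a ha) q (hclos.symm ▸ rfl)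
    obtain ⟨V', h, r, hqV', e⟩ := hdvd U' hqU' hle a hqa
    filter_upwards [V'.isOpen.mem_nhds hqV'] with y hy hya
    have h2 : y ∈ X.basicOpen (resO h a) := by rw [basicOpen_resO]; exact ⟨hy, hya⟩
    rw [e, Scheme.basicOpen_mul, basicOpen_resO] at h2
    exact h2.2.2
  obtain ⟨N, hN, hNo, hqN⟩ := mem_nhds_iff.1 ((Filter.eventually_all_finite hS).2 h1)
  let W : X.Opens := ⟨N, hNo⟩ ⊓ U'
  have hWU : W ≤ U := inf_le_right.trans hle
  have hunit : ∀ y ∈ W, y ≠ q → y ∈ X.basicOpen f := by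
    intro y hy hyq
    obtain ⟨a, ha, hya⟩ := hS' y hy.2 (by rw [range_reducedSubι, hclos]; exact hyq)
    exact hN hy.1 a ha hya
  have hqf : q ∉ X.basicOpen f := by
    rw [mem_basicOpen_iff_germ hqU]
    exact hf.not_isUnit
  have hunit' : ∀ (V : X.Opens) (hV : V ≤ W) (y : X) (_ : y ∈ V) (_ : y ≠ q),
      ∃ V' : X.Opens, y ∈ V' ∧ ∃ h : V' ≤ V, IsUnit (resO (h.trans (hV.trans hWU)) f) := by
    intro V hV y hy hyq
    refine ⟨V ⊓ X.basicOpen f, ⟨hy, hunit y (hV hy) hyq⟩, inf_le_left, ?_⟩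
    have := (X.toRingedSpace.isUnit_res_basicOpen f).map
      (X.presheaf.map (homOfLE (inf_le_right : V ⊓ X.basicOpen f ≤ X.basicOpen f)).op).hom
    convert this
    exact (resO_resO (inf_le_right : V ⊓ X.basicOpen f ≤ X.basicOpen f) (X.basicOpen_le f) f).symm
  obtain ⟨u, hu, e⟩ := exists_ideal_generator (A := {q}) (resO hWU f)
    (fun x hx h => by
      rw [hclos] at hx
      rw [basicOpen_resO] at h
      exact hqf (hx ▸ h.2))
    (fun V h a ha => by
      rw [resO_resO] at ha
      refine eq_of_locallyO fun x hx => ?_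
      by_cases hxq : x = q
      · subst hxq
        have h2 := congr(X.presheaf.germ V x hx $ha)
        rw [map_mul, germ_resO, map_zero] at h2
        obtain ⟨V', hV', hxV', e⟩ := germ_eq_zero hx ((mul_eq_zero.1 h2).resolve_right hf.ne_zero)
        exact ⟨V', hV', hxV', by rw [e, resO_zero]⟩
      · obtain ⟨V', hxV', hV', hu⟩ := hunit' V h x hx hxq
        refine ⟨V', hV', hxV', hu.mul_right_cancel ?_⟩
        have h2 := congr(resO hV' $ha)
        rw [resO_mul, resO_resO, resO_zero] at h2
        rw [h2, resO_zero, zero_mul])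
    fun V h s hs x hx => by
      by_cases hxq : x = q
      · subst hxq
        obtain ⟨V', h', r, hx', e⟩ := hdvd V hx (h.trans hWU) s (hs x (hclos.symm ▸ rfl))
        exact ⟨V', h', r, hx', by rw [e, resO_resO]⟩
      · obtain ⟨V', hxV', hV', hu⟩ := hunit' V h x hx hxq
        refine ⟨V', hV', resO hV' s * ↑hu.unit⁻¹, hxV', ?_⟩
        rw [resO_resO, mul_assoc, IsUnit.val_inv_mul, mul_one]
  exact ⟨W, hWU, u, ⟨hqN, hqU'⟩, hu, e⟩

lemma exists_irreducible_germ {q : X} [IsDomain (X.presheaf.stalk q)]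
    [IsDiscreteValuationRing (X.presheaf.stalk q)] :
    ∃ (U : X.Opens) (hq : q ∈ U) (f : Γ(X, U)), Irreducible (X.presheaf.germ U q hq f) := by
  obtain ⟨ϖ, hϖ⟩ := IsDiscreteValuationRing.exists_irreducible (X.presheaf.stalk q)
  obtain ⟨U, hq, f, rfl⟩ := X.presheaf.exists_germ_eq ϖ
  exact ⟨U, hq, f, hϖ⟩

/-- The ideal sheaf of a smooth closed point is a line bundle. -/
lemma isLineBundle_idealSheaf [IsLocallyNoetherian X] {q : X} (hq : IsClosed ({q} : Set X))
    (hs : IsSmoothPoint q) : IsLineBundle (idealSheaf X {q}) := by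
  obtain ⟨_, _⟩ := hs
  intro x
  by_cases hx : x = q
  · subst hx
    obtain ⟨U, hqU, f, hf⟩ := exists_irreducible_germ (q := x)
    obtain ⟨W, -, u, hxW, hu, -⟩ := exists_ideal_generator_of_irreducible hq hqU f hf
    exact ⟨W, hxW, u, hu⟩
  · obtain ⟨u, hu, -⟩ := exists_ideal_generator_of_disjoint (A := {q})
      (W := ⟨{q}ᶜ, hq.isOpen_compl⟩) (fun y hy h => h (hq.closure_eq ▸ hy))
    exact ⟨_, hx, u, hu⟩

end Ideal

section Twist
variable {X : Scheme.{u}} (L : X.Modules) (A : Set X)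

/-- Sections of the ideal sheaf as functions. -/
def idealFun (U : X.Opens) : Γ(idealSheaf X A, U) →ₗ[Γ(X, U)] Γ(X, U) where
  toFun s := (idealIncl X A).app U s
  map_add' s t := map_add ((idealIncl X A).app U).hom s t
  map_smul' a s := Scheme.Modules.Hom.app_smul (idealIncl X A) a s

lemma idealFun_resM {U W : X.Opens} (h : W ≤ U) (t : Γ(idealSheaf X A, U)) :
    idealFun A W (resM _ h t) = resO h (idealFun A U t) := app_resM (idealIncl X A) h t

/-- The multiplication map `L ⊗ I ⟶ L`, where `I` is the ideal sheaf of `closure A`. -/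
def mulIdeal : tensor L (idealSheaf X A) ⟶ L :=
  tensorDesc (fun U => TensorProduct.lift (R := Γ(X, U))
      ((LinearMap.lsmul Γ(X, U) Γ(L, U)).flip.compl₂ (idealFun A U)))
    (fun U W h s t => by
      rw [TensorProduct.lift.tmul, TensorProduct.lift.tmul]
      change idealFun A W _ • resM L h s = resM L h (idealFun A U t • s)
      rw [idealFun_resM, resM_smul])

lemma mulIdeal_tmul {U : X.Opens} (s : Γ(L, U)) (t : Γ(idealSheaf X A, U)) {f : Γ(X, U)}
    (hf : (idealIncl X A).app U t = secO f) :
    (mulIdeal L A).app U (ofTensor _ _ U (s ⊗ₜ[Γ(X, U)] t)) = f • s := by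
  rw [mulIdeal, tensorDesc_ofTensor, TensorProduct.lift.tmul]
  have : idealFun A U t = f := hf
  rw [← this]
  rfl

end Twist
end NodalPruning

/-! ### Gluing sections over a transversal union -/

namespace NodalPruning

section Vanishes
variable {X : Scheme.{u}} {M : X.Modules}

variable (M) in
/-- The global section `s` of the line bundle `M` vanishes at `x`. -/
def Vanishes (s : Γ(M, ⊤)) (x : X) : Prop :=
  ∀ (U : X.Opens) (g : Γ(M, U)) (_hg : IsGenerator M g) (a : Γ(X, U)), x ∈ U →
    resM M le_top s = a • g → x ∉ X.basicOpen a

lemma vanishes_of_eq {s : Γ(M, ⊤)} {x : X} {U : X.Opens} {g : Γ(M, U)}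
    {a : Γ(X, U)} (hxU : x ∈ U) (e : resM M le_top s = a • g) (ha : x ∉ X.basicOpen a) :
    Vanishes M s x := by
  intro V g' hg' b hxV e' hb
  obtain ⟨c, hc⟩ := hg'.exists_smul (inf_le_left : V ⊓ U ≤ V) (resM M inf_le_right g)
  have h1 := congr(resM M (inf_le_right : V ⊓ U ≤ U) $e)
  have h2 := congr(resM M (inf_le_left : V ⊓ U ≤ V) $e')
  rw [resM_resM, resM_smul] at h1 h2
  rw [hc, ← mul_smul] at h1
  have h3 := hg'.smul_inj inf_le_left (h1.symm.trans h2)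
  have h4 : x ∈ X.basicOpen (resO (inf_le_left : V ⊓ U ≤ V) b) := by
    rw [basicOpen_resO]; exact ⟨⟨hxV, hxU⟩, hb⟩
  rw [← h3, Scheme.basicOpen_mul, basicOpen_resO] at h4
  exact ha h4.1.2

lemma Vanishes.add (hM : IsLineBundle M) {s t : Γ(M, ⊤)} {x : X} (hs : Vanishes M s x)
    (ht : Vanishes M t x) : Vanishes M (s + t) x := by
  obtain ⟨U, hxU, g, hg⟩ := hM x
  obtain ⟨a, ha⟩ := hg.exists_smul le_rfl (resM M le_top s)
  obtain ⟨b, hb⟩ := hg.exists_smul le_rfl (resM M le_top t)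
  rw [resM_self] at ha hb
  refine vanishes_of_eq (a := a + b) hxU (by rw [resM_add, ha, hb, add_smul]) ?_
  have h1 := hs U g hg a hxU ha
  have h2 := ht U g hg b hxU hb
  rw [← Scheme.evaluation_eq_zero_iff_notMem_basicOpen X x hxU] at h1 h2 ⊢
  rw [map_add, h1, h2, add_zero]

lemma Vanishes.smul (hM : IsLineBundle M) {s : Γ(M, ⊤)} {x : X} (hs : Vanishes M s x)
    (c : Γ(X, ⊤)) : Vanishes M (c • s) x := by
  obtain ⟨U, hxU, g, hg⟩ := hM x
  obtain ⟨a, ha⟩ := hg.exists_smul le_rfl (resM M le_top s)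
  rw [resM_self] at ha
  refine vanishes_of_eq (a := resO le_top c * a) hxU
    (by rw [resM_smul, ha, mul_smul]) fun h => ?_
  rw [Scheme.basicOpen_mul] at h
  exact hs U g hg a hxU ha h.2

lemma Vanishes.zero (hM : IsLineBundle M) (x : X) : Vanishes M 0 x := by
  obtain ⟨U, hxU, g, -⟩ := hM x
  refine vanishes_of_eq (g := g) (a := 0) hxU (by rw [resM_zero, zero_smul]) ?_
  rw [Scheme.basicOpen_zero]
  exact fun h => h

end Vanishes

section Scalar
variable {k : Type u} [Field k] [IsAlgClosed k] {X : Scheme.{u}} (str : X ⟶ Spec (.of k))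
  [LocallyOfFiniteType str]

/-- The residue field of a closed point is the base field, so that the value of a function there
is a multiple of the value of any function that does not vanish there. -/
lemma exists_scalar_mul_sub {x : X} (hx : IsClosed ({x} : Set X)) {U : X.Opens} (hxU : x ∈ U)
    {a : Γ(X, U)} (ha : x ∈ X.basicOpen a) (b : Γ(X, U)) :
    ∃ c : k, x ∉ X.basicOpen (resO le_top (scalar str c) * a - b) := by
  have h1 := (SpecMap_residueFieldIsoBase_inv str x hx).trans
    (congrArg (X.fromSpecResidueField x ≫ ·) (toSpecΓ_comp_scalar k str).symm)
  rw [Scheme.fromSpecResidueField, Category.assoc,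
    Scheme.fromSpecStalk_toSpecΓ_assoc, ← Spec.map_comp, ← Spec.map_comp] at h1
  have h2 : ∀ c : k, (residueFieldIsoBase str x hx).inv c =
      X.evaluation U x hxU (resO le_top (scalar str c)) := by
    intro c
    refine congr($(Spec.map_injective h1).hom c).trans ?_
    exact congr(X.residue x $(germ_resO le_top (scalar str c) x hxU)).symm
  have ha0 := (Scheme.evaluation_ne_zero_iff_mem_basicOpen X x hxU a).2 ha
  obtain ⟨c, hc⟩ := (ConcreteCategory.bijective_of_isIso (residueFieldIsoBase str x hx).inv).2
    (X.evaluation U x hxU b / X.evaluation U x hxU a)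
  refine ⟨c, ?_⟩
  rw [← Scheme.evaluation_eq_zero_iff_notMem_basicOpen X x hxU, map_sub, map_mul, ← h2, hc,
    div_mul_cancel₀ _ ha0, sub_self]

end Scalar

section Glue
variable {X Z₁ Z₂ : Scheme.{u}} (i : Z₁ ⟶ X) (j : Z₂ ⟶ X) [IsClosedImmersion i]
  [IsClosedImmersion j] [IsReduced X] [IsReduced Z₁] [IsReduced Z₂] {L : X.Modules}

omit [IsReduced X] [IsReduced Z₁] in
/-- Near a point of `U`, a section on a closed subscheme is a multiple of a given generator by a
function on the ambient scheme. -/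
lemma exists_local_expr {U : X.Opens} {g : Γ(L, U)} (hg : IsGenerator L g) {x : X} (hx : x ∈ U)
    (s : Γ(restrictTo i L, ⊤)) :
    ∃ (W : X.Opens) (h : W ≤ U) (a : Γ(X, W)), x ∈ W ∧
      resM _ le_top s = i.app W a • pullSec i L (resM L h g) := by
  obtain ⟨b, hb⟩ := (hg.pullSec i U).exists_smul le_rfl (resM _ le_top s)
  obtain ⟨W, h, a, hxW, e⟩ := exists_local_lift i b hx
  refine ⟨W, h, a, hxW, ?_⟩
  have := congr(resM _ (i.preimage_mono h) $hb)
  rw [resM_resM, resM_smul, resM_self] at this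
  rw [this, e, pullSec_resM]

omit [IsClosedImmersion i] [IsClosedImmersion j] in
/-- A section of a line bundle is zero if it restricts to zero on two closed subschemes covering
`X`. -/
lemma eq_zero_of_pullSec (hij : Set.range i ∪ Set.range j = Set.univ) (hL : IsLineBundle L)
    {U : X.Opens} {s : Γ(L, U)} (hi : pullSec i L s = 0) (hj : pullSec j L s = 0) : s = 0 := by
  refine eq_of_locally L fun x hx => ?_
  obtain ⟨V, hxV, g, hg⟩ := hL x
  obtain ⟨a, ha⟩ := hg.exists_smul (inf_le_right : U ⊓ V ≤ V) (resM L inf_le_left s)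
  refine ⟨U ⊓ V, inf_le_left, ⟨hx, hxV⟩, ?_⟩
  have key : ∀ {Z : Scheme.{u}} (f : Z ⟶ X), pullSec f L s = 0 → f.app _ a = 0 := by
    intro Z f hf
    have h1 := congr(pullSec f L $ha)
    rw [pullSec_resM, hf, resM_zero, pullSec_smul] at h1
    exact ((hg.res inf_le_right).pullSec f _).smul_eq_zero le_rfl (by rw [resM_self]; exact h1.symm)
  rw [ha, eq_zero_of_cover i j hij (key i hi) (key j hj), zero_smul, resM_zero]

/-- Sections on two closed subschemes that cover `X` and meet transversally in the point `p` come
from a section on `X` if they agree at `p`. -/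
theorem exists_section_of_cover (hij : Set.range i ∪ Set.range j = Set.univ) (hL : IsLineBundle L)
    {z₁ : Z₁} {z₂ : Z₂} {p : X} (h₁ : i z₁ = p) (h₂ : j z₂ = p)
    (hp : Set.range i ∩ Set.range j = {p})
    (hm : IsLocalRing.maximalIdeal (X.presheaf.stalk p) ≤
      RingHom.ker (stalkTo i h₁) ⊔ RingHom.ker (stalkTo j h₂))
    (s₁ : Γ(restrictTo i L, ⊤)) (s₂ : Γ(restrictTo j L, ⊤))
    {W : X.Opens} (hpW : p ∈ W) {g : Γ(L, W)} {a b : Γ(X, W)}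
    (ha : resM _ le_top s₁ = i.app W a • pullSec i L g)
    (hb : resM _ le_top s₂ = j.app W b • pullSec j L g) (hab : p ∉ X.basicOpen (a - b)) :
    ∃ s : Γ(L, ⊤), pullSec i L s = s₁ ∧ pullSec j L s = s₂ := by
  -- the sections with the required restrictions are unique, so it suffices to find them locally
  let P : ∀ W : X.Opens, Γ(L, W) → Prop := fun W s =>
    pullSec i L s = resM _ le_top s₁ ∧ pullSec j L s = resM _ le_top s₂
  obtain ⟨s, hs⟩ := exists_glue L (U := ⊤) P
    (fun W W' h s hs => ⟨by rw [pullSec_resM, hs.1, resM_resM],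
      by rw [pullSec_resM, hs.2, resM_resM]⟩)
    (fun W _ s t hs ht => by
      rw [← sub_eq_zero]
      refine eq_zero_of_pullSec i j hij hL ?_ ?_
      · have h := pullSec_add i L (s - t) t
        rw [sub_add_cancel, hs.1, ht.1] at h
        exact (add_eq_right.1 h.symm)
      · have h := pullSec_add j L (s - t) t
        rw [sub_add_cancel, hs.2, ht.2] at h
        exact (add_eq_right.1 h.symm))
    (fun x _ => by
      by_cases hxp : x = p
      · subst hxp
        -- correct the lifts by functions vanishing on one of the two subschemes
        rw [mem_basicOpen_iff_germ hpW, ← mem_nonunits_iff, ← IsLocalRing.mem_maximalIdeal] at hab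
        obtain ⟨r, hr, r', hr', e⟩ := Submodule.mem_sup.1 (hm hab)
        obtain ⟨V, hxV, r, rfl⟩ := X.presheaf.exists_germ_eq r
        obtain ⟨V', hxV', r', rfl⟩ := X.presheaf.exists_germ_eq r'
        obtain ⟨N, hN, hxN, hN0⟩ := app_eq_zero_of_stalkTo i h₁ hxV hr
        obtain ⟨N', hN', hxN', hN0'⟩ := app_eq_zero_of_stalkTo j h₂ hxV' hr'
        have hmem : x ∈ W ⊓ (N ⊓ N') := ⟨hpW, hxN, hxN'⟩
        have hNN : W ⊓ (N ⊓ N') ≤ N := inf_le_right.trans inf_le_left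
        have hNN' : W ⊓ (N ⊓ N') ≤ N' := inf_le_right.trans inf_le_right
        have hz : X.presheaf.germ (W ⊓ (N ⊓ N')) x hmem
            (resO inf_le_left (a - b) -
              (resO (hNN.trans hN) r + resO (hNN'.trans hN') r')) = 0 := by
          rw [map_sub, map_add, germ_resO, germ_resO, germ_resO, e, sub_self]
        obtain ⟨Y, hY, hxY, hY0⟩ := germ_eq_zero _ hz
        rw [resO_sub, resO_add, resO_resO, resO_resO, resO_resO, sub_eq_zero, resO_sub,
          sub_eq_iff_eq_add] at hY0
        have hi0 : i.app Y (resO (hY.trans (hNN.trans hN)) r) = 0 := by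
          rw [← resO_resO (hY.trans hNN) hN]; exact app_eq_zero_of_resO i _ hN0
        have hj0 : j.app Y (resO (hY.trans (hNN'.trans hN')) r') = 0 := by
          rw [← resO_resO (hY.trans hNN') hN']; exact app_eq_zero_of_resO j _ hN0'
        have hYW : Y ≤ W := hY.trans inf_le_left
        refine ⟨Y, hxY, le_top, (resO hYW b + resO (hY.trans (hNN'.trans hN')) r') • resM L hYW g,
          ?_, ?_⟩
        · have h3 := congr(i.app Y $hY0)
          rw [map_add, map_add, hi0, zero_add] at h3
          have h4 := congr(resM _ (i.preimage_mono hYW) $ha)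
          rw [resM_resM, resM_smul, ← app_resO i hYW, ← pullSec_resM, h3] at h4
          rw [h4, pullSec_smul, map_add, add_comm]
        · have h4 := congr(resM _ (j.preimage_mono hYW) $hb)
          rw [resM_resM, resM_smul, ← app_resO j hYW, ← pullSec_resM] at h4
          rw [h4, pullSec_smul, map_add, hj0, add_zero]
      · obtain ⟨U, hxU, g, hg⟩ := hL x
        -- away from `p`, only one of the two subschemes matters
        have key : ∀ {Y : Scheme.{u}} (f : Y ⟶ X) [IsClosedImmersion f], x ∉ Set.range f →
            ∃ V : X.Opens, x ∈ V ∧ ∀ (V' : X.Opens) (_ : V' ≤ V)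
              (s t : Γ(restrictTo f L, f ⁻¹ᵁ V')), s = t := by
          intro Y f _ hxf
          refine ⟨⟨(Set.range f)ᶜ, f.isClosedEmbedding.isClosed_range.isOpen_compl⟩, hxf,
            fun V' hV' s t => eq_of_locally _ fun y hy => (hV' hy ⟨y, rfl⟩).elim⟩
        by_cases hxi : x ∈ Set.range i
        · have hxj : x ∉ Set.range j := fun h => hxp (hp.le ⟨hxi, h⟩)
          obtain ⟨V, hxV, hV⟩ := key j hxj
          obtain ⟨N, hN, c, hxN, e⟩ := exists_local_expr i hg hxU s₁
          refine ⟨N ⊓ V, ⟨hxN, hxV⟩, le_top, resM L inf_le_left (c • resM L hN g), ?_,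
            hV _ inf_le_right _ _⟩
          rw [pullSec_resM, pullSec_smul, ← e, resM_resM]
        · obtain ⟨V, hxV, hV⟩ := key i hxi
          obtain ⟨N, hN, c, hxN, e⟩ := exists_local_expr j hg hxU s₂
          refine ⟨N ⊓ V, ⟨hxN, hxV⟩, le_top, resM L inf_le_left (c • resM L hN g),
            hV _ inf_le_right _ _, ?_⟩
          rw [pullSec_resM, pullSec_smul, ← e, resM_resM])
  refine ⟨s, eq_of_locally _ fun y _ => ?_, eq_of_locally _ fun y _ => ?_⟩
  · obtain ⟨N, hN, hyN, hs1, -⟩ := hs (i y) trivial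
    refine ⟨i ⁻¹ᵁ N, le_top, hyN, ?_⟩
    exact (pullSec_resM i L hN s).symm.trans hs1
  · obtain ⟨N, hN, hyN, -, hs2⟩ := hs (j y) trivial
    refine ⟨j ⁻¹ᵁ N, le_top, hyN, ?_⟩
    exact (pullSec_resM j L hN s).symm.trans hs2

omit [IsClosedImmersion i] [IsClosedImmersion j] [IsReduced X] [IsReduced Z₁] in
/-- If a section vanishes on one subscheme, it vanishes at the intersection point on the other. -/
lemma vanishes_pullSec (hL : IsLineBundle L) {z₁ : Z₁} {z₂ : Z₂} {p : X} (h₁ : i z₁ = p)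
    (h₂ : j z₂ = p) {s : Γ(L, ⊤)} (hs : pullSec j L s = 0) :
    Vanishes (restrictTo i L) (pullSec i L s) z₁ := by
  obtain ⟨U, hpU, g, hg⟩ := hL p
  obtain ⟨a, ha⟩ := hg.exists_smul le_rfl (resM L le_top s)
  rw [resM_self] at ha
  have h3 := congr(pullSec i L $ha)
  have h4 := congr(pullSec j L $ha)
  rw [pullSec_resM, pullSec_smul] at h3 h4
  rw [hs, resM_zero] at h4
  have h5 : j.app U a = 0 :=
    (hg.pullSec j U).smul_eq_zero le_rfl (by rw [resM_self]; exact h4.symm)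
  refine vanishes_of_eq (U := i ⁻¹ᵁ U) (show i z₁ ∈ U from h₁ ▸ hpU) h3 fun h => ?_
  rw [← Scheme.preimage_basicOpen] at h
  have h6 : i z₁ ∈ X.basicOpen a := h
  rw [h₁, ← h₂] at h6
  exact (app_eq_zero_iff j a).1 h5 _ h6

/-- A section that vanishes at the intersection point is extended by zero. -/
lemma exists_extension_by_zero (hij : Set.range i ∪ Set.range j = Set.univ) (hL : IsLineBundle L)
    {z₁ : Z₁} {z₂ : Z₂} {p : X} (h₁ : i z₁ = p) (h₂ : j z₂ = p)
    (hp : Set.range i ∩ Set.range j = {p})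
    (hm : IsLocalRing.maximalIdeal (X.presheaf.stalk p) ≤
      RingHom.ker (stalkTo i h₁) ⊔ RingHom.ker (stalkTo j h₂))
    {s₁ : Γ(restrictTo i L, ⊤)} (hs : Vanishes _ s₁ z₁) :
    ∃ s : Γ(L, ⊤), pullSec i L s = s₁ ∧ pullSec j L s = 0 := by
  obtain ⟨U, hpU, g, hg⟩ := hL p
  obtain ⟨W, hW, a, hpW, e⟩ := exists_local_expr i hg hpU s₁
  refine exists_section_of_cover i j hij hL h₁ h₂ hp hm s₁ 0 hpW (b := 0) e
    (by rw [map_zero, zero_smul, resM_zero]) ?_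
  rw [sub_zero]
  intro h
  refine hs _ _ ((hg.res hW).pullSec i W) _ (show i z₁ ∈ W from h₁ ▸ hpW) e ?_
  rw [← Scheme.preimage_basicOpen]
  exact (show i z₁ ∈ X.basicOpen a from h₁ ▸ h)

end Glue
end NodalPruning

/-! ### Dimensions of spaces of sections -/

namespace NodalPruning

section Dimension
variable {k : Type u} [Field k] {X : Scheme.{u}} (str : X ⟶ Spec (.of k))

/-- The space of global sections of `M` that vanish at `x`. -/
def vanishing {M : X.Modules} (hM : IsLineBundle M) (x : X) :
    letI := globalSectionsModule str M
    Submodule k Γ(M, ⊤) :=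
  letI := globalSectionsModule str M
  { carrier := {s | Vanishes M s x}
    add_mem' := fun hs ht => hs.add hM ht
    zero_mem' := Vanishes.zero hM x
    smul_mem' := fun c _ hs => hs.smul hM (scalar str c) }

/-- The dimension of the space of global sections of `M` that vanish at `x`. -/
def h0Vanishing {M : X.Modules} (hM : IsLineBundle M) (x : X) : Cardinal.{u} :=
  letI := globalSectionsModule str M
  Module.rank k (vanishing str hM x)

/-- The sections vanishing at a closed point form a hyperplane, unless all sections vanish there. -/
lemma h0_eq_h0Vanishing_add_one [IsAlgClosed k] [LocallyOfFiniteType str] {M : X.Modules}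
    (hM : IsLineBundle M) {x : X} (hx : IsClosed ({x} : Set X)) {σ : Γ(M, ⊤)}
    (hσ : ¬ Vanishes M σ x) : h0 str M = h0Vanishing str hM x + 1 := by
  let _ := globalSectionsModule str M
  obtain ⟨U, hxU, g, hg⟩ := hM x
  obtain ⟨a, ha⟩ := hg.exists_smul le_rfl (resM M le_top σ)
  rw [resM_self] at ha
  have hax : x ∈ X.basicOpen a := by
    by_contra h
    exact hσ (vanishes_of_eq hxU ha h)
  -- the sections vanishing at `x` and the multiples of `σ` are complementary
  let φ : (vanishing str hM x × k) →ₗ[k] Γ(M, ⊤) :=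
    LinearMap.coprod (vanishing str hM x).subtype (LinearMap.toSpanSingleton k _ σ)
  have hφ : ∀ s c, φ (s, c) = s + c • σ := fun s c => by simp [φ]
  have hinj : Function.Injective φ := by
    rw [← LinearMap.ker_eq_bot, LinearMap.ker_eq_bot']
    rintro ⟨s, c⟩ h
    rw [hφ] at h
    have hc : c = 0 := by
      by_contra hc
      have h1 : σ = c⁻¹ • -(s : Γ(M, ⊤)) := by
        rw [← eq_neg_of_add_eq_zero_right h, smul_smul, inv_mul_cancel₀ hc, one_smul]
      exact hσ (h1 ▸ (vanishing str hM x).smul_mem c⁻¹ ((vanishing str hM x).neg_mem s.2))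
    subst hc
    rw [zero_smul, add_zero] at h
    exact Prod.ext (Subtype.ext h) rfl
  have hsurj : Function.Surjective φ := by
    intro s
    obtain ⟨b, hb⟩ := hg.exists_smul le_rfl (resM M le_top s)
    rw [resM_self] at hb
    obtain ⟨c, hc⟩ := exists_scalar_mul_sub str hx hxU hax b
    have hv : Vanishes M (c • σ - s) x := by
      refine vanishes_of_eq (g := g) hxU ?_ hc
      rw [resM_sub, hb, sub_smul, mul_smul, ← ha]
      exact congrArg (· - b • g) (resM_smul M le_top (scalar str c) σ)
    refine ⟨(-⟨_, hv⟩, c), ?_⟩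
    rw [hφ]
    change -(c • σ - s) + c • σ = s
    abel
  have h1 := (LinearEquiv.ofBijective φ ⟨hinj, hsurj⟩).rank_eq
  rw [rank_prod', Module.rank_self] at h1
  exact h1.symm

variable {Z : Scheme.{u}}

/-- The restriction of global sections, as a linear map. -/
def pullLin (f : Z ⟶ X) (L : X.Modules) :
    letI := globalSectionsModule str L
    letI := globalSectionsModule (f ≫ str) (restrictTo f L)
    Γ(L, ⊤) →ₗ[k] Γ(restrictTo f L, ⊤) :=
  letI := globalSectionsModule str L
  letI := globalSectionsModule (f ≫ str) (restrictTo f L)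
  { toFun := fun s => pullSec f L s
    map_add' := pullSec_add f L
    map_smul' := fun c s => by
      refine (pullSec_smul f L (scalar str c) s).trans ?_
      rw [← scalar_comp]
      rfl }

end Dimension

section Cover
variable {k : Type u} [Field k] {X Z₁ Z₂ : Scheme.{u}} (str : X ⟶ Spec (.of k))
  (i : Z₁ ⟶ X) (j : Z₂ ⟶ X) [IsClosedImmersion i]
  [IsClosedImmersion j] [IsReduced X] [IsReduced Z₁] [IsReduced Z₂] {L : X.Modules}

/-- If there are no sections on `Z₁`, the sections on `X` are those on `Z₂` that vanish at the
intersection point. -/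
theorem h0_eq_h0Vanishing (hij : Set.range i ∪ Set.range j = Set.univ) (hL : IsLineBundle L)
    {z₁ : Z₁} {z₂ : Z₂} {p : X} (h₁ : i z₁ = p) (h₂ : j z₂ = p)
    (hp : Set.range i ∩ Set.range j = {p})
    (hm : IsLocalRing.maximalIdeal (X.presheaf.stalk p) ≤
      RingHom.ker (stalkTo i h₁) ⊔ RingHom.ker (stalkTo j h₂))
    (h0i : h0 (i ≫ str) (restrictTo i L) = 0) :
    h0 str L = h0Vanishing (j ≫ str) (hL.pullback j) z₂ := by
  let _ := globalSectionsModule str L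
  let _ := globalSectionsModule (i ≫ str) (restrictTo i L)
  let _ := globalSectionsModule (j ≫ str) (restrictTo j L)
  have h0i' : ∀ s : Γ(restrictTo i L, ⊤), s = 0 :=
    rank_zero_iff_forall_zero.1 (show Module.rank k Γ(restrictTo i L, ⊤) = 0 from h0i)
  have hinj : Function.Injective (pullLin str j L) := by
    rw [← LinearMap.ker_eq_bot, LinearMap.ker_eq_bot']
    exact fun s hs => eq_zero_of_pullSec i j hij hL (h0i' _) hs
  have hrange : LinearMap.range (pullLin str j L) = vanishing (j ≫ str) (hL.pullback j) z₂ := by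
    ext s
    constructor
    · rintro ⟨s, rfl⟩
      exact vanishes_pullSec j i hL h₂ h₁ (h0i' _)
    · intro hs
      obtain ⟨t, ht, -⟩ := exists_extension_by_zero j i (by rwa [Set.union_comm]) hL h₂ h₁
        (by rwa [Set.inter_comm]) (by rwa [sup_comm]) hs
      exact ⟨t, ht⟩
  have h1 := rank_range_of_injective _ hinj
  rw [hrange] at h1
  exact h1.symm

/-- If some section on `Z₁` does not vanish at the intersection point, the sections on `X`
map onto the sections on `Z₂`, and the kernel consists of the sections on `Z₁` vanishing
there. -/
theorem h0_eq_add_h0Vanishing [IsAlgClosed k] [LocallyOfFiniteType str]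
    (hij : Set.range i ∪ Set.range j = Set.univ) (hL : IsLineBundle L)
    {z₁ : Z₁} {z₂ : Z₂} {p : X} (h₁ : i z₁ = p) (h₂ : j z₂ = p)
    (hpc : IsClosed ({p} : Set X)) (hp : Set.range i ∩ Set.range j = {p})
    (hm : IsLocalRing.maximalIdeal (X.presheaf.stalk p) ≤
      RingHom.ker (stalkTo i h₁) ⊔ RingHom.ker (stalkTo j h₂))
    {σ : Γ(restrictTo i L, ⊤)} (hσ : ¬ Vanishes _ σ z₁) :
    h0 str L = h0 (j ≫ str) (restrictTo j L) +
      h0Vanishing (i ≫ str) (hL.pullback i) z₁ := by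
  let _ := globalSectionsModule str L
  let _ := globalSectionsModule (i ≫ str) (restrictTo i L)
  let _ := globalSectionsModule (j ≫ str) (restrictTo j L)
  -- a suitable multiple of `σ` has the same value at `p` as the given section `s₂`
  have hsurj : Function.Surjective (pullLin str j L) := by
    intro s₂
    obtain ⟨U, hpU, g, hg⟩ := hL p
    obtain ⟨W, hW, a, hpW, e⟩ := exists_local_expr i hg hpU σ
    obtain ⟨V, hV, b, hpV, e'⟩ := exists_local_expr j (hg.res hW) hpW s₂
    have ha : p ∈ X.basicOpen (resO hV a) := by
      rw [basicOpen_resO]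
      refine ⟨hpV, ?_⟩
      by_contra h
      refine hσ (vanishes_of_eq (U := i ⁻¹ᵁ W) (show i z₁ ∈ W from h₁ ▸ hpW) e ?_)
      rw [← Scheme.preimage_basicOpen]
      exact fun h' => h (h₁ ▸ (show i z₁ ∈ X.basicOpen a from h'))
    obtain ⟨c, hc⟩ := exists_scalar_mul_sub str hpc hpV ha b
    have h3 := congr(resM _ (i.preimage_mono hV) $e)
    rw [resM_resM, resM_smul, ← app_resO i hV, ← pullSec_resM i L hV] at h3
    have h4 : resM _ le_top (c • σ) = i.app V (resO le_top (scalar str c) * resO hV a) •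
        pullSec i L (resM L hV (resM L hW g)) := by
      refine (resM_smul _ le_top (scalar (i ≫ str) c) σ).trans ?_
      have h5 : resO le_top (scalar (i ≫ str) c) = i.app V (resO le_top (scalar str c)) := by
        rw [scalar_comp]; exact (app_resO i le_top _).symm
      rw [h3, map_mul, mul_smul, h5]
    obtain ⟨s, -, hs⟩ := exists_section_of_cover i j hij hL h₁ h₂ hp hm (c • σ) s₂ hpV h4 e' hc
    exact ⟨s, hs⟩
  have h1 := LinearMap.rank_eq_of_surjective hsurj
  let φ := (pullLin str i L).comp (LinearMap.ker (pullLin str j L)).subtype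
  have hinj : Function.Injective φ := by
    rw [← LinearMap.ker_eq_bot, LinearMap.ker_eq_bot']
    exact fun s hs => Subtype.ext (eq_zero_of_pullSec i j hij hL hs s.2)
  have hrange : LinearMap.range φ = vanishing (i ≫ str) (hL.pullback i) z₁ := by
    ext s
    constructor
    · rintro ⟨s, rfl⟩
      exact vanishes_pullSec i j hL h₁ h₂ s.2
    · intro hs
      obtain ⟨t, ht, ht'⟩ := exists_extension_by_zero i j hij hL h₁ h₂ hp hm hs
      exact ⟨⟨t, ht'⟩, ht⟩
  have h2 := rank_range_of_injective _ hinj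
  rw [hrange] at h2
  exact h1.trans (congrArg (_ + ·) h2.symm)

end Cover

section Twist
variable {k : Type u} [Field k] {X : Scheme.{u}} (str : X ⟶ Spec (.of k)) {M : X.Modules}

variable (M) in
/-- The multiplication map on global sections, as a linear map. -/
def mulIdealLin (A : Set X) :
    letI := globalSectionsModule str (tensor M (idealSheaf X A))
    letI := globalSectionsModule str M
    Γ(tensor M (idealSheaf X A), ⊤) →ₗ[k] Γ(M, ⊤) :=
  letI := globalSectionsModule str (tensor M (idealSheaf X A))
  letI := globalSectionsModule str M
  { toFun := fun s => (mulIdeal M A).app ⊤ s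
    map_add' := map_add ((mulIdeal M A).app ⊤).hom
    map_smul' := fun c s => Scheme.Modules.Hom.app_smul (mulIdeal M A) (scalar str c) s }

/-- The function by which a local generator of the ideal sheaf acts is not a zero divisor. -/
lemma eq_zero_of_mul_ideal {A : Set X} {U : X.Opens} {u : Γ(idealSheaf X A, U)}
    (hu : IsGenerator _ u) {f : Γ(X, U)} (hf : (idealIncl X A).app U u = secO f)
    {W : X.Opens} (h : W ≤ U) {a : Γ(X, W)} (ha : a * resO h f = 0) : a = 0 := by
  refine hu.smul_eq_zero h (idealIncl_injective X A W ?_)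
  rw [Scheme.Modules.Hom.app_smul, app_resM, hf, resM_secO, smul_secO, ha]
  exact (map_zero ((idealIncl X A).app W).hom).symm

/-- The multiplication map identifies the global sections of `M ⊗ 𝒪(-x)` with the global sections
of `M` that vanish at `x`. -/
theorem h0_tensor_idealSheaf (hM : IsLineBundle M) {x : X} (hx : IsClosed ({x} : Set X))
    (hI : IsLineBundle (idealSheaf X {x})) :
    h0 str (tensor M (idealSheaf X {x})) = h0Vanishing str hM x := by
  let _ := globalSectionsModule str (tensor M (idealSheaf X {x}))
  let _ := globalSectionsModule str M
  have hcl : closure ({x} : Set X) = {x} := hx.closure_eq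
  have hloc : ∀ y : X, ∃ (U : X.Opens) (_ : y ∈ U) (g : Γ(M, U)) (u : Γ(idealSheaf X {x}, U))
      (f : Γ(X, U)), IsGenerator M g ∧ IsGenerator _ u ∧ (idealIncl X {x}).app U u = secO f := by
    intro y
    obtain ⟨U, hyU, g, hg⟩ := hM y
    obtain ⟨V, hyV, u, hu⟩ := hI y
    obtain ⟨f, hf⟩ := (secO_bijective (U ⊓ V)).2 ((idealIncl X {x}).app _ (resM _ inf_le_right u))
    exact ⟨U ⊓ V, ⟨hyU, hyV⟩, _, _, f, hg.res inf_le_left, hu.res inf_le_right, hf.symm⟩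
  have happ : ∀ {U W : X.Opens} (h : W ≤ U) {g : Γ(M, U)} {u : Γ(idealSheaf X {x}, U)}
      {f : Γ(X, U)} (_ : (idealIncl X {x}).app U u = secO f) (a : Γ(X, W)),
      (mulIdeal M {x}).app W (a • resM _ h (ofTensor _ _ U (g ⊗ₜ[Γ(X, U)] u))) =
        (a * resO h f) • resM M h g := by
    intro U W h g u f hf a
    rw [Scheme.Modules.Hom.app_smul, app_resM, mulIdeal_tmul M {x} g u hf, resM_smul, mul_smul]
  have hinj : ∀ (V : X.Opens) (s t : Γ(tensor M (idealSheaf X {x}), V)),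
      (mulIdeal M {x}).app V s = (mulIdeal M {x}).app V t → s = t := by
    intro V s t hst
    refine eq_of_locally _ fun y hy => ?_
    obtain ⟨U, hyU, g, u, f, hg, hu, hf⟩ := hloc y
    obtain ⟨a, ha⟩ := (hg.tmul hu).exists_smul (inf_le_right : V ⊓ U ≤ U) (resM _ inf_le_left s)
    obtain ⟨b, hb⟩ := (hg.tmul hu).exists_smul (inf_le_right : V ⊓ U ≤ U) (resM _ inf_le_left t)
    refine ⟨V ⊓ U, inf_le_left, ⟨hy, hyU⟩, ?_⟩
    have h1 := congr(resM M (inf_le_left : V ⊓ U ≤ V) $hst)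
    rw [← app_resM, ← app_resM, ha, hb, happ _ hf, happ _ hf] at h1
    have h2 := hg.smul_inj inf_le_right h1
    rw [← sub_eq_zero, ← sub_mul] at h2
    rw [ha, hb, sub_eq_zero.1 (eq_zero_of_mul_ideal hu hf inf_le_right h2)]
  have hrange : LinearMap.range (mulIdealLin str M {x}) = vanishing str hM x := by
    ext s
    constructor
    · rintro ⟨s, rfl⟩
      obtain ⟨U, hyU, g, u, f, hg, hu, hf⟩ := hloc x
      obtain ⟨a, ha⟩ := (hg.tmul hu).exists_smul le_rfl (resM _ le_top s)
      refine vanishes_of_eq (g := resM M le_rfl g) (a := a * resO le_rfl f) hyU ?_ ?_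
      · rw [← happ _ hf, ← ha, app_resM]
        rfl
      · intro h
        rw [Scheme.basicOpen_mul, resO_self] at h
        exact (app_reducedSubι_eq_zero_iff f).1 ((mem_range_idealIncl X {x} U f).1 ⟨u, hf⟩) x
          (subset_closure rfl) h.2
    · intro hs
      obtain ⟨t, ht⟩ := exists_glue (tensor M (idealSheaf X {x})) (U := ⊤)
        (fun W t => (mulIdeal M {x}).app W t = resM M le_top s)
        (fun W W' h t ht => by rw [app_resM, ht, resM_resM])
        (fun W _ t t' ht ht' => hinj W _ _ (ht.trans ht'.symm))
        (fun y _ => by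
          obtain ⟨U, hyU, g, u, f, hg, hu, hf⟩ := hloc y
          obtain ⟨a, ha⟩ := hg.exists_smul le_rfl (resM M le_top s)
          rw [resM_self] at ha
          have hax : ∀ z ∈ closure ({x} : Set X), z ∉ X.basicOpen a := by
            intro z hz h
            rw [hcl] at hz
            obtain rfl : z = x := hz
            exact hs U g hg a (X.basicOpen_le _ h) ha h
          obtain ⟨t, ht⟩ := (mem_range_idealIncl X {x} U a).2
            ((app_reducedSubι_eq_zero_iff a).2 hax)
          refine ⟨U, hyU, le_top, ofTensor _ _ U (g ⊗ₜ[Γ(X, U)] t), ?_⟩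
          rw [mulIdeal_tmul M {x} g t ht, ha])
      refine ⟨t, eq_of_locally M fun y _ => ?_⟩
      obtain ⟨W, hW, hyW, e⟩ := ht y trivial
      refine ⟨W, le_top, hyW, ?_⟩
      rw [app_resM] at e
      exact e
  have h1 := rank_range_of_injective (mulIdealLin str M {x}) fun s t hst => hinj ⊤ s t hst
  rw [hrange] at h1
  exact h1.symm

end Twist
end NodalPruning

/-! ### Pruning a leaf -/

namespace NodalPruning

section Geometry
variable {k : Type u} [Field k] {X : Scheme.{u}} (str : X ⟶ Spec (.of k))

include str in
lemma isLocallyNoetherian_of_field [LocallyOfFiniteType str] : IsLocallyNoetherian X :=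
  LocallyOfFiniteType.isLocallyNoetherian str

include str in
lemma noetherianSpace_of_isProper [IsProper str] : NoetherianSpace X := by
  have := isLocallyNoetherian_of_field str
  have : CompactSpace X := by
    have h := QuasiCompact.isCompact_preimage (f := str) Set.univ isOpen_univ isCompact_univ
    rw [Set.preimage_univ] at h
    exact ⟨h⟩
  have : IsNoetherian X := {}
  infer_instance

/-- An irreducible closed set with its reduced structure is integral. -/
lemma isIntegral_reducedSub {T : Set X} (hT : IsIrreducible T) : IsIntegral (reducedSub X T) := by
  have hr := range_reducedSubι X T
  have hT' : IsIrreducible (closure T) := hT.closure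
  have : IrreducibleSpace (reducedSub X T) := by
    rw [← hr] at hT'
    have := Subtype.irreducibleSpace hT'
    exact (reducedSubι X T).isClosedEmbedding.isEmbedding.toHomeomorph.irreducibleSpace_iff.2 this
  exact isIntegral_of_irreducibleSpace_of_isReduced _

variable {Z₁ Z₂ : Scheme.{u}} (i : Z₁ ⟶ X) (j : Z₂ ⟶ X) [IsClosedImmersion i]
  [IsClosedImmersion j] [IsReduced X] [IsReduced Z₁] [IsReduced Z₂] [IsLocallyNoetherian X]

/-- If a node is a smooth point of one of two closed subschemes that cover the curve, it is a
smooth point of the other, and the two subschemes meet transversally. -/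
lemma smooth_and_transversal_of_isNode (hij : Set.range i ∪ Set.range j = Set.univ)
    {z₁ : Z₁} {z₂ : Z₂} {p : X} (h₁ : i z₁ = p) (h₂ : j z₂ = p) (hp : IsNode k p)
    (hs : IsSmoothPoint z₁) (hj : Set.range j ∉ nhds p) :
    IsSmoothPoint z₂ ∧ IsLocalRing.maximalIdeal (X.presheaf.stalk p) ≤
      RingHom.ker (stalkTo i h₁) ⊔ RingHom.ker (stalkTo j h₂) := by
  obtain ⟨_, _⟩ := hs
  obtain ⟨e⟩ := hp
  have hne : ∃ b, b ≠ 0 ∧ stalkTo j h₂ b = 0 := by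
    by_contra! h
    exact hj (range_mem_nhds j h₂ fun r hr => by_contra fun hr0 => h r hr0 hr)
  exact branch_of_isFormalNode (isFormalNode_nodeRing k) e (stalkTo i h₁) (stalkTo_surjective i h₁)
    (stalkTo j h₂) (stalkTo_surjective j h₂) (stalkTo_cover_inj i j hij h₁ h₂) hne

omit [IsReduced Z₁] [IsReduced Z₂] [IsLocallyNoetherian X] in
/-- A closed subscheme of a nodal curve is nodal if the only point at which it is not locally the
whole curve is a smooth point of it. -/
lemma isNodalCurve_of_smooth [IsReduced Z₂] (hX : IsNodalCurve str) {z₂ : Z₂} {p : X}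
    (h₂ : j z₂ = p)
    (hs : IsSmoothPoint z₂) (hj : ∀ x ∈ Set.range j, x ≠ p → Set.range j ∈ nhds x) :
    IsNodalCurve (j ≫ str) := by
  have := hX.isProper
  refine ⟨inferInstance, inferInstance, fun z hz => ?_⟩
  by_cases hzp : j z = p
  · obtain rfl : z = z₂ := j.isClosedEmbedding.injective (hzp.trans h₂.symm)
    exact Or.inl hs
  · have hb := stalkTo_bijective_of_mem_nhds j rfl (hj (j z) ⟨z, rfl⟩ hzp)
    let e := RingEquiv.ofBijective _ hb
    have hc : IsClosed ({j z} : Set X) := by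
      rw [← Set.image_singleton]
      exact j.isClosedEmbedding.isClosedMap _ hz
    exact (hX.smooth_or_node _ hc).imp (isSmoothPoint_of_ringEquiv e) (isNode_of_ringEquiv e)

end Geometry

namespace Pair
variable {k : Type u} [Field k] {P : Pair k} {T U : Set P.C} {p : P.C}

lemma IsLeaf.range_left (leaf : P.IsLeaf T U p) : Set.range (reducedSubι P.C T) = T := by
  rw [range_reducedSubι, (isClosed_of_mem_irreducibleComponents T leaf.left_mem).closure_eq]

lemma range_removedι (hP : P.IsNodalPair) (hT : T ∈ irreducibleComponents P.C) :
    Set.range (P.removedι T) = ⋃₀ (irreducibleComponents P.C \ {T}) := by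
  have := hP.1.isProper
  have := noetherianSpace_of_isProper P.str
  rw [range_reducedSubι, closure_compl_component hT]

lemma IsLeaf.cover (leaf : P.IsLeaf T U p) (hP : P.IsNodalPair) :
    Set.range (reducedSubι P.C T) ∪ Set.range (P.removedι T) = Set.univ := by
  rw [leaf.range_left, range_removedι hP leaf.left_mem]
  have := sUnion_union_eq_univ (𝒮 := {T})
  rwa [Set.sUnion_singleton] at this

lemma IsLeaf.inter (leaf : P.IsLeaf T U p) (hP : P.IsNodalPair) :
    Set.range (reducedSubι P.C T) ∩ Set.range (P.removedι T) = {p} := by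
  rw [leaf.range_left, range_removedι hP leaf.left_mem, leaf.inter_eq]

lemma IsLeaf.isClosed_singleton (leaf : P.IsLeaf T U p) (hP : P.IsNodalPair) :
    IsClosed ({p} : Set P.C) := by
  rw [← leaf.inter hP]
  exact (reducedSubι P.C T).isClosedEmbedding.isClosed_range.inter
    (P.removedι T).isClosedEmbedding.isClosed_range

lemma IsLeaf.right_not_mem_nhds (leaf : P.IsLeaf T U p) (hP : P.IsNodalPair) :
    Set.range (P.removedι T) ∉ nhds p := by
  have := hP.1.isProper
  have := noetherianSpace_of_isProper P.str
  intro h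
  have hpT : p ∈ T := (leaf.inter_eq.ge rfl).1
  have h1 := subset_of_mem_nhds leaf.left_mem.1.2
    (P.removedι T).isClosedEmbedding.isClosed_range hpT h
  rw [range_removedι hP leaf.left_mem] at h1
  exact not_subset_sUnion (𝒮 := irreducibleComponents P.C \ {T}) Set.sdiff_subset leaf.left_mem
    (fun h => h.2 rfl) h1

lemma IsLeaf.left_not_mem_nhds (leaf : P.IsLeaf T U p) : T ∉ nhds p := fun h =>
  leaf.ne (eq_of_subset_component leaf.right_mem leaf.left_mem (subset_of_mem_nhds
    leaf.right_mem.1.2 (isClosed_of_mem_irreducibleComponents T leaf.left_mem) leaf.mem h))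

/-- The attaching point is a node: at a smooth point the local ring is a domain, so that one of `T`
and `C ∖ T` would be the whole curve near the point. -/
lemma IsLeaf.isNode (leaf : P.IsLeaf T U p) (hP : P.IsNodalPair) : IsNode k p := by
  have := hP.1.isProper
  have := hP.1.isReduced
  have := isLocallyNoetherian_of_field P.str
  refine (hP.1.smooth_or_node p (leaf.isClosed_singleton hP)).resolve_left ?_
  rintro ⟨_, -⟩
  obtain ⟨⟨t, ht⟩, ⟨q, hq⟩⟩ := (leaf.inter hP).ge rfl
  rcases mem_nhds_or_mem_nhds (reducedSubι P.C T) (P.removedι T) (leaf.cover hP) ht hq with h | h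
  · rw [leaf.range_left] at h
    exact leaf.left_not_mem_nhds h
  · exact leaf.right_not_mem_nhds hP h

lemma IsLeaf.nonempty_lineCharts (leaf : P.IsLeaf T U p) :
    Nonempty (LineCharts (reducedSubι P.C T ≫ P.str)) := by
  obtain ⟨e, he⟩ := leaf.isRational
  exact ⟨(projectiveLineCharts k).ofIso e he⟩

lemma IsLeaf.ne_genericPoint (leaf : P.IsLeaf T U p) (hP : P.IsNodalPair)
    [IsIntegral (reducedSub P.C T)] {t : reducedSub P.C T} (ht : reducedSubι P.C T t = p) :
    t ≠ genericPoint (reducedSub P.C T) := by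
  rintro rfl
  have h1 : T ⊆ {p} := by
    intro x hx
    rw [← leaf.range_left] at hx
    obtain ⟨z, rfl⟩ := hx
    have h2 := (genericPoint_specializes z).map (reducedSubι P.C T).continuous
    rw [ht] at h2
    exact (leaf.isClosed_singleton hP).closure_eq ▸ h2.mem_closure
  exact leaf.ne (eq_of_subset_component leaf.left_mem leaf.right_mem
    (h1.trans (Set.singleton_subset_iff.2 leaf.mem))).symm

variable [IsAlgClosed k]

/-- The geometry of a leaf: `T` and `C ∖ T` both pass through the attaching point, `C ∖ T` is smooth
there, and the two curves meet transversally. -/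
lemma IsLeaf.exists_points (leaf : P.IsLeaf T U p) (hP : P.IsNodalPair) :
    ∃ (t : reducedSub P.C T) (q : P.removed T) (ht : reducedSubι P.C T t = p)
      (hq : P.removedι T q = p), IsSmoothPoint q ∧
      IsLocalRing.maximalIdeal (P.C.presheaf.stalk p) ≤
        RingHom.ker (stalkTo (reducedSubι P.C T) ht) ⊔ RingHom.ker (stalkTo (P.removedι T) hq) := by
  have := hP.1.isProper
  have := hP.1.isReduced
  have := isLocallyNoetherian_of_field P.str
  have := isIntegral_reducedSub leaf.left_mem.1
  obtain ⟨⟨t, ht⟩, ⟨q, hq⟩⟩ := (leaf.inter hP).ge rfl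
  obtain ⟨𝒞⟩ := leaf.nonempty_lineCharts
  exact ⟨t, q, ht, hq, smooth_and_transversal_of_isNode (reducedSubι P.C T) (P.removedι T)
    (leaf.cover hP) ht hq (leaf.isNode hP) (𝒞.isSmoothPoint (leaf.ne_genericPoint hP ht))
    (leaf.right_not_mem_nhds hP)⟩

lemma IsLeaf.isNodalCurve_removed (leaf : P.IsLeaf T U p) (hP : P.IsNodalPair) :
    IsNodalCurve (P.removedι T ≫ P.str) := by
  have := hP.1.isReduced
  obtain ⟨t, q, ht, hq, hs, -⟩ := leaf.exists_points hP
  refine isNodalCurve_of_smooth P.str (P.removedι T) hP.1 hq hs fun x hx hxp => ?_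
  have hT : IsClosed T := isClosed_of_mem_irreducibleComponents T leaf.left_mem
  have hxT : x ∉ T := fun h => hxp ((leaf.inter hP).le ⟨leaf.range_left.symm ▸ h, hx⟩)
  filter_upwards [hT.isOpen_compl.mem_nhds hxT] with y hy
  exact ((leaf.cover hP).ge trivial).resolve_left fun h => hy (leaf.range_left ▸ h)

lemma IsLeaf.isNodalPair_pruneRestrict (leaf : P.IsLeaf T U p) (hP : P.IsNodalPair) :
    (P.pruneRestrict T).IsNodalPair :=
  ⟨leaf.isNodalCurve_removed hP, hP.2.pullback _⟩

omit [IsAlgClosed k] in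
lemma preimage_singleton_removedι {q : P.removed T} (hq : P.removedι T q = p) :
    P.removedι T ⁻¹' {p} = {q} := by
  ext z
  rw [Set.mem_preimage, Set.mem_singleton_iff, Set.mem_singleton_iff, ← hq]
  exact (P.removedι T).isClosedEmbedding.injective.eq_iff

omit [IsAlgClosed k] in
lemma IsLeaf.isClosed_point (leaf : P.IsLeaf T U p) (hP : P.IsNodalPair) {q : P.removed T}
    (hq : P.removedι T q = p) : IsClosed ({q} : Set (P.removed T)) := by
  rw [← preimage_singleton_removedι hq]
  exact (leaf.isClosed_singleton hP).preimage (P.removedι T).continuous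

lemma IsLeaf.isNodalPair_pruneTwist (leaf : P.IsLeaf T U p) (hP : P.IsNodalPair) :
    (P.pruneTwist T p).IsNodalPair := by
  obtain ⟨t, q, ht, hq, hs, -⟩ := leaf.exists_points hP
  have := hP.1.isProper
  have := isLocallyNoetherian_of_field (P.removedι T ≫ P.str)
  have hI := isLineBundle_idealSheaf (leaf.isClosed_point hP hq) hs
  rw [← preimage_singleton_removedι hq] at hI
  exact ⟨leaf.isNodalCurve_removed hP, (hP.2.pullback _).tensor hI⟩

omit [IsAlgClosed k] in
lemma hasDegree_degree {X : Scheme.{u}} {M : X.Modules} (h : ∃ d, HasDegree M d) :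
    HasDegree M (degree M) := by
  rw [degree, dif_pos h]
  exact h.choose_spec

/-- Pruning a leaf of degree `d ≥ 0`: some section on `T` does not vanish at the attaching point, so
every section on `C ∖ T` extends, and the extensions form a torsor under the `d`-dimensional space
of sections on `T` that vanish there. -/
theorem IsLeaf.h0_pruneRestrict (leaf : P.IsLeaf T U p) (hP : P.IsNodalPair)
    (hd : 0 ≤ P.degreeOn T) :
    P.h0 = (P.pruneRestrict T).h0 + ((P.degreeOn T).toNat : Cardinal) := by
  obtain ⟨t, q, ht, hq, hs, hm⟩ := leaf.exists_points hP
  have := hP.1.isProper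
  have := hP.1.isReduced
  have := isIntegral_reducedSub leaf.left_mem.1
  have := isLocallyNoetherian_of_field (reducedSubι P.C T ≫ P.str)
  obtain ⟨𝒞⟩ := leaf.nonempty_lineCharts
  have hM := hP.2.pullback (reducedSubι P.C T)
  have hdeg := hasDegree_degree (𝒞.exists_hasDegree hM)
  obtain ⟨σ, hσ⟩ := 𝒞.exists_section_ne_zero hM hdeg hd (leaf.ne_genericPoint hP ht)
  have hσ' : ¬ Vanishes _ σ t := by
    intro hv
    obtain ⟨V, htV, g, hg⟩ := hM t
    obtain ⟨a, ha⟩ := hg.exists_smul le_rfl (resM _ le_top σ)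
    rw [resM_self] at ha
    exact hv V g hg a htV ha (hσ V g hg a htV ha)
  have h1 := h0_eq_add_h0Vanishing P.str (reducedSubι P.C T) (P.removedι T) (leaf.cover hP) hP.2
    ht hq (leaf.isClosed_singleton hP) (leaf.inter hP) hm hσ'
  have htc : IsClosed ({t} : Set (reducedSub P.C T)) := by
    have : reducedSubι P.C T ⁻¹' {p} = {t} := by
      ext z
      rw [Set.mem_preimage, Set.mem_singleton_iff, Set.mem_singleton_iff, ← ht]
      exact (reducedSubι P.C T).isClosedEmbedding.injective.eq_iff
    rw [← this]
    exact (leaf.isClosed_singleton hP).preimage (reducedSubι P.C T).continuous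
  have h2 := h0_eq_h0Vanishing_add_one (reducedSubι P.C T ≫ P.str) hM htc hσ'
  rw [𝒞.rank_sections hM hdeg] at h2
  have h3 : h0Vanishing (reducedSubι P.C T ≫ P.str) hM t = ((P.degreeOn T).toNat : Cardinal) := by
    have h4 : (degree (restrictTo (reducedSubι P.C T) P.L) + 1).toNat =
        (P.degreeOn T).toNat + 1 := by
      change (P.degreeOn T + 1).toNat = _
      omega
    rw [h4, Nat.cast_add, Nat.cast_one] at h2
    exact (Cardinal.add_one_inj.1 h2).symm
  rw [h3] at h1
  exact h1

/-- Pruning a leaf of negative degree: there are no sections on `T`, so the sections on the curve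
are those on `C ∖ T` that vanish at the attaching point. -/
theorem IsLeaf.h0_pruneTwist (leaf : P.IsLeaf T U p) (hP : P.IsNodalPair)
    (hd : P.degreeOn T < 0) : P.h0 = (P.pruneTwist T p).h0 := by
  obtain ⟨t, q, ht, hq, hs, hm⟩ := leaf.exists_points hP
  have := hP.1.isProper
  have := hP.1.isReduced
  have := isIntegral_reducedSub leaf.left_mem.1
  have := isLocallyNoetherian_of_field (reducedSubι P.C T ≫ P.str)
  have := isLocallyNoetherian_of_field (P.removedι T ≫ P.str)
  obtain ⟨𝒞⟩ := leaf.nonempty_lineCharts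
  have hM := hP.2.pullback (reducedSubι P.C T)
  have h0i := 𝒞.rank_sections hM (hasDegree_degree (𝒞.exists_hasDegree hM))
  rw [show (degree (restrictTo (reducedSubι P.C T) P.L) + 1).toNat = 0 from
    Int.toNat_of_nonpos hd, Nat.cast_zero] at h0i
  have h1 := h0_eq_h0Vanishing P.str (reducedSubι P.C T) (P.removedι T) (leaf.cover hP) hP.2
    ht hq (leaf.inter hP) hm h0i
  have hcl := leaf.isClosed_point hP hq
  have h2 := h0_tensor_idealSheaf (P.removedι T ≫ P.str) (hP.2.pullback (P.removedι T)) hcl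
    (isLineBundle_idealSheaf hcl hs)
  rw [← preimage_singleton_removedι hq] at h2
  exact h1.trans h2.symm

end Pair
end NodalPruning

/-! ### Restriction of a twisted line bundle -/

namespace NodalPruning

section CommonImage
variable {X : Scheme.{u}} {M M' N : X.Modules}

/-- A morphism that sends local generators to sections that are not annihilated by any function is
injective. -/
lemma app_injective_of_generators (φ : M ⟶ N)
    (H : ∀ x : X, ∃ (W : X.Opens) (m : Γ(M, W)), x ∈ W ∧ IsGenerator M m ∧
      ∀ (V : X.Opens) (h : V ≤ W) (a : Γ(X, V)), a • resM N h (φ.app W m) = 0 → a = 0)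
    {U : X.Opens} {s t : Γ(M, U)} (hst : φ.app U s = φ.app U t) : s = t := by
  refine eq_of_locally M fun x hx => ?_
  obtain ⟨W, m, hxW, hm, hinj⟩ := H x
  obtain ⟨a, ha⟩ := hm.exists_smul (inf_le_right : U ⊓ W ≤ W) (resM M inf_le_left s)
  obtain ⟨b, hb⟩ := hm.exists_smul (inf_le_right : U ⊓ W ≤ W) (resM M inf_le_left t)
  refine ⟨U ⊓ W, inf_le_left, ⟨hx, hxW⟩, ?_⟩
  have h1 := congr(resM N (inf_le_left : U ⊓ W ≤ U) $hst)
  rw [← app_resM, ← app_resM, ha, hb, Scheme.Modules.Hom.app_smul, Scheme.Modules.Hom.app_smul,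
    app_resM, ← sub_eq_zero, ← sub_smul] at h1
  rw [ha, hb, sub_eq_zero.1 (hinj _ _ _ h1)]

/-- Two morphisms to `N` that send local generators to the same sections have the same image. -/
lemma exists_app_eq_of_generators (φ : M ⟶ N) (ψ : M' ⟶ N)
    (H : ∀ x : X, ∃ (W : X.Opens) (m : Γ(M, W)) (m' : Γ(M', W)), x ∈ W ∧ IsGenerator M m ∧
      IsGenerator M' m' ∧ φ.app W m = ψ.app W m' ∧
      ∀ (V : X.Opens) (h : V ≤ W) (a : Γ(X, V)), a • resM N h (φ.app W m) = 0 → a = 0)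
    {U : X.Opens} (s : Γ(M, U)) : ∃ t : Γ(M', U), ψ.app U t = φ.app U s := by
  have hinj : ∀ {V : X.Opens} {s t : Γ(M', V)}, ψ.app V s = ψ.app V t → s = t :=
    fun h => app_injective_of_generators ψ (fun x => by
      obtain ⟨W, m, m', hxW, -, hm', e, hi⟩ := H x
      exact ⟨W, m', hxW, hm', e ▸ hi⟩) h
  obtain ⟨t, ht⟩ := exists_glue M' (U := U)
    (fun W t => ∃ t₀, t₀ = φ.app (U ⊓ W) (resM M inf_le_left s) ∧
      ψ.app (U ⊓ W) (resM M' inf_le_right t) = t₀)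
    (fun W W' h t ht => by
      obtain ⟨_, rfl, ht⟩ := ht
      refine ⟨_, rfl, ?_⟩
      have h1 := congr(resM N (inf_le_inf_left U h : U ⊓ W' ≤ U ⊓ W) $ht)
      rw [← app_resM, ← app_resM, resM_resM, resM_resM] at h1
      rw [resM_resM, ← h1])
    (fun W hW t t' ht ht' => by
      obtain ⟨_, rfl, ht⟩ := ht
      obtain ⟨_, rfl, ht'⟩ := ht'
      have h1 := congr(resM M' (le_inf hW le_rfl : W ≤ U ⊓ W) $(hinj (ht.trans ht'.symm)))
      rwa [resM_resM, resM_resM, resM_self, resM_self] at h1)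
    (fun x hx => by
      obtain ⟨W, m, m', hxW, hm, hm', e, hi⟩ := H x
      obtain ⟨a, ha⟩ := hm.exists_smul (inf_le_right : U ⊓ W ≤ W) (resM M inf_le_left s)
      refine ⟨U ⊓ W, ⟨hx, hxW⟩, inf_le_left, a • resM M' inf_le_right m', _, rfl, ?_⟩
      have h1 := congr(φ.app _ (resM M (inf_le_right : U ⊓ (U ⊓ W) ≤ U ⊓ W) $ha))
      rw [resM_resM] at h1
      rw [h1, app_resM, app_resM, Scheme.Modules.Hom.app_smul, Scheme.Modules.Hom.app_smul,
        app_resM, app_resM, e])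
  refine ⟨t, eq_of_locally N fun x hx => ?_⟩
  obtain ⟨W, hW, hxW, _, rfl, e⟩ := ht x hx
  refine ⟨U ⊓ W, inf_le_left, ⟨hx, hxW⟩, ?_⟩
  rw [resM_resM] at e
  rw [← app_resM, ← app_resM, e]

/-- Sheaves of modules that embed in `N` with the same image are isomorphic. -/
lemma nonempty_iso_of_generators (φ : M ⟶ N) (ψ : M' ⟶ N)
    (H : ∀ x : X, ∃ (W : X.Opens) (m : Γ(M, W)) (m' : Γ(M', W)), x ∈ W ∧ IsGenerator M m ∧
      IsGenerator M' m' ∧ φ.app W m = ψ.app W m' ∧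
      ∀ (V : X.Opens) (h : V ≤ W) (a : Γ(X, V)), a • resM N h (φ.app W m) = 0 → a = 0) :
    Nonempty (M ≅ M') := by
  have hφ : ∀ {V : X.Opens} {s t : Γ(M, V)}, φ.app V s = φ.app V t → s = t :=
    fun h => app_injective_of_generators φ (fun x => by
      obtain ⟨W, m, m', hxW, hm, -, e, hi⟩ := H x
      exact ⟨W, m, hxW, hm, hi⟩) h
  have hψ : ∀ {V : X.Opens} {s t : Γ(M', V)}, ψ.app V s = ψ.app V t → s = t :=
    fun h => app_injective_of_generators ψ (fun x => by
      obtain ⟨W, m, m', hxW, -, hm', e, hi⟩ := H x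
      exact ⟨W, m', hxW, hm', e ▸ hi⟩) h
  choose F hF using fun (U : X.Opens) (s : Γ(M, U)) => exists_app_eq_of_generators φ ψ H s
  let f : M ⟶ M' := mkHom F
    (fun U s t => hψ (by
      rw [hF]
      exact (map_add (φ.app U).hom s t).trans
        ((congr_arg₂ (· + ·) (hF U s) (hF U t)).symm.trans (map_add (ψ.app U).hom _ _).symm)))
    (fun U a s => hψ (by
      rw [hF, Scheme.Modules.Hom.app_smul, Scheme.Modules.Hom.app_smul, hF]))
    (fun U W h s => hψ (by rw [hF, app_resM, app_resM, hF]))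
  have : IsIso f := isIso_of_bijective f fun U => by
    constructor
    · intro s t hst
      have h1 : F U s = F U t := hst
      exact hφ (by rw [← hF, ← hF, h1])
    · intro t
      obtain ⟨s, hs⟩ := exists_app_eq_of_generators ψ φ (fun x => by
        obtain ⟨W, m, m', hxW, hm, hm', e, hi⟩ := H x
        exact ⟨W, m', m, hxW, hm', hm, e.symm, e ▸ hi⟩) t
      exact ⟨s, hψ ((hF U s).trans hs)⟩
  exact ⟨asIso f⟩

end CommonImage

section Twist
variable {X Z : Scheme.{u}} (f : Z ⟶ X) {A : X.Modules} {B : Z.Modules}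

/-- The multiplication map on the pullback of a twist. -/
lemma map_mulIdeal_pullSec (e : restrictTo f A ≅ B) {S : Set X} {U : X.Opens} (g : Γ(A, U))
    (u : Γ(idealSheaf X S, U)) {a : Γ(X, U)} (ha : (idealIncl X S).app U u = secO a) :
    ((Scheme.Modules.pullback f).map (mulIdeal A S) ≫ e.hom).app (f ⁻¹ᵁ U)
      (pullSec f _ (ofTensor _ _ U (g ⊗ₜ[Γ(X, U)] u))) =
      f.app U a • e.hom.app (f ⁻¹ᵁ U) (pullSec f A g) := by
  have h1 := pullSec_naturality f (mulIdeal A S) (ofTensor _ _ U (g ⊗ₜ[Γ(X, U)] u))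
  rw [mulIdeal_tmul A S g u ha, pullSec_smul] at h1
  have h2 := congr(e.hom.app (f ⁻¹ᵁ U) $h1)
  rw [Scheme.Modules.Hom.app_smul] at h2
  exact h2.symm

/-- Twisting commutes with restriction to a closed subscheme that is the whole scheme near the
point in question. -/
theorem nonempty_restrict_twist_iso [IsClosedImmersion f] [IsLocallyNoetherian X]
    [IsLocallyNoetherian Z] (hA : IsLineBundle A) (e : restrictTo f A ≅ B) {q : X}
    (hq : IsClosed ({q} : Set X)) (hs : IsSmoothPoint q) {z : Z} (hz : f z = q)
    (hb : Function.Bijective (stalkTo f hz)) :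
    Nonempty (restrictTo f (tensor A (idealSheaf X {q})) ≅ tensor B (idealSheaf Z {z})) := by
  have hfz : ∀ y, f y = q → y = z := fun y hy => f.isClosedEmbedding.injective (hy.trans hz.symm)
  have hzc : IsClosed ({z} : Set Z) := by
    have : f ⁻¹' {q} = {z} := Set.ext fun y => ⟨hfz y, fun h => by rw [h]; exact hz⟩
    rw [← this]
    exact hq.preimage f.continuous
  -- compatible local generators of the two ideal sheaves: a uniformizer at the point, one elsewhere
  have hloc : ∀ y : Z, ∃ (W₁ : X.Opens) (u₁ : Γ(idealSheaf X {q}, W₁)) (a : Γ(X, W₁))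
      (W₂ : Z.Opens) (h : W₂ ≤ f ⁻¹ᵁ W₁) (u₂ : Γ(idealSheaf Z {z}, W₂)), f y ∈ W₁ ∧ y ∈ W₂ ∧
      IsGenerator _ u₁ ∧ IsGenerator _ u₂ ∧ (idealIncl X {q}).app W₁ u₁ = secO a ∧
      (idealIncl Z {z}).app W₂ u₂ = secO (resO h (f.app W₁ a)) := by
    intro y
    by_cases hy : y = z
    · subst hy
      obtain ⟨_, _⟩ := isSmoothPoint_of_ringEquiv (RingEquiv.ofBijective _ hb) hs
      obtain ⟨_, _⟩ := hs
      obtain ⟨U, hqU, a, ha⟩ := exists_irreducible_germ (q := q)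
      obtain ⟨W₁, h₁, u₁, hqW, hu₁, e₁⟩ := exists_ideal_generator_of_irreducible hq hqU a ha
      have hqW' : f y ∈ W₁ := hz ▸ hqW
      have ha' : Irreducible (Z.presheaf.germ (f ⁻¹ᵁ W₁) y hqW' (f.app W₁ (resO h₁ a))) := by
        rw [← stalkTo_germ f hz hqW, germ_resO]
        exact (MulEquiv.irreducible_iff (RingEquiv.ofBijective _ hb)).2 ha
      obtain ⟨W₂, h₂, u₂, hyW, hu₂, e₂⟩ := exists_ideal_generator_of_irreducible hzc hqW' _ ha'
      exact ⟨W₁, u₁, _, W₂, h₂, u₂, hqW', hyW, hu₁, hu₂, e₁, e₂⟩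
    · obtain ⟨u₁, hu₁, e₁⟩ := exists_ideal_generator_of_disjoint (A := {q})
        (W := ⟨{q}ᶜ, hq.isOpen_compl⟩) (fun x hx h => h (hq.closure_eq ▸ hx))
      obtain ⟨u₂, hu₂, e₂⟩ := exists_ideal_generator_of_disjoint (A := {z})
        (W := ⟨{z}ᶜ, hzc.isOpen_compl⟩) (fun x hx h => h (hzc.closure_eq ▸ hx))
      refine ⟨⟨{q}ᶜ, hq.isOpen_compl⟩, u₁, 1, ⟨{z}ᶜ, hzc.isOpen_compl⟩,
        fun (x : Z) (hx : x ≠ z) (h : f x = q) => hx (hfz x h), u₂,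
        fun h => hy (hfz y h), hy, hu₁, hu₂, e₁,
        ?_⟩
      rw [e₂, map_one]
      exact congrArg secO (resO_one _).symm
  refine nonempty_iso_of_generators
    ((Scheme.Modules.pullback f).map (mulIdeal A {q}) ≫ e.hom) (mulIdeal B {z}) fun y => ?_
  obtain ⟨W₁, u₁, a, W₂, h, u₂, hyW₁, hyW₂, hu₁, hu₂, e₁, e₂⟩ := hloc y
  obtain ⟨V, hyV, g, hg⟩ := hA (f y)
  have hle : W₁ ⊓ V ≤ W₁ := inf_le_left
  have e₁' : (idealIncl X {q}).app (W₁ ⊓ V) (resM _ hle u₁) = secO (resO hle a) := by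
    rw [app_resM, e₁, resM_secO]
  let g' : Γ(A, W₁ ⊓ V) := resM A inf_le_right g
  have hg' : IsGenerator A g' := hg.res inf_le_right
  let W : Z.Opens := W₂ ⊓ f ⁻¹ᵁ (W₁ ⊓ V)
  have hW : W ≤ f ⁻¹ᵁ (W₁ ⊓ V) := inf_le_right
  have hW' : W ≤ W₂ := inf_le_left
  let γ : Γ(B, f ⁻¹ᵁ (W₁ ⊓ V)) := e.hom.app (f ⁻¹ᵁ (W₁ ⊓ V)) (pullSec f A g')
  have hγ : IsGenerator B γ := (hg'.pullSec f _).map_iso e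
  have hm := map_mulIdeal_pullSec f e g' (resM _ hle u₁) e₁'
  have e₂' : (idealIncl Z {z}).app W (resM _ hW' u₂) =
      secO (resO hW (f.app (W₁ ⊓ V) (resO hle a))) := by
    rw [app_resM, e₂, resM_secO, resO_resO, app_resO f hle, resO_resO]
  refine ⟨W, resM _ hW (pullSec f _ (ofTensor _ _ _ (g' ⊗ₜ[Γ(X, W₁ ⊓ V)] resM _ hle u₁))),
    ofTensor _ _ W (resM B hW γ ⊗ₜ[Γ(Z, W)] resM _ hW' u₂), ⟨hyW₂, hyW₁, hyV⟩,
    ((hg'.tmul (hu₁.res hle)).pullSec f _).res hW, (hγ.res hW).tmul (hu₂.res hW'), ?_, ?_⟩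
  · rw [app_resM, hm, mulIdeal_tmul B {z} _ _ e₂', resM_smul]
  · intro V' hV' b hb0
    rw [app_resM, hm, resM_smul, resM_smul, resM_resM, ← mul_smul] at hb0
    exact eq_zero_of_mul_ideal (hu₂.res hW') e₂' hV' (hγ.smul_eq_zero _ hb0)

/-- Twisting does nothing away from the point in question. -/
theorem nonempty_restrict_twist_iso_of_not_mem (hA : IsLineBundle A) (e : restrictTo f A ≅ B)
    {q : X} (hq : IsClosed ({q} : Set X)) (hqf : q ∉ Set.range f) :
    Nonempty (restrictTo f (tensor A (idealSheaf X {q})) ≅ B) := by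
  obtain ⟨u, hu, e₁⟩ := exists_ideal_generator_of_disjoint (A := {q})
    (W := ⟨{q}ᶜ, hq.isOpen_compl⟩) (fun x hx h => h (hq.closure_eq ▸ hx))
  refine nonempty_iso_of_generators
    ((Scheme.Modules.pullback f).map (mulIdeal A {q}) ≫ e.hom) (𝟙 B) fun y => ?_
  obtain ⟨V, hyV, g, hg⟩ := hA (f y)
  let W : X.Opens := ⟨{q}ᶜ, hq.isOpen_compl⟩ ⊓ V
  have hyW : f y ∈ W := ⟨fun h => hqf ⟨y, h⟩, hyV⟩
  have hle : W ≤ ⟨{q}ᶜ, hq.isOpen_compl⟩ := inf_le_left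
  let g' : Γ(A, W) := resM A inf_le_right g
  have hg' : IsGenerator A g' := hg.res inf_le_right
  have e₁' : (idealIncl X {q}).app W (resM _ hle u) = secO 1 := by
    rw [app_resM, e₁, resM_secO, resO_one]
  have hm := map_mulIdeal_pullSec f e g' (resM _ hle u) e₁'
  rw [map_one, one_smul] at hm
  have hγ : IsGenerator B (e.hom.app (f ⁻¹ᵁ W) (pullSec f A g')) := (hg'.pullSec f _).map_iso e
  refine ⟨f ⁻¹ᵁ W, _, _, hyW, (hg'.tmul (hu.res hle)).pullSec f W, hγ, hm, ?_⟩
  intro V' hV' b hb0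
  rw [hm] at hb0
  exact hγ.smul_eq_zero hV' hb0

end Twist
end NodalPruning

/-! ### The twisted line bundle on the pruned curve -/

namespace NodalPruning

namespace Pair
variable {k : Type u} [Field k] {P : Pair k} {T U : Set P.C} {p : P.C}

lemma IsLeaf.right_subset_range (leaf : P.IsLeaf T U p) (hP : P.IsNodalPair) :
    U ⊆ Set.range (P.removedι T) := by
  rw [range_removedι hP leaf.left_mem]
  exact Set.subset_sUnion_of_mem ⟨leaf.right_mem, leaf.ne⟩

/-- Once the leaf is removed, `U` is the only component through the attaching point, because the
local ring there is a domain. -/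
lemma IsLeaf.preimage_right_mem_nhds [IsAlgClosed k] (leaf : P.IsLeaf T U p) (hP : P.IsNodalPair)
    {q : P.removed T} (hq : P.removedι T q = p) (hs : IsSmoothPoint q) :
    P.removedι T ⁻¹' U ∈ nhds q := by
  have := hP.1.isProper
  have := noetherianSpace_of_isProper P.str
  have := isLocallyNoetherian_of_field (P.removedι T ≫ P.str)
  obtain ⟨_, -⟩ := hs
  have hUc : IsClosed (P.removedι T ⁻¹' U) :=
    (isClosed_of_mem_irreducibleComponents U leaf.right_mem).preimage (P.removedι T).continuous
  by_contra hU
  let 𝒮 : Set (Set P.C) := irreducibleComponents P.C \ {T, U}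
  have h𝒮 : 𝒮 ⊆ irreducibleComponents P.C := Set.sdiff_subset
  have hcl : closure (P.removedι T ⁻¹' U)ᶜ ⊆ P.removedι T ⁻¹' ⋃₀ 𝒮 := by
    refine closure_minimal (fun c hc => ?_)
      ((isClosed_sUnion_of_subset_components h𝒮).preimage (P.removedι T).continuous)
    have h1 : P.removedι T c ∈ ⋃₀ (irreducibleComponents P.C \ {T}) := by
      rw [← range_removedι hP leaf.left_mem]; exact ⟨c, rfl⟩
    obtain ⟨V, ⟨hV, hVT⟩, hcV⟩ := h1
    refine ⟨V, ⟨hV, ?_⟩, hcV⟩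
    rintro (h | h)
    · exact hVT h
    · obtain rfl : V = U := h
      exact hc hcV
  have hcU : q ∈ closure (P.removedι T ⁻¹' U)ᶜ := by
    rw [closure_compl]
    exact fun h => hU (mem_interior_iff_mem_nhds.1 h)
  have hr₁ := range_reducedSubι (P.removed T) (P.removedι T ⁻¹' U)
  have hr₂ := range_reducedSubι (P.removed T) (P.removedι T ⁻¹' U)ᶜ
  rw [hUc.closure_eq] at hr₁
  obtain ⟨z₁, h₁⟩ : q ∈ Set.range (reducedSubι (P.removed T) (P.removedι T ⁻¹' U)) := by
    rw [hr₁]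
    exact (show P.removedι T q ∈ U from hq ▸ leaf.mem)
  obtain ⟨z₂, h₂⟩ : q ∈ Set.range (reducedSubι (P.removed T) (P.removedι T ⁻¹' U)ᶜ) := by
    rw [hr₂]; exact hcU
  rcases mem_nhds_or_mem_nhds (reducedSubι (P.removed T) (P.removedι T ⁻¹' U))
    (reducedSubι (P.removed T) (P.removedι T ⁻¹' U)ᶜ) (by
      rw [hr₁, hr₂]
      exact Set.eq_univ_of_forall fun c =>
        (em (c ∈ P.removedι T ⁻¹' U)).imp id fun h => subset_closure h) h₁ h₂ with h | h
  · exact hU (hr₁ ▸ h)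
  · rw [hr₂] at h
    have h3 := Filter.mem_of_superset h hcl
    rw [(P.removedι T).isClosedEmbedding.isInducing.nhds_eq_comap, hq] at h3
    obtain ⟨N, hN, hNS⟩ := h3
    obtain ⟨N', hN'N, hN'o, hpN'⟩ := mem_nhds_iff.1 hN
    have h4 : U ∩ N' ⊆ ⋃₀ 𝒮 := by
      rintro x ⟨hxU, hxN⟩
      obtain ⟨c, rfl⟩ := leaf.right_subset_range hP hxU
      exact hNS (hN'N hxN)
    have h5 : U ⊆ ⋃₀ 𝒮 := (subset_closure_inter_of_isPreirreducible_of_isOpen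
      leaf.right_mem.1.2 hN'o ⟨p, leaf.mem, hpN'⟩).trans
      ((isClosed_sUnion_of_subset_components h𝒮).closure_subset_iff.2 h4)
    exact not_subset_sUnion h𝒮 leaf.right_mem (fun h => h.2 (Or.inr rfl)) h5

variable [IsAlgClosed k]

/-- The restriction of the twisted line bundle to `U` is the twist of the restriction. -/
theorem IsLeaf.nonempty_twist_iso (leaf : P.IsLeaf T U p) (hP : P.IsNodalPair) :
    Nonempty (restrictTo (reducedSubι (P.removed T) (P.removedι T ⁻¹' U)) (P.pruneTwist T p).L ≅
      tensor
        (restrictTo (reducedSubι (P.removed T) (P.removedι T ⁻¹' U) ≫ P.removedι T) P.L)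
        (idealSheaf (reducedSub (P.removed T) (P.removedι T ⁻¹' U))
          ((reducedSubι (P.removed T) (P.removedι T ⁻¹' U) ≫ P.removedι T) ⁻¹' {p}))) := by
  have := hP.1.isProper
  have := isLocallyNoetherian_of_field (P.removedι T ≫ P.str)
  have := isLocallyNoetherian_of_field
    (reducedSubι (P.removed T) (P.removedι T ⁻¹' U) ≫ P.removedι T ≫ P.str)
  obtain ⟨t, q, ht, hq, hs, -⟩ := leaf.exists_points hP
  have hn := leaf.preimage_right_mem_nhds hP hq hs
  have hr : Set.range (reducedSubι (P.removed T) (P.removedι T ⁻¹' U)) ∈ nhds q := by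
    rw [range_reducedSubι]
    exact Filter.mem_of_superset hn subset_closure
  obtain ⟨z, hz⟩ := mem_of_mem_nhds hr
  have h1 := nonempty_restrict_twist_iso (reducedSubι (P.removed T) (P.removedι T ⁻¹' U))
    (hP.2.pullback (P.removedι T)) ((Scheme.Modules.pullbackComp
      (reducedSubι (P.removed T) (P.removedι T ⁻¹' U)) (P.removedι T)).app P.L)
    (leaf.isClosed_point hP hq) hs hz (stalkTo_bijective_of_mem_nhds _ hz hr)
  have h2 : (reducedSubι (P.removed T) (P.removedι T ⁻¹' U) ≫ P.removedι T) ⁻¹' {p} = {z} := by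
    have h3 : (reducedSubι (P.removed T) (P.removedι T ⁻¹' U) ≫ P.removedι T) ⁻¹' {p} =
        reducedSubι (P.removed T) (P.removedι T ⁻¹' U) ⁻¹' (P.removedι T ⁻¹' {p}) := by
      ext y
      simp
    rw [h3, preimage_singleton_removedι hq, ← hz]
    ext y
    exact (reducedSubι (P.removed T) (P.removedι T ⁻¹' U)).isClosedEmbedding.injective.eq_iff
  rw [← preimage_singleton_removedι hq, ← h2] at h1
  exact h1

/-- The twist does not affect the components other than `U`, as they do not contain the point. -/
theorem IsLeaf.nonempty_restrict_iso (leaf : P.IsLeaf T U p) (hP : P.IsNodalPair) :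
    Nonempty (restrictTo (reducedSubι (P.removed T) (P.removedι T ⁻¹' U)ᶜ) (P.pruneTwist T p).L ≅
      restrictTo (reducedSubι (P.removed T) (P.removedι T ⁻¹' U)ᶜ ≫ P.removedι T) P.L) := by
  obtain ⟨t, q, ht, hq, hs, -⟩ := leaf.exists_points hP
  have hn := leaf.preimage_right_mem_nhds hP hq hs
  have h1 := nonempty_restrict_twist_iso_of_not_mem
    (reducedSubι (P.removed T) (P.removedι T ⁻¹' U)ᶜ)
    (hP.2.pullback (P.removedι T)) ((Scheme.Modules.pullbackComp
      (reducedSubι (P.removed T) (P.removedι T ⁻¹' U)ᶜ) (P.removedι T)).app P.L)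
    (leaf.isClosed_point hP hq) (by
      rw [range_reducedSubι, closure_compl]
      exact fun h => h (mem_interior_iff_mem_nhds.2 hn))
  rw [← preimage_singleton_removedι hq] at h1
  exact h1

theorem Prunes.isNodalPair_and_h0 {P Q : Pair k} {j : Q.C ⟶ P.C} {n : ℕ} (h : Prunes P Q j n)
    (hP : P.IsNodalPair) : Q.IsNodalPair ∧ P.h0 = Q.h0 + (n : Cardinal) := by
  induction h with
  | refl P => exact ⟨hP, by simp⟩
  | restrict d leaf deg tail ih =>
    obtain ⟨hQ, e⟩ := ih (leaf.isNodalPair_pruneRestrict hP)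
    refine ⟨hQ, ?_⟩
    rw [leaf.h0_pruneRestrict hP (deg ▸ Int.natCast_nonneg d), e, deg, Int.toNat_natCast,
      Nat.cast_add, add_assoc, add_comm (d : Cardinal)]
  | twist leaf deg tail ih =>
    obtain ⟨hQ, e⟩ := ih (leaf.isNodalPair_pruneTwist hP)
    exact ⟨hQ, (leaf.h0_pruneTwist hP deg).trans e⟩

end Pair
end NodalPruning

/-! ### Removing rational trees -/

namespace NodalPruning

section ClosedEmbedding
open Set
variable {α β : Type*} [TopologicalSpace α] [TopologicalSpace β] {f : β → α}

/-- A subset of a subspace that is irreducible in the ambient space is irreducible. -/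
lemma isIrreducible_of_image (hf : Topology.IsInducing f) {s : Set β} (h : IsIrreducible (f '' s)) :
    IsIrreducible s := by
  refine ⟨image_nonempty.1 h.1, ?_⟩
  intro u v hu hv hsu hsv
  obtain ⟨u, hu', rfl⟩ := hf.isOpen_iff.1 hu
  obtain ⟨v, hv', rfl⟩ := hf.isOpen_iff.1 hv
  obtain ⟨x, hx, hxu⟩ := hsu
  obtain ⟨y, hy, hyv⟩ := hsv
  obtain ⟨_, ⟨z, hz, rfl⟩, hzu, hzv⟩ := h.2 u v hu' hv' ⟨f x, ⟨x, hx, rfl⟩, hxu⟩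
    ⟨f y, ⟨y, hy, rfl⟩, hyv⟩
  exact ⟨z, hz, hzu, hzv⟩

/-- The irreducible components of a union of irreducible components. -/
lemma irreducibleComponents_of_range_eq [NoetherianSpace α] (hf : Topology.IsClosedEmbedding f)
    {𝒮 : Set (Set α)} (h𝒮 : 𝒮 ⊆ irreducibleComponents α) (hr : range f = ⋃₀ 𝒮) :
    irreducibleComponents β = preimage f '' 𝒮 := by
  have hmem : ∀ V ∈ 𝒮, f '' (f ⁻¹' V) = V := fun V hV =>
    image_preimage_eq_of_subset (hr ▸ subset_sUnion_of_mem hV)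
  have hirr : ∀ V ∈ 𝒮, IsIrreducible (f ⁻¹' V) := fun V hV =>
    isIrreducible_of_image hf.isInducing (by rw [hmem V hV]; exact (h𝒮 hV).1)
  refine Subset.antisymm (fun A hA => ?_) ?_
  · have h1 : IsIrreducible (f '' A) := hA.1.image f hf.continuous.continuousOn
    have hfin : 𝒮.Finite := NoetherianSpace.finite_irreducibleComponents.subset h𝒮
    obtain ⟨V, hV, hAV⟩ := isIrreducible_iff_sUnion_isClosed.1 h1 hfin.toFinset
      (fun W hW => isClosed_of_mem_irreducibleComponents W (h𝒮 (hfin.mem_toFinset.1 hW)))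
      (by rw [hfin.coe_toFinset, ← hr]; exact image_subset_range f A)
    rw [hfin.mem_toFinset] at hV
    have h2 : A ⊆ f ⁻¹' V := image_subset_iff.1 hAV
    exact ⟨V, hV, (hA.2 (hirr V hV) h2).antisymm h2⟩
  · rintro _ ⟨V, hV, rfl⟩
    refine ⟨hirr V hV, fun B hB hVB => image_subset_iff.1 ?_⟩
    refine (h𝒮 hV).2 (hB.image f hf.continuous.continuousOn) ?_
    rw [← hmem V hV]
    exact image_mono hVB

end ClosedEmbedding

namespace Pair
open Set
variable {k : Type u} [Field k] {P : Pair k} {𝒯 : Set (Set P.C)} {T U : Set P.C} {p : P.C}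

/-- The reduced structure on a closed set does not change if the curve is replaced by a closed
subscheme that contains the set. -/
lemma isRational_preimage {P' : Pair k} {f : P'.C ⟶ P.C} [IsClosedImmersion f]
    (hf : f ≫ P.str = P'.str) {V : Set P.C} (hV : IsClosed V) (hVf : V ⊆ range f)
    (h : P.IsRational V) : P'.IsRational (f ⁻¹' V) := by
  obtain ⟨e, he⟩ := h
  have hr : range (reducedSubι P'.C (f ⁻¹' V) ≫ f) = range (reducedSubι P.C V) := by
    rw [range_reducedSubι, hV.closure_eq]
    have h1 : range (reducedSubι P'.C (f ⁻¹' V) ≫ f) = f '' range (reducedSubι P'.C (f ⁻¹' V)) := by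
      rw [← range_comp]
      congr 1
    rw [h1, range_reducedSubι, (hV.preimage f.continuous).closure_eq,
      image_preimage_eq_of_subset hVf]
  obtain ⟨e', he'⟩ := exists_iso_of_range_eq (reducedSubι P'.C (f ⁻¹' V) ≫ f) (reducedSubι P.C V) hr
  refine ⟨e' ≪≫ e, ?_⟩
  rw [Iso.trans_hom, Category.assoc, he, ← Category.assoc, he', Category.assoc, hf]

lemma IsRationalTree.finite [NoetherianSpace P.C] (h : P.IsRationalTree 𝒯 U p) : 𝒯.Finite :=
  NoetherianSpace.finite_irreducibleComponents.subset h.subset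

/-- A tree with more than one member has a member `T` that is a leaf of the curve, such that the
attaching point of the tree also lies on another member. -/
lemma IsRationalTree.exists_leaf [NoetherianSpace P.C] (h : P.IsRationalTree 𝒯 U p)
    (hn : 𝒯.Nontrivial) : ∃ (T : 𝒯) (N : Set P.C) (q : P.C), P.IsLeaf T N q ∧
      (∃! N, (P.meetGraph 𝒯).Adj T N) ∧ p ∈ ⋃₀ (𝒯 \ {(T : Set P.C)}) := by
  classical
  have := h.finite.fintype
  have := Set.nontrivial_coe_sort.2 hn
  have : Fintype (P.meetGraph 𝒯).edgeSet := Fintype.ofFinite _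
  have : (P.meetGraph 𝒯).LocallyFinite := fun v => Fintype.ofFinite _
  obtain ⟨T₀, hT₀, hpT₀⟩ := (h.inter_eq.ge rfl).1
  -- choose a leaf of the tree different from a member through the attaching point
  obtain ⟨T, hne, hdeg⟩ : ∃ T : 𝒯, T ≠ ⟨T₀, hT₀⟩ ∧ (P.meetGraph 𝒯).degree T = 1 := by
    obtain ⟨A, B, hAB, hA, hB⟩ := h.isTree.exists_ne_and_degree_eq_one
    by_cases hA0 : A = ⟨T₀, hT₀⟩
    · exact ⟨B, fun hB0 => hAB (hA0.trans hB0.symm), hB⟩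
    · exact ⟨A, hA0, hA⟩
  rw [SimpleGraph.degree_eq_one_iff_existsUnique_adj] at hdeg
  have hne' : T₀ ≠ (T : Set P.C) := fun h => hne (Subtype.ext h.symm)
  obtain ⟨N, ⟨hTN, q, hqT, hqN⟩, hN⟩ := hdeg
  have hTN' : (N : Set P.C) ≠ (T : Set P.C) := fun h => hTN (Subtype.ext h.symm)
  refine ⟨T, N, q, ⟨h.subset T.2, h.subset N.2, hTN', h.isRational T T.2, ?_, hqN⟩,
    ⟨N, ⟨hTN, q, hqT, hqN⟩, hN⟩, ⟨T₀, ⟨hT₀, hne'⟩, hpT₀⟩⟩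
  have key : ∀ V : 𝒯, V ≠ T → ∀ x ∈ (T : Set P.C), x ∈ (V : Set P.C) → x = q := by
    intro V hVT x hxT hxV
    obtain rfl := hN V ⟨hVT.symm, x, hxT, hxV⟩
    exact h.simple T T.2 V V.2 hTN'.symm ⟨hxT, hxV⟩ ⟨hqT, hqN⟩
  refine Subset.antisymm ?_ (singleton_subset_iff.2 ⟨hqT, N, ⟨h.subset N.2, hTN'⟩, hqN⟩)
  rintro x ⟨hxT, V, ⟨hV, hVT⟩, hxV⟩
  by_cases hV𝒯 : V ∈ 𝒯
  · exact key ⟨V, hV𝒯⟩ (fun h => hVT congr(($h : Set P.C))) x hxT hxV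
  · obtain rfl : x = p := h.inter_eq.le ⟨⟨T, T.2, hxT⟩, ⟨V, ⟨hV, hV𝒯⟩, hxV⟩⟩
    exact key ⟨T₀, hT₀⟩ hne.symm x hxT hpT₀

lemma preimage_injOn {P' : Pair k} {f : P'.C ⟶ P.C}
    (hr : range f = ⋃₀ (irreducibleComponents P.C \ {T})) :
    InjOn (preimage f) (irreducibleComponents P.C \ {T}) := by
  intro V hV W hW h
  have hVf : V ⊆ range f := hr ▸ subset_sUnion_of_mem hV
  have hWf : W ⊆ range f := hr ▸ subset_sUnion_of_mem hW
  rw [← image_preimage_eq_of_subset hVf, ← image_preimage_eq_of_subset hWf, h]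

lemma sUnion_image_preimage {P' : Pair k} {f : P'.C ⟶ P.C} (𝒮 : Set (Set P.C)) :
    ⋃₀ (preimage f '' 𝒮) = f ⁻¹' ⋃₀ 𝒮 := by
  rw [sUnion_image, preimage_sUnion]

section Transfer
variable [NoetherianSpace P.C] {P' : Pair k} {f : P'.C ⟶ P.C} [IsClosedImmersion f]

lemma components_diff_image (h𝒯 : 𝒯 ⊆ irreducibleComponents P.C) (hT : T ∈ 𝒯)
    (hr : range f = ⋃₀ (irreducibleComponents P.C \ {T})) :
    irreducibleComponents P'.C \ (preimage f '' (𝒯 \ {T})) =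
      preimage f '' (irreducibleComponents P.C \ 𝒯) := by
  rw [irreducibleComponents_of_range_eq f.isClosedEmbedding sdiff_subset hr,
    ← (preimage_injOn hr).image_sdiff_subset (sdiff_subset_sdiff_left h𝒯)]
  congr 1
  ext V
  constructor
  · rintro ⟨⟨hV, hVT⟩, hV'⟩
    exact ⟨hV, fun h => hV' ⟨h, hVT⟩⟩
  · rintro ⟨hV, hV'⟩
    exact ⟨⟨hV, fun h => hV' (h ▸ hT)⟩, fun h => hV' h.1⟩

/-- Removing a leaf of the tree from the curve leaves a tree. -/
lemma IsRationalTree.remove_leaf (h : P.IsRationalTree 𝒯 U p) (hf : f ≫ P.str = P'.str) {T : 𝒯}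
    (hr : range f = ⋃₀ (irreducibleComponents P.C \ {(T : Set P.C)}))
    (hT : ∃! N, (P.meetGraph 𝒯).Adj T N) (hp : p ∈ ⋃₀ (𝒯 \ {(T : Set P.C)})) {p' : P'.C}
    (hp' : f p' = p) :
    P'.IsRationalTree (preimage f '' (𝒯 \ {(T : Set P.C)})) (f ⁻¹' U) p' := by
  classical
  have hcomp := irreducibleComponents_of_range_eq f.isClosedEmbedding sdiff_subset hr
  have hVf : ∀ V ∈ irreducibleComponents P.C \ {(T : Set P.C)}, V ⊆ range f := fun V hV =>
    hr ▸ subset_sUnion_of_mem hV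
  have hsub : 𝒯 \ {(T : Set P.C)} ⊆ irreducibleComponents P.C \ {(T : Set P.C)} :=
    sdiff_subset_sdiff_left h.subset
  refine ⟨?_, ?_, ?_, ?_, ?_, ?_, ?_⟩
  · rw [hcomp]
    exact image_mono hsub
  · rintro _ ⟨V, hV, rfl⟩
    exact isRational_preimage hf (isClosed_of_mem_irreducibleComponents V (h.subset hV.1))
      (hVf V (hsub hV)) (h.isRational V hV.1)
  · have : Fintype ((P.meetGraph 𝒯).neighborSet T) := by
      have := h.finite.fintype
      exact Fintype.ofFinite _
    have hconn := h.isTree.connected.induce_compl_singleton_of_degree_eq_one (v := T)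
      (SimpleGraph.degree_eq_one_iff_existsUnique_adj.2 hT)
    have htree : ((P.meetGraph 𝒯).induce {T}ᶜ).IsTree := ⟨hconn, h.isTree.isAcyclic.induce _⟩
    let F : ({T}ᶜ : Set 𝒯) → (preimage f '' (𝒯 \ {(T : Set P.C)}) : Set (Set P'.C)) := fun V =>
      ⟨f ⁻¹' V.1, V.1, ⟨V.1.2, fun h => V.2 (Subtype.ext h)⟩, rfl⟩
    have hmem : ∀ V : ({T}ᶜ : Set 𝒯), (V.1 : Set P.C) ∈ 𝒯 \ {(T : Set P.C)} := fun V =>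
      ⟨V.1.2, fun h => V.2 (Subtype.ext h)⟩
    have hF : Function.Bijective F := by
      constructor
      · intro V W hVW
        exact Subtype.ext (Subtype.ext (preimage_injOn hr (hsub (hmem V)) (hsub (hmem W))
          congr(($hVW : Set P'.C))))
      · rintro ⟨_, V, hV, rfl⟩
        exact ⟨⟨⟨V, hV.1⟩, fun h => hV.2 congr(($h : Set P.C))⟩, rfl⟩
    refine (SimpleGraph.Iso.isTree_iff
      (⟨Equiv.ofBijective F hF, ?_⟩ : (P.meetGraph 𝒯).induce {T}ᶜ ≃g P'.meetGraph _)).1 htree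
    intro V W
    change (F V ≠ F W ∧ (f ⁻¹' (V.1 : Set P.C) ∩ f ⁻¹' (W.1 : Set P.C)).Nonempty) ↔
      (V.1 ≠ W.1 ∧ ((V.1 : Set P.C) ∩ W.1).Nonempty)
    rw [hF.1.ne_iff, ← preimage_inter, Subtype.coe_ne_coe]
    refine and_congr_right fun _ => ⟨fun ⟨x, hx⟩ => ⟨f x, hx⟩, fun ⟨x, hx⟩ => ?_⟩
    obtain ⟨y, rfl⟩ := hVf _ (hsub (hmem V)) hx.1
    exact ⟨y, hx⟩
  · rintro _ ⟨V, hV, rfl⟩ _ ⟨W, hW, rfl⟩ hne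
    have hVW : V ≠ W := fun h => hne (by rw [h])
    intro x hx y hy
    exact f.isClosedEmbedding.injective (h.simple V hV.1 W hW.1 hVW hx hy)
  · rw [components_diff_image h.subset T.2 hr]
    exact ⟨U, h.right_mem, rfl⟩
  · rw [components_diff_image h.subset T.2 hr, sUnion_image_preimage, sUnion_image_preimage]
    ext x
    rw [mem_singleton_iff]
    constructor
    · rintro ⟨⟨V, hV, hxV⟩, hx⟩
      have h1 : f x = p := h.inter_eq.le ⟨⟨V, hV.1, hxV⟩, hx⟩
      exact f.isClosedEmbedding.injective (h1.trans hp'.symm)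
    · rintro rfl
      subst hp'
      exact ⟨hp, (h.inter_eq.ge rfl).2⟩
  · exact (show f p' ∈ U from hp' ▸ h.mem)

end Transfer

variable [IsAlgClosed k]

/-- A leaf of any degree can be pruned. -/
lemma IsLeaf.exists_prune (leaf : P.IsLeaf T U p) (hP : P.IsNodalPair) :
    ∃ (P' : Pair k) (f : P'.C ⟶ P.C), IsClosedImmersion f ∧ f ≫ P.str = P'.str ∧
      range f = ⋃₀ (irreducibleComponents P.C \ {T}) ∧ P'.IsNodalPair ∧
      ∀ (Q : Pair k) (j : Q.C ⟶ P'.C) (n : ℕ), Prunes P' Q j n → ∃ n', Prunes P Q (j ≫ f) n' := by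
  by_cases hd : 0 ≤ P.degreeOn T
  · exact ⟨P.pruneRestrict T, P.removedι T, inferInstanceAs (IsClosedImmersion (reducedSubι _ _)),
      rfl, range_removedι hP leaf.left_mem, leaf.isNodalPair_pruneRestrict hP,
      fun Q j n h => ⟨_, .restrict (P.degreeOn T).toNat leaf (Int.toNat_of_nonneg hd).symm h⟩⟩
  · exact ⟨P.pruneTwist T p, P.removedι T, inferInstanceAs (IsClosedImmersion (reducedSubι _ _)),
      rfl, range_removedι hP leaf.left_mem, leaf.isNodalPair_pruneTwist hP,
      fun Q j n h => ⟨_, .twist leaf (not_le.1 hd) h⟩⟩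

/-- A rational tree is removed by pruning its leaves one after the other, the member through the
attaching point last. -/
theorem IsRationalTree.exists_prunes (hP : P.IsNodalPair) (h : P.IsRationalTree 𝒯 U p) :
    ∃ (Q : Pair k) (j : Q.C ⟶ P.C) (n : ℕ), Pair.Prunes P Q j n ∧
      range j = ⋃₀ (irreducibleComponents P.C \ 𝒯) := by
  induction hc : 𝒯.ncard using Nat.strong_induction_on generalizing P with
  | _ c ih =>
  subst hc
  have := hP.1.isProper
  have := noetherianSpace_of_isProper P.str
  by_cases hn : 𝒯.Nontrivial
  · obtain ⟨T, N, q, leaf, hT, hp⟩ := h.exists_leaf hn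
    obtain ⟨P', f, _, hf, hr, hP', hprune⟩ := leaf.exists_prune hP
    have hpf : p ∈ range f := by
      rw [hr]
      exact sUnion_subset_sUnion (sdiff_subset_sdiff_left h.subset) hp
    obtain ⟨p', hp'⟩ := hpf
    have h' := h.remove_leaf hf hr hT hp hp'
    have hlt : (preimage f '' (𝒯 \ {(T : Set P.C)})).ncard < 𝒯.ncard :=
      (ncard_image_le h.finite.sdiff).trans_lt (ncard_sdiff_singleton_lt_of_mem T.2 h.finite)
    obtain ⟨Q, j, n, hj, hrj⟩ := ih _ hlt hP' h' rfl
    obtain ⟨n', hn'⟩ := hprune Q j n hj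
    refine ⟨Q, j ≫ f, n', hn', ?_⟩
    have h1 : range (j ≫ f) = f '' range j := by
      rw [← range_comp]
      congr 1
    rw [h1, hrj, components_diff_image h.subset T.2 hr, sUnion_image_preimage,
      image_preimage_eq_of_subset]
    rw [hr]
    exact sUnion_subset_sUnion fun V hV => ⟨hV.1, fun h => hV.2 (h ▸ T.2)⟩
  · obtain ⟨T, hT, hpT⟩ := (h.inter_eq.ge rfl).1
    have h𝒯 : 𝒯 = {T} := (not_nontrivial_iff.1 hn).eq_singleton_of_mem hT
    subst h𝒯
    have leaf : P.IsLeaf T U p := by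
      refine ⟨h.subset rfl, h.right_mem.1, h.right_mem.2, h.isRational T rfl, ?_, h.mem⟩
      have := h.inter_eq
      rwa [sUnion_singleton] at this
    obtain ⟨P', f, -, -, hr, -, hprune⟩ := leaf.exists_prune hP
    obtain ⟨n, hn⟩ := hprune P' _ 0 (.refl P')
    exact ⟨P', _, n, hn, by rw [Category.id_comp, hr]⟩

end Pair
end NodalPruning

end

open NodalPruning in
theorem mainTheorem2 {k : Type u} [Field k] [IsAlgClosed k] (P : Pair k) (hP : P.IsNodalPair) :
    -- pruning a single leaf `T`, attached to `U` at `p`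
    (∀ (T U : Set P.C) (p : P.C), P.IsLeaf T U p →
      (0 ≤ P.degreeOn T →
        (P.pruneRestrict T).IsNodalPair ∧
        P.h0 = (P.pruneRestrict T).h0 + ((P.degreeOn T).toNat : Cardinal)) ∧
      (P.degreeOn T < 0 →
        (P.pruneTwist T p).IsNodalPair ∧
        P.h0 = (P.pruneTwist T p).h0 ∧
        -- the restriction of the new bundle to `U` is `L|_U ⊗ 𝒪_U(-p)`
        Nonempty (restrictTo (reducedSubι (P.removed T) (P.removedι T ⁻¹' U)) (P.pruneTwist T p).L ≅
          tensor
            (restrictTo (reducedSubι (P.removed T) (P.removedι T ⁻¹' U) ≫ P.removedι T) P.L)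
            (idealSheaf (reducedSub (P.removed T) (P.removedι T ⁻¹' U))
              ((reducedSubι (P.removed T) (P.removedι T ⁻¹' U) ≫ P.removedι T) ⁻¹' {p}))) ∧
        -- the new bundle agrees with `L` on the union of the components other than `T` and `U`
        Nonempty (restrictTo (reducedSubι (P.removed T) (P.removedι T ⁻¹' U)ᶜ) (P.pruneTwist T p).L ≅
          restrictTo (reducedSubι (P.removed T) (P.removedι T ⁻¹' U)ᶜ ≫ P.removedι T) P.L))) ∧
    -- iterating
    (∀ (Q : Pair k) (j : Q.C ⟶ P.C) (n : ℕ), Pair.Prunes P Q j n →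
      Q.IsNodalPair ∧ P.h0 = Q.h0 + (n : Cardinal)) ∧
    -- whole rational trees can be removed
    (∀ (𝒯 : Set (Set P.C)) (U : Set P.C) (p : P.C), P.IsRationalTree 𝒯 U p →
      ∃ (Q : Pair k) (j : Q.C ⟶ P.C) (n : ℕ), Pair.Prunes P Q j n ∧
        Set.range j = ⋃₀ (irreducibleComponents P.C \ 𝒯)) := by
  refine ⟨fun T U p leaf => ⟨fun hd => ⟨leaf.isNodalPair_pruneRestrict hP, leaf.h0_pruneRestrict hP hd⟩,
    fun hd => ⟨leaf.isNodalPair_pruneTwist hP, leaf.h0_pruneTwist hP hd, leaf.nonempty_twist_iso hP,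
      leaf.nonempty_restrict_iso hP⟩⟩,
    fun Q j n h => h.isNodalPair_and_h0 hP, fun 𝒯 U p h => h.exists_prunes hP⟩
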